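/- Let $p$ be a prime number and $G$ a finite group. Let $G\text{-}\mathrm{sets}$ be the category of finite left $G$-sets, equipped with the sipp topology: a family of $G$-maps $\{\alpha_i:U_i\to X\}_{i\in I}$ is a covering if for every $x\in X$ there are $i\in I$ and $u\in U_i$ with $\alpha_i(u)=x$ and $[\mathrm{St}_G(x):\mathrm{St}_G(u)]$ prime to $p$; a single $G$-map $\alpha:U\to X$ is a cover if $\{\alpha\}$ is a covering. For a $G$-set $X$ let $G\ltimes X$ be its action groupoid (objects: the elements of $X$; morphisms $x\to x'$: the $g\in G$ with $gx=x'$). For a category $\mathcal A$ let $\mathrm{Rep}(X)=\mathcal A^{G\ltimes X}$ be the category of functors $G\ltimes X\to\mathcal A$, and for a $G$-map $\alpha:Y\to X$ let $\alpha^*:\mathrm{Rep}(X)\to\mathrm{Rep}(Y)$ be precomposition with $G\ltimes\alpha$. If $\mathcal A$ is abelian, let $\mathrm D(\mathrm{Rep}(X))$ be the (unbounded) derived category of $\mathrm{Rep}(X)$, with the functors induced degreewise by $\alpha^*$. If $\mathcal A=k\text{-}\mathrm{Vect}$ is the category of all vector spaces over a field $k$, let $\mathrm{StRep}(X)$ be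 the stable category, with the same objects as $\mathrm{Rep}(X)$ and with two morphisms identified when their difference factors through a projective object, with the functors induced by $\alpha^*$. A strict functor $\mathcal D:(G\text{-}\mathrm{sets})^{\mathrm{op}}\to\mathrm{Cat}$ is a strict stack for the sipp topology if for every sipp cover $\alpha:U\to X$ the functor $\mathcal D(X)\to\mathrm{Desc}_{\mathcal D}(\alpha)$, $V\mapsto(\alpha^*V,\mathrm{id})$, $f\mapsto\alpha^*f$, is an equivalence of categories. Here the objects of $\mathrm{Desc}_{\mathcal D}(\alpha)$ are the pairs $(W,s)$ of an object $W$ of $\mathcal D(U)$ and an isomorphism $s:\mathrm{pr}_2^*W\to\mathrm{pr}_1^*W$ in $\mathcal D(U\times_XU)$ such that $\mathrm{pr}_{13}^*s=\mathrm{pr}_{12}^*s\circ\mathrm{pr}_{23}^*s$ in $\mathcal D(U\times_XU\times_XU)$, and the morphisms $(W,s)\to(W',s')$ are the morphisms $f:W\to W'$ in $\mathcal D(U)$ with $\mathrm{pr}_1^*f\circ s=s'\circ\mathrm{pr}_2^*f$. Then the following are strict functors from $(G\text{-}\mathrm{sets})^{\mathrm{op}}$ to the category of additive categories and additive functors, and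 they are strict stacks for the sipp topology: (a) $\mathrm{Rep}(-)=\mathcal A^{G\ltimes-}$, for every idempotent-complete additive $\mathbb Z_{(p)}$-linear category $\mathcal A$; (b) $\mathrm D(\mathrm{Rep}(-))$, for every abelian $\mathbb Z_{(p)}$-linear category $\mathcal A$; (c) $\mathrm{StRep}(-)$, for $\mathcal A=k\text{-}\mathrm{Vect}$ with $k$ a field of characteristic $p$. -/

import Mathlib

namespace Sipp

open CategoryTheory Limits Opposite

universe w v u t

/-- The category of finite left `G`-sets and `G`-equivariant maps. -/
abbrev GSets (G : Type t) [Group G] := Action FintypeCat.{w} G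

section top

/-- The ideal of `ℤ` generated by a prime number is prime. -/
instance isPrime_span (p : ℕ) [Fact p.Prime] : (Ideal.span {(p : ℤ)}).IsPrime :=
  (Ideal.span_singleton_prime (by exact_mod_cast (Fact.out : p.Prime).ne_zero)).2
    (Nat.prime_iff_prime_int.1 Fact.out)

/-- The ring `ℤ_(p)`, i.e. the localization of `ℤ` at the prime ideal `(p)`. -/
abbrev ZLoc (p : ℕ) [Fact p.Prime] := Localization.AtPrime (Ideal.span {(p : ℤ)})

variable {G : Type t} [Group G]

theorem hom_smul {X Y : GSets.{w} G} (f : X ⟶ Y) (g : G) (x : X.V) :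
    f.hom (g • x) = g • f.hom x :=
  ConcreteCategory.congr_hom (f.comm g) x

theorem stabilizer_le {X Y : GSets.{w} G} (f : X ⟶ Y) (x : X.V) :
    MulAction.stabilizer G x ≤ MulAction.stabilizer G (f.hom x) := fun g hg => by
  rw [MulAction.mem_stabilizer_iff] at hg ⊢
  rw [← hom_smul, hg]

theorem exists_pullback {X Y Z : GSets.{w} G} (f : X ⟶ Z) (g : Y ⟶ Z) (x : X.V) (y : Y.V)
    (h : f.hom x = g.hom y) :
    ∃ z : (pullback f g).V, (pullback.fst f g).hom z = x ∧ (pullback.snd f g).hom z = y :=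
  Types.exists_of_isPullback
    ((IsPullback.of_hasPullback f g).map (Action.forget FintypeCat G ⋙ FintypeCat.incl)) x y h

theorem pullback_ext {X Y Z : GSets.{w} G} (f : X ⟶ Z) (g : Y ⟶ Z) (z z' : (pullback f g).V)
    (h₁ : (pullback.fst f g).hom z = (pullback.fst f g).hom z')
    (h₂ : (pullback.snd f g).hom z = (pullback.snd f g).hom z') : z = z' :=
  Types.ext_of_isPullback
    ((IsPullback.of_hasPullback f g).map (Action.forget FintypeCat G ⋙ FintypeCat.incl)) h₁ h₂

/-- A family `S` of `G`-maps to `X` is a sipp-covering if every `x : X` is the image of some `u`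
under a member of the family, with stabilizer of index `[St(x) : St(u)]` prime to `p`. -/
def IsSippCovering (p : ℕ) {X : GSets.{w} G} (S : Presieve X) : Prop :=
  ∀ x : X.V, ∃ (U : GSets.{w} G) (α : U ⟶ X), S α ∧ ∃ u : U.V, α.hom u = x ∧
    ((MulAction.stabilizer G u).relIndex (MulAction.stabilizer G x)).Coprime p

/-- If the index of the stabilizer of `u` in `H` is prime to `p` and `K ≤ H`, then some `H`-translate
of `u` has a stabilizer of index prime to `p` in `K`. -/
theorem exists_coprime (p : ℕ) [Fact p.Prime] {U : Type*} [Finite G] [MulAction G U] (u : U)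
    (H K : Subgroup G) (hKH : K ≤ H) (hc : ((MulAction.stabilizer G u).relIndex H).Coprime p) :
    ∃ h ∈ H, ((MulAction.stabilizer G (h • u)).relIndex K).Coprime p := by
  obtain ⟨Q⟩ := (inferInstance : Nonempty (Sylow p K))
  let Q' : Subgroup H := (Q : Subgroup K).map (Subgroup.inclusion hKH)
  have hQ' : IsPGroup p Q' := Q.2.map _
  have hs : MulAction.stabilizer H u = (MulAction.stabilizer G u).subgroupOf H := by
    ext g; rfl
  have hcard : ¬ p ∣ Nat.card (MulAction.orbit H u) := by
    have h := MulAction.index_stabilizer H u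
    rw [hs] at h
    rw [Nat.card_coe_set_eq, ← h]
    exact (Nat.Prime.coprime_iff_not_dvd Fact.out).1 hc.symm
  obtain ⟨⟨_, h, rfl⟩, hv⟩ := hQ'.nonempty_fixed_point_of_prime_not_dvd_card _ hcard
  refine ⟨h.1, h.2, Nat.Coprime.coprime_dvd_left ?_
    ((Nat.Prime.coprime_iff_not_dvd Fact.out).2 Q.not_dvd_index).symm⟩
  refine Subgroup.index_dvd_of_le fun q hq => ?_
  have := congrArg Subtype.val (hv ⟨_, Subgroup.mem_map_of_mem _ hq⟩)
  exact this

/-- The sipp topology on finite `G`-sets (more precisely, the basis given by the sipp-coverings). -/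
def sippTopology (G : Type t) [Group G] [Finite G] (p : ℕ) [Fact p.Prime] :
    Pretopology (GSets.{w} G) where
  coverings _ := {S | IsSippCovering p S}
  has_isos X Y f _ x := by
    have e : f.hom ((inv f).hom x) = x :=
      ConcreteCategory.congr_hom (congrArg Action.Hom.hom (IsIso.inv_hom_id f)) x
    refine ⟨Y, f, ⟨⟩, (inv f).hom x, e, ?_⟩
    have h : MulAction.stabilizer G ((inv f).hom x) = MulAction.stabilizer G x :=
      le_antisymm ((stabilizer_le f _).trans_eq (by rw [e])) (stabilizer_le (inv f) x)
    rw [h, Subgroup.relIndex_self]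
    exact Nat.coprime_one_left p
  pullbacks X Y f S hS y := by
    obtain ⟨U, α, hα, u, hu, hc⟩ := hS (f.hom y)
    obtain ⟨h, hh, hc'⟩ := exists_coprime p u _ _ (stabilizer_le f y) hc
    obtain ⟨z, hz₁, hz₂⟩ := exists_pullback α f (h • u) y (by
      rw [hom_smul, hu]; exact hh)
    refine ⟨_, pullback.snd α f, Presieve.pullbackArrows.mk _ _ hα, z, hz₂, ?_⟩
    have hz : MulAction.stabilizer G z =
        MulAction.stabilizer G (h • u) ⊓ MulAction.stabilizer G y := by
      refine le_antisymm (le_inf (hz₁ ▸ stabilizer_le _ z) (hz₂ ▸ stabilizer_le _ z)) ?_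
      rintro g ⟨h₁, h₂⟩
      refine pullback_ext _ _ _ _ ?_ ?_
      · rw [hom_smul, hz₁]; exact h₁
      · rw [hom_smul, hz₂]; exact h₂
    rw [hz, Subgroup.inf_relIndex_right]
    exact hc'
  transitive X S T hS hT x := by
    obtain ⟨U, α, hα, u, rfl, hc⟩ := hS x
    obtain ⟨V, β, hβ, v, rfl, hc'⟩ := hT α hα u
    refine ⟨V, β ≫ α, ⟨_, β, α, hα, hβ, rfl⟩, v, rfl, ?_⟩
    rw [← Subgroup.relIndex_mul_relIndex _ _ _ (stabilizer_le β v) (stabilizer_le α _)]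
    exact Nat.Coprime.mul_left hc' hc

end top
section descent
variable {C : Type u} [Category.{v} C] (D : Cᵒᵖ ⥤ Cat.{w, t})

/-- The restriction functor `f^* : D(X) ⥤ D(Y)` of a presheaf of categories along `f : Y ⟶ X`. -/
abbrev res {X Y : C} (f : Y ⟶ X) : D.obj (op X) ⥤ D.obj (op Y) := (D.map f.op).toFunctor

theorem res_obj_eq {X Y Z : C} {g : Z ⟶ Y} {f : Y ⟶ X} {h : Z ⟶ X} (w : g ≫ f = h)
    (V : D.obj (op X)) : (res D g).obj ((res D f).obj V) = (res D h).obj V := by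
  subst w
  simp [res]

theorem res_map_eq {X Y Z : C} {g : Z ⟶ Y} {f : Y ⟶ X} {h : Z ⟶ X} (w : g ≫ f = h)
    {V V' : D.obj (op X)} (φ : V ⟶ V') : (res D g).map ((res D f).map φ) =
      eqToHom (res_obj_eq D w V) ≫ (res D h).map φ ≫ eqToHom (res_obj_eq D w V').symm := by
  subst w
  simp only [res, op_comp]
  rw [Functor.congr_hom (congrArg Cat.Hom.toFunctor (D.map_comp f.op g.op)) φ]
  simp

/-- The morphism `g^* φ` for a morphism `φ : f₁^* V₁ ⟶ f₂^* V₂`, seen as a morphism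
`h₁^* V₁ ⟶ h₂^* V₂` through the equalities of functors `g^* f₁^* = h₁^*` and `g^* f₂^* = h₂^*`. -/
def pullHom {X₁ X₂ Y Z : C} {f₁ : Y ⟶ X₁} {f₂ : Y ⟶ X₂} {V₁ : D.obj (op X₁)} {V₂ : D.obj (op X₂)}
    (φ : (res D f₁).obj V₁ ⟶ (res D f₂).obj V₂) (g : Z ⟶ Y) {h₁ : Z ⟶ X₁} {h₂ : Z ⟶ X₂}
    (w₁ : g ≫ f₁ = h₁) (w₂ : g ≫ f₂ = h₂) :
    (res D h₁).obj V₁ ⟶ (res D h₂).obj V₂ :=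
  eqToHom (res_obj_eq D w₁ V₁).symm ≫ (res D g).map φ ≫ eqToHom (res_obj_eq D w₂ V₂)

section
variable [HasPullbacks C] {X U : C} (α : U ⟶ X)

/-- `U ×_X U`. -/
noncomputable abbrev dbl : C := pullback α α
/-- The first projection `U ×_X U ⟶ U`. -/
noncomputable abbrev pr₁ : dbl α ⟶ U := pullback.fst α α
/-- The second projection `U ×_X U ⟶ U`. -/
noncomputable abbrev pr₂ : dbl α ⟶ U := pullback.snd α α
/-- `U ×_X U ×_X U`, as the fibre product `(U ×_X U) ×_U (U ×_X U)` along `pr₂` and `pr₁`. -/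
noncomputable abbrev tpl : C := pullback (pr₂ α) (pr₁ α)
/-- The projection of the triple fibre product to the factors 1 and 2. -/
noncomputable abbrev pr₁₂ : tpl α ⟶ dbl α := pullback.fst (pr₂ α) (pr₁ α)
/-- The projection of the triple fibre product to the factors 2 and 3. -/
noncomputable abbrev pr₂₃ : tpl α ⟶ dbl α := pullback.snd (pr₂ α) (pr₁ α)
/-- The projection of the triple fibre product to the factors 1 and 3. -/
noncomputable abbrev pr₁₃ : tpl α ⟶ dbl α :=
  pullback.lift (pr₁₂ α ≫ pr₁ α) (pr₂₃ α ≫ pr₂ α) (by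
    have h : pr₁₂ α ≫ pr₂ α = pr₂₃ α ≫ pr₁ α := pullback.condition
    have h' : pr₁ α ≫ α = pr₂ α ≫ α := pullback.condition
    rw [Category.assoc, Category.assoc, h', ← Category.assoc, h, Category.assoc, h'])

/-- A (strict) descent datum for the presheaf of categories `D` and the cover `α : U ⟶ X`: an
object `W` of `D(U)` and a gluing isomorphism `s : pr₂^* W ≅ pr₁^* W` in `D(U ×_X U)` with
`pr₁₃^* s = pr₁₂^* s ∘ pr₂₃^* s` in `D(U ×_X U ×_X U)`. -/
structure DescentDatum where
  /-- the object over `U` -/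
  obj : D.obj (op U)
  /-- the gluing isomorphism -/
  glue : (res D (pr₂ α)).obj obj ≅ (res D (pr₁ α)).obj obj
  cocycle :
    pullHom D glue.hom (pr₁₃ α) (h₁ := pr₂₃ α ≫ pr₂ α) (h₂ := pr₁₂ α ≫ pr₁ α)
        (pullback.lift_snd _ _ _) (pullback.lift_fst _ _ _) =
      pullHom D glue.hom (pr₂₃ α) (h₁ := pr₂₃ α ≫ pr₂ α) (h₂ := pr₁₂ α ≫ pr₂ α)
          rfl pullback.condition.symm ≫
        pullHom D glue.hom (pr₁₂ α) (h₁ := pr₁₂ α ≫ pr₂ α) (h₂ := pr₁₂ α ≫ pr₁ α) rfl rfl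

variable {D α}

/-- A morphism of descent data: a morphism `f : W ⟶ W'` in `D(U)` such that
`pr₁^* f ∘ s = s' ∘ pr₂^* f`. -/
@[ext]
structure DescentDatum.Hom (W W' : DescentDatum D α) where
  /-- the underlying morphism over `U` -/
  hom : W.obj ⟶ W'.obj
  comm : W.glue.hom ≫ (res D (pr₁ α)).map hom = (res D (pr₂ α)).map hom ≫ W'.glue.hom

/-- The descent category of the cover `α`. -/
instance : Category (DescentDatum D α) where
  Hom := DescentDatum.Hom
  id W := ⟨𝟙 _, by simp⟩
  comp f g := ⟨f.hom ≫ g.hom, by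
    rw [Functor.map_comp, Functor.map_comp, reassoc_of% f.comm, g.comm, Category.assoc]⟩
  id_comp f := DescentDatum.Hom.ext (Category.id_comp _)
  comp_id f := DescentDatum.Hom.ext (Category.comp_id _)
  assoc f g h := DescentDatum.Hom.ext (Category.assoc _ _ _)

variable (D α)

/-- The comparison functor `Q` from `D(X)` to the descent category of `α : U ⟶ X`: it maps `V` to
`α^* V` with gluing isomorphism the identity of `pr₂^* α^* V = pr₁^* α^* V`. -/
noncomputable def comparison : D.obj (op X) ⥤ DescentDatum D α where
  obj V :=
    { obj := (res D α).obj V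
      glue := eqToIso ((res_obj_eq D pullback.condition.symm V).trans (res_obj_eq D rfl V).symm)
      cocycle := by simp [pullHom, eqToHom_map] }
  map {V V'} f :=
    { hom := (res D α).map f
      comm := by
        rw [res_map_eq D (g := pr₁ α) (f := α) rfl f,
          res_map_eq D (g := pr₂ α) (f := α) pullback.condition.symm f]
        simp }
  map_id V := DescentDatum.Hom.ext ((res D α).map_id V)
  map_comp f g := DescentDatum.Hom.ext ((res D α).map_comp f g)

end

/-- A presheaf of categories `D` on a site (a category with pullbacks and a basis `K` of a
topology) is a strict stack if for every cover `α : U ⟶ X` the comparison functor from `D(X)` to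
the descent category of `α` is an equivalence. -/
def IsStrictStack [HasPullbacks C] (K : Pretopology C) : Prop :=
  ∀ ⦃X U : C⦄ (α : U ⟶ X), Presieve.singleton α ∈ K X → (comparison D α).IsEquivalence

/-- `D` takes values in additive categories and additive functors. -/
def IsAdditivePresheaf : Prop :=
  ∃ _ : ∀ X : C, Preadditive (D.obj (op X)),
    (∀ X : C, HasFiniteProducts (D.obj (op X))) ∧
    ∀ ⦃X Y : C⦄ (f : Y ⟶ X), (res D f).Additive

end descent

section rep
variable {G : Type t} [Group G]

/-- The functor `G ⋉ α : G ⋉ X ⥤ G ⋉ Y` between action groupoids induced by a `G`-map `α`. -/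
def actionMap {X Y : GSets.{w} G} (α : X ⟶ Y) : ActionCategory G X.V ⥤ ActionCategory G Y.V where
  obj x := ⟨x.1, α.hom x.2⟩
  map {x _} g := ⟨g.1, (hom_smul α g.1 x.2).symm.trans (congrArg _ g.2)⟩

/-- The category `Rep(X)` of representations in `A` of the `G`-set `X`. -/
abbrev RepCat (A : Type u) [Category.{v} A] (X : GSets.{w} G) := ActionCategory G X.V ⥤ A

/-- The restriction functor `α^* : Rep(X) ⥤ Rep(Y)` along a `G`-map `α : Y ⟶ X`. -/
abbrev repRes (A : Type u) [Category.{v} A] {X Y : GSets.{w} G} (α : Y ⟶ X) :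
    RepCat A X ⥤ RepCat A Y :=
  (Functor.whiskeringLeft _ _ A).obj (actionMap α)

/-- The presheaf of categories `X ↦ Rep(X)`. -/
def Rep (G : Type t) [Group G] (A : Type u) [Category.{v} A] :
    (GSets.{w} G)ᵒᵖ ⥤ Cat.{max w v, max (max u v w) t} where
  obj X := Cat.of (RepCat A X.unop)
  map α := (repRes A α.unop).toCatHom
  map_id _ := rfl
  map_comp _ _ := rfl

end rep

section derived

/-- The derived category of an abelian category `C`: the complexes in `C`, with the
quasi-isomorphisms formally inverted. -/
abbrev Der (C : Type u) [Category.{v} C] [Abelian C] :=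
  (HomologicalComplex.quasiIso C (ComplexShape.up ℤ)).Localization

/-- The functor between derived categories given by applying an exact functor degreewise. -/
noncomputable def Der.map {C C' : Type*} [Category* C] [Category* C'] [Abelian C] [Abelian C']
    (F : C ⥤ C') [F.Additive] [F.PreservesHomology] : Der C ⥤ Der C' :=
  Localization.Construction.lift
    (F.mapHomologicalComplex (ComplexShape.up ℤ) ⋙ MorphismProperty.Q _)
    (fun _ _ f (_ : QuasiIso f) => MorphismProperty.Q_inverts _ _
      (HomologicalComplex.quasiIso_map_of_preservesHomology f F))

instance repRes_preservesHomology {G : Type t} [Group G] (A : Type u) [Category.{v} A]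
    [Abelian A] {X Y : GSets.{w} G} (α : Y ⟶ X) : (repRes A α).PreservesHomology :=
  have : PreservesFiniteLimits (repRes A α) := ⟨fun _ ↦ inferInstance⟩
  have : PreservesFiniteColimits (repRes A α) := ⟨fun _ ↦ inferInstance⟩
  inferInstance

theorem Der.fac {C C' : Type*} [Category* C] [Category* C'] [Abelian C] [Abelian C']
    (F : C ⥤ C') [F.Additive] [F.PreservesHomology] :
    MorphismProperty.Q _ ⋙ Der.map F =
      F.mapHomologicalComplex (ComplexShape.up ℤ) ⋙ MorphismProperty.Q _ :=
  Localization.Construction.fac _ _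

theorem Der.map_id (C : Type*) [Category* C] [Abelian C] : Der.map (𝟭 C) = 𝟭 (Der C) :=
  Localization.Construction.uniq _ _ (Localization.Construction.fac _ _)

theorem Der.map_comp {C C' C'' : Type*} [Category* C] [Category* C'] [Category* C'']
    [Abelian C] [Abelian C'] [Abelian C''] (F : C ⥤ C') (F' : C' ⥤ C'')
    [F.Additive] [F.PreservesHomology] [F'.Additive] [F'.PreservesHomology]
    [(F ⋙ F').PreservesHomology] : Der.map (F ⋙ F') = Der.map F ⋙ Der.map F' := by
  refine Localization.Construction.uniq _ _ ((Der.fac _).trans ?_)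
  rw [← Functor.assoc, Der.fac, Functor.assoc, Der.fac]
  rfl

/-- The presheaf of categories `X ↦ D(Rep(X))`. -/
noncomputable def DerRep (G : Type t) [Group G] (A : Type u) [Category.{v} A] [Abelian A] :
    (GSets.{w} G)ᵒᵖ ⥤ Cat.{max u v w t, max u v w t} where
  obj X := Cat.of (Der (RepCat A X.unop))
  map α := (Der.map (repRes A α.unop)).toCatHom
  map_id X := congrArg Functor.toCatHom (Der.map_id (RepCat A X.unop))
  map_comp f g := congrArg Functor.toCatHom (Der.map_comp (repRes A f.unop) (repRes A g.unop))

end derived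

section stable

/-- Two morphisms are stably equal if their difference factors through a projective object. -/
def stableRel (C : Type u) [Category.{v} C] [Preadditive C] : HomRel C := fun X Y f g =>
  ∃ (P : C) (_ : Projective P) (i : X ⟶ P) (q : P ⟶ Y), f - g = i ≫ q

/-- The stable category of `C`, i.e. its additive quotient by the projective objects. -/
abbrev Stab (C : Type u) [Category.{v} C] [Preadditive C] :=
  CategoryTheory.Quotient (stableRel C)

/-- The functor between stable categories induced by an additive functor that preserves
projective objects. -/
def Stab.map {C C' : Type*} [Category* C] [Category* C'] [Preadditive C] [Preadditive C']
    (F : C ⥤ C') [F.Additive] (hF : ∀ P : C, Projective P → Projective (F.obj P)) :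
    Stab C ⥤ Stab C' :=
  CategoryTheory.Quotient.lift _ (F ⋙ CategoryTheory.Quotient.functor _)
    fun _ _ _ _ ⟨P, hP, i, q, h⟩ =>
      CategoryTheory.Quotient.sound _ ⟨F.obj P, hF P hP, F.map i, F.map q, by
        rw [← F.map_sub, h, F.map_comp]⟩

variable {G : Type t} [Group G] {A : Type u} [Category.{v} A] [Abelian A]

/-! Restriction along a `G`-map `α : Y ⟶ X` preserves projective objects, because it has an exact
right adjoint, `(α_* N)_x = ⨁_{α y = x} N_y`. -/

section coind
variable {X Y : GSets.{w} G} (α : Y ⟶ X)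

/-- An element of a `G`-set, as an object of the action groupoid. -/
abbrev pt (y : Y.V) : ActionCategory G Y.V := ⟨(), y⟩

/-- The morphism of the action groupoid given by an element of `G`. -/
abbrev arr {y y' : ActionCategory G Y.V} (g : G) (h : g • y.back = y'.back) : y ⟶ y' := ⟨g, h⟩

/-- The fibre of `α` over `x`. -/
abbrev Fib (x : ActionCategory G X.V) := {y : Y.V // α.hom y = x.back}

instance (x : ActionCategory G X.V) : Finite (Fib α x) :=
  inferInstanceAs (Finite {y : Y.V // α.hom y = x.back})

theorem inv_mem_fib {x x' : ActionCategory G X.V} (g : x ⟶ x') (y : Fib α x') :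
    α.hom (g.1⁻¹ • y.1) = x.back := by
  rw [hom_smul, y.2, inv_smul_eq_iff]
  exact g.2.symm

variable (N : RepCat A Y)

instance (x : ActionCategory G X.V) : HasBiproduct fun y : Fib α x => N.obj (pt y.1) :=
  haveI := Abelian.hasFiniteBiproducts (C := A)
  inferInstance

/-- The action of a morphism of the action groupoid of `X` on `α_* N`. -/
noncomputable def coindMap {x x' : ActionCategory G X.V} (g : x ⟶ x') :
    (⨁ fun y : Fib α x => N.obj (pt y.1)) ⟶ (⨁ fun y : Fib α x' => N.obj (pt y.1)) :=
  biproduct.lift fun y =>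
    biproduct.π (fun y : Fib α x => N.obj (pt y.1)) ⟨g.1⁻¹ • y.1, inv_mem_fib α g y⟩ ≫
      N.map (arr g.1 (smul_inv_smul g.1 y.1))

theorem coindMap_π {x x' : ActionCategory G X.V} (g : x ⟶ x') (y : Fib α x) (y' : Fib α x')
    (h : g.1 • y.1 = y'.1) :
    coindMap α N g ≫ biproduct.π (fun y : Fib α x' => N.obj (pt y.1)) y' =
      biproduct.π (fun y : Fib α x => N.obj (pt y.1)) y ≫
        N.map (arr (y := pt y.1) (y' := pt y'.1) g.1 h) := by
  have hy : y = ⟨g.1⁻¹ • y'.1, inv_mem_fib α g y'⟩ :=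
    Subtype.ext ((inv_smul_smul g.1 y.1).symm.trans (congrArg _ h))
  subst hy
  exact biproduct.lift_π _ _

/-- The representation `α_* N`. -/
noncomputable def coind : RepCat A X where
  obj x := ⨁ fun y : Fib α x => N.obj (pt y.1)
  map g := coindMap α N g
  map_id x := by
    refine biproduct.hom_ext _ _ fun y => ?_
    rw [coindMap_π α N (𝟙 x) y y (one_smul G y.1)]
    exact (congrArg _ (N.map_id _)).trans ((Category.comp_id _).trans (Category.id_comp _).symm)
  map_comp {x x' x''} g g' := by
    refine biproduct.hom_ext _ _ fun y => ?_
    let y' : Fib α x' := ⟨g'.1⁻¹ • y.1, inv_mem_fib α g' y⟩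
    let y₀ : Fib α x := ⟨g.1⁻¹ • y'.1, inv_mem_fib α g y'⟩
    have h' : g'.1 • y'.1 = y.1 := smul_inv_smul _ _
    have h : g.1 • y₀.1 = y'.1 := smul_inv_smul _ _
    have h'' : (g ≫ g').1 • y₀.1 = y.1 :=
      (mul_smul g'.1 g.1 y₀.1).trans ((congrArg _ h).trans h')
    rw [Category.assoc, coindMap_π α N g' y' y h', ← Category.assoc, coindMap_π α N g y₀ y' h,
      coindMap_π α N (g ≫ g') y₀ y h'', Category.assoc, ← N.map_comp]
    rfl

end coind

theorem projective_repRes {X Y : GSets.{w} G} (α : Y ⟶ X) (P : RepCat A X) (hP : Projective P) :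
    Projective ((repRes A α).obj P) where
  factors {N M} f e _ := by
    have := Abelian.hasFiniteBiproducts (C := A)
    let e' : coind α N ⟶ coind α M :=
      { app x := biproduct.map fun y : Fib α x => e.app (pt y.1)
        naturality x x' g := by
          refine biproduct.hom_ext _ _ fun y => ?_
          have h : g.1 • (⟨g.1⁻¹ • y.1, inv_mem_fib α g y⟩ : Fib α x).1 = y.1 := smul_inv_smul _ _
          have h₁ := coindMap_π α N g _ y h
          have h₂ := coindMap_π α M g _ y h
          refine (Category.assoc _ _ _).trans ?_
          refine (congrArg (coindMap α N g ≫ ·) (biproduct.map_π _ _)).trans ?_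
          refine (Category.assoc _ _ _).symm.trans ((congrArg (· ≫ e.app (pt y.1)) h₁).trans ?_)
          refine Eq.trans ?_ ((congrArg (biproduct.map (fun y : Fib α x => e.app (pt y.1)) ≫ ·)
            h₂).symm.trans (Category.assoc _ _ _).symm)
          refine Eq.trans ?_ ((congrArg (· ≫ M.map (arr (y := pt (g.1⁻¹ • y.1)) (y' := pt y.1)
            g.1 h)) (biproduct.map_π (fun y : Fib α x => e.app (pt y.1))
            ⟨g.1⁻¹ • y.1, inv_mem_fib α g y⟩)).symm.trans (Category.assoc _ _ _))
          exact (Category.assoc _ _ _).trans ((congrArg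
            (biproduct.π (fun y : Fib α x => N.obj (pt y.1)) ⟨g.1⁻¹ • y.1, inv_mem_fib α g y⟩ ≫ ·)
            (e.naturality (arr (y := pt (g.1⁻¹ • y.1)) (y' := pt y.1) g.1 h))).trans (Category.assoc _ _ _).symm) }
    have : Epi e' := by
      rw [NatTrans.epi_iff_epi_app]
      intro x
      change Epi (biproduct.map fun y : Fib α x => e.app (pt y.1))
      infer_instance
    let f' : P ⟶ coind α M :=
      { app x := biproduct.lift fun y : Fib α x =>
          P.map (arr (y := x) (y' := pt (α.hom y.1)) 1 ((one_smul G _).trans y.2.symm)) ≫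
            f.app (pt y.1)
        naturality x x' g := by
          refine biproduct.hom_ext _ _ fun y => ?_
          have h : g.1 • (⟨g.1⁻¹ • y.1, inv_mem_fib α g y⟩ : Fib α x).1 = y.1 := smul_inv_smul _ _
          have h₂ := coindMap_π α M g _ y h
          refine (Category.assoc _ _ _).trans ?_
          refine (congrArg (P.map g ≫ ·) (biproduct.lift_π _ _)).trans ?_
          refine Eq.trans ?_ ((congrArg (biproduct.lift _ ≫ ·)
            h₂).symm.trans (Category.assoc _ _ _).symm)
          refine Eq.trans ?_ ((congrArg (· ≫ M.map (arr (y := pt (g.1⁻¹ • y.1)) (y' := pt y.1)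
            g.1 h)) (biproduct.lift_π (f := fun y : Fib α x => M.obj (pt y.1)) _
            ⟨g.1⁻¹ • y.1, inv_mem_fib α g y⟩)).symm.trans (Category.assoc _ _ _))
          refine Eq.trans ?_ ((congrArg (P.map _ ≫ ·) (f.naturality (arr (y := pt (g.1⁻¹ • y.1))
            (y' := pt y.1) g.1 h))).trans (Category.assoc _ _ _).symm)
          refine (Category.assoc _ _ _).symm.trans (Eq.trans ?_ (Category.assoc _ _ _))
          refine congrArg (· ≫ f.app (pt y.1)) ((P.map_comp _ _).symm.trans
            (Eq.trans (congrArg P.map (Subtype.ext ?_)) (P.map_comp _ _)))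
          exact (one_mul g.1).trans (mul_one g.1).symm }
    obtain ⟨l, hl⟩ := hP.factors f' e'
    refine ⟨{ app y := l.app ((actionMap α).obj y) ≫
                biproduct.π (fun z : Fib α ((actionMap α).obj y) => N.obj (pt z.1)) ⟨y.back, rfl⟩
              naturality y y' g := ?_ }, ?_⟩
    · have h₁ := coindMap_π α N ((actionMap α).map g) ⟨y.back, rfl⟩ ⟨y'.back, rfl⟩ g.2
      have h₂ := l.naturality ((actionMap α).map g)
      refine (Category.assoc _ _ _).symm.trans ((congrArg (· ≫ _) h₂).trans ?_)
      refine (Category.assoc _ _ _).trans ((congrArg (_ ≫ ·) h₁).trans ?_)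
      exact (Category.assoc _ _ _).symm
    · ext y : 2
      have h := congrArg (fun τ => τ.app ((actionMap α).obj y) ≫
        biproduct.π (fun z : Fib α ((actionMap α).obj y) => M.obj (pt z.1)) ⟨y.back, rfl⟩) hl
      refine Eq.trans ?_ (h.trans ?_)
      · exact ((Category.assoc _ _ _).trans (congrArg (l.app _ ≫ ·) (biproduct.map_π
          (fun z : Fib α ((actionMap α).obj y) => e.app (pt z.1)) ⟨y.back, rfl⟩).symm)).trans
          (Category.assoc _ _ _).symm
      · refine (biproduct.lift_π _ _).trans ?_
        exact (congrArg (· ≫ f.app y) (P.map_id _)).trans (Category.id_comp _)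

/-- The presheaf of categories `X ↦ StRep(X)`, for representations in `k`-vector spaces. -/
def StRep (G : Type t) [Group G] (k : Type u) [Field k] :
    (GSets.{w} G)ᵒᵖ ⥤ Cat.{max w u, max (u + 1) w t} where
  obj X := Cat.of (Stab (RepCat (ModuleCat.{u} k) X.unop))
  map α := (Stab.map (repRes (ModuleCat.{u} k) α.unop) (projective_repRes α.unop)).toCatHom
  map_id _ := congrArg Functor.toCatHom (CategoryTheory.Quotient.lift_unique' _ _ _ rfl)
  map_comp _ _ := congrArg Functor.toCatHom (CategoryTheory.Quotient.lift_unique' _ _ _ rfl)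

end stable

end Sipp

/-! Descent along a sipp cover `α : U ⟶ X` is a separability argument. Restriction `α^*` has a right
adjoint `α_*`, with `(α_* N)_x` the sum of the `N_u` over the fibre of `x`, and for a sipp cover the
unit `1 ⟶ α_* α^*` has a natural retraction. This retraction is a weighted trace: weights on `U`
that are `G`-invariant and have sum `1` along each fibre exist because each point of `X` has a point
above it whose relative stabilizer index is prime to `p`, hence invertible in the coefficients
(`exists_weight`, `pushUnit_trace`).

Given such a retraction, the comparison functor is faithful and full by averaging morphisms. For
essential surjectivity, the inverse of the gluing isomorphism is transposed to a coaction `W ⟶ α^*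
α_* W`. The cocycle condition makes it coassociative and its restriction to the diagonal makes it
counital. The coaction followed by the retraction gives an idempotent of `α_* W`, and an object
splitting it descends `W`. Only the idempotent completeness of `D(X)` is needed.

The structure `PushKit` records the functors, the natural transformations and the identities used
here, and `PushKit.isEquivalence_comparison` is the argument. All the data are natural
transformations subject to equations, so one verification for representations serves all three
cases. Restriction and push-forward are exact, so the kit passes degreewise to derived categories;
over a field both preserve projectives, so it passes to stable categories.

There remains idempotent completeness. For `Rep(X)` it is pointwise. For `StRep(X)` an Eilenberg
swindle with countable coproducts works (`isIdempotentComplete_stab`). For the derived category of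
an arbitrary abelian category infinite coproducts may not exist. The truncation triangle reduces the
problem to complexes bounded on one side (`splits_of_distTriang`), where the coproduct of all the
even shifts in one direction is finite in each degree. This sum `F` satisfies `F ≅ T ⊕ F[2ε]` for a
truncation `T` and a sign `ε`. For an idempotent `f` the sum of the images of `f` and `f[1]` always
exists, as the cone of `1 - f`, and a swindle in steps of two shifts then splits the given
idempotent (`splits_lift_map`). -/

namespace Sipp

open CategoryTheory Limits Opposite

universe w v u t

/-! ### Formal descent from push-forward functors with a split unit. -/

section descentKit
variable {C : Type u} [Category.{v} C] (D : Cᵒᵖ ⥤ Cat.{w, t})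

/-- The identification `g^* f^* V = g'^* f'^* V` for a commutative square `g ≫ f = g' ≫ f'`. -/
def resSwap {X Y Y' Z : C} {f : Y ⟶ X} {f' : Y' ⟶ X} {g : Z ⟶ Y} {g' : Z ⟶ Y'}
    (h : g ≫ f = g' ≫ f') (V : D.obj (op X)) :
    (res D g).obj ((res D f).obj V) ⟶ (res D g').obj ((res D f').obj V) :=
  eqToHom ((res_obj_eq D h V).trans (res_obj_eq D rfl V).symm)

theorem resSwap_naturality {X Y Y' Z : C} {f : Y ⟶ X} {f' : Y' ⟶ X} {g : Z ⟶ Y} {g' : Z ⟶ Y'}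
    (h : g ≫ f = g' ≫ f') {V V' : D.obj (op X)} (φ : V ⟶ V') :
    (res D g).map ((res D f).map φ) ≫ resSwap D h V' =
      resSwap D h V ≫ (res D g').map ((res D f').map φ) := by
  rw [res_map_eq D h φ, res_map_eq D (g := g') (f := f') rfl φ]
  simp [resSwap]

theorem pullHom_comp {X₁ X₂ X₃ Y Z : C} {f₁ : Y ⟶ X₁} {f₂ : Y ⟶ X₂} {f₃ : Y ⟶ X₃}
    {V₁ : D.obj (op X₁)} {V₂ : D.obj (op X₂)} {V₃ : D.obj (op X₃)}
    (φ : (res D f₁).obj V₁ ⟶ (res D f₂).obj V₂) (ψ : (res D f₂).obj V₂ ⟶ (res D f₃).obj V₃)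
    (g : Z ⟶ Y) {h₁ : Z ⟶ X₁} {h₂ : Z ⟶ X₂} {h₃ : Z ⟶ X₃}
    (w₁ : g ≫ f₁ = h₁) (w₂ : g ≫ f₂ = h₂) (w₃ : g ≫ f₃ = h₃) :
    pullHom D (φ ≫ ψ) g w₁ w₃ = pullHom D φ g w₁ w₂ ≫ pullHom D ψ g w₂ w₃ := by
  simp [pullHom]

theorem pullHom_pullHom {X₁ X₂ Y Z Z' : C} {f₁ : Y ⟶ X₁} {f₂ : Y ⟶ X₂}
    {V₁ : D.obj (op X₁)} {V₂ : D.obj (op X₂)}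
    (φ : (res D f₁).obj V₁ ⟶ (res D f₂).obj V₂)
    (g : Z ⟶ Y) {h₁ : Z ⟶ X₁} {h₂ : Z ⟶ X₂} (w₁ : g ≫ f₁ = h₁) (w₂ : g ≫ f₂ = h₂)
    (g' : Z' ⟶ Z) {k₁ : Z' ⟶ X₁} {k₂ : Z' ⟶ X₂} (z₁ : g' ≫ h₁ = k₁) (z₂ : g' ≫ h₂ = k₂)
    (g'' : Z' ⟶ Y) (hg : g' ≫ g = g'') :
    pullHom D (pullHom D φ g w₁ w₂) g' z₁ z₂ =
      pullHom D φ g'' (by rw [← hg, Category.assoc, w₁, z₁])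
        (by rw [← hg, Category.assoc, w₂, z₂]) := by
  subst w₁ w₂ z₁ z₂ hg
  simp only [pullHom, Functor.map_comp, eqToHom_map, Category.assoc, eqToHom_trans,
    eqToHom_trans_assoc]
  rw [res_map_eq D (g := g') (f := g) rfl φ]
  simp

theorem pullHom_res_map {X Y Z : C} {f : Y ⟶ X} {V V' : D.obj (op X)} (φ : V ⟶ V')
    (g : Z ⟶ Y) {h : Z ⟶ X} (w : g ≫ f = h) :
    pullHom D (V₁ := V) (V₂ := V') ((res D f).map φ) g w w = (res D h).map φ := by
  rw [pullHom, res_map_eq D w φ]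
  simp

theorem pullHom_resSwap {X Y Y' Z Z' : C} {f : Y ⟶ X} {f' : Y' ⟶ X} {g : Z ⟶ Y} {g' : Z ⟶ Y'}
    (h : g ≫ f = g' ≫ f') (V : D.obj (op X)) (k : Z' ⟶ Z) {h₁ : Z' ⟶ Y} {h₂ : Z' ⟶ Y'}
    (w₁ : k ≫ g = h₁) (w₂ : k ≫ g' = h₂) :
    pullHom D (resSwap D h V) k w₁ w₂ =
      resSwap D (by rw [← w₁, ← w₂, Category.assoc, h, Category.assoc]) V := by
  simp [pullHom, resSwap, eqToHom_map]

theorem pullHom_id {X Y Z : C} {f : Y ⟶ X} (V : D.obj (op X)) (g : Z ⟶ Y) {h : Z ⟶ X}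
    (w : g ≫ f = h) : pullHom D (𝟙 ((res D f).obj V)) g w w = 𝟙 _ := by
  simp [pullHom]

/-- Used to cancel the pull-back along the composite of the diagonal with a projection, which equals
the identity functor only propositionally. -/
theorem res_id_map_injective {X : C} {V V' : D.obj (op X)} :
    Function.Injective ((res D (𝟙 X)).map : (V ⟶ V') → _) := by
  intro a b hab
  have key : ∀ (F : D.obj (op X) ⥤ D.obj (op X)) (_ : F = 𝟭 _), F.map a = F.map b → a = b := by
    rintro _ rfl h
    exact h
  exact key _ (congrArg Cat.Hom.toFunctor (D.map_id (op X))) hab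

theorem hom_comm_iff_inv_comm {E : Type*} [Category* E] {a b a' b' : E} (S : a ≅ b) (T : a' ≅ b')
    (f : b ⟶ b') (g : a ⟶ a') : S.hom ≫ f = g ≫ T.hom ↔ S.inv ≫ g = f ≫ T.inv := by
  rw [Iso.inv_comp_eq, ← Category.assoc, Iso.eq_comp_inv, eq_comm]

variable [HasPullbacks C] {X U : C} (α : U ⟶ X)

theorem pr_condition : pr₁ α ≫ α = pr₂ α ≫ α := pullback.condition

theorem pr₁₂_pr₂ : pr₁₂ α ≫ pr₂ α = pr₂₃ α ≫ pr₁ α := pullback.condition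

theorem pr₁₃_pr₁ : pr₁₃ α ≫ pr₁ α = pr₁₂ α ≫ pr₁ α := pullback.lift_fst _ _ _

theorem pr₁₃_pr₂ : pr₁₃ α ≫ pr₂ α = pr₂₃ α ≫ pr₂ α := pullback.lift_snd _ _ _

/-- Push-forward functors along `α`, along the first projection of `U ×_X U` and along the first
projection of `U ×_X U ×_X U`, with the natural transformations and the relations between them that
are needed for descent along `α`. -/
structure PushKit where
  /-- push-forward along `α` -/
  aPush : D.obj (op U) ⥤ D.obj (op X)
  /-- push-forward along the first projection `U ×_X U ⟶ U` -/
  pPush : D.obj (op (dbl α)) ⥤ D.obj (op U)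
  /-- push-forward along the first projection `U ×_X U ×_X U ⟶ U` -/
  qPush : D.obj (op (tpl α)) ⥤ D.obj (op U)
  /-- the unit for `α` -/
  η : 𝟭 _ ⟶ res D α ⋙ aPush
  /-- a natural retraction of the unit for `α` -/
  ρ : res D α ⋙ aPush ⟶ 𝟭 _
  /-- the counit for `α` -/
  ε : aPush ⋙ res D α ⟶ 𝟭 _
  /-- the unit for the first projection -/
  η₁ : 𝟭 _ ⟶ res D (pr₁ α) ⋙ pPush
  /-- the counit for the first projection -/
  ε₁ : pPush ⋙ res D (pr₁ α) ⟶ 𝟭 _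
  /-- base change along `α` -/
  b : res D (pr₂ α) ⋙ pPush ⟶ aPush ⋙ res D α
  /-- pull-back along `pr₁₂` over `U` -/
  c₁₂ : pPush ⟶ res D (pr₁₂ α) ⋙ qPush
  /-- pull-back along `pr₁₃` over `U` -/
  c₁₃ : pPush ⟶ res D (pr₁₃ α) ⋙ qPush
  /-- base change along `α` for the composite push-forward -/
  κ : res D (pr₂₃ α) ⋙ qPush ⟶ pPush ⋙ aPush ⋙ res D α
  η_ρ (V) : η.app V ≫ ρ.app V = 𝟙 V
  res_η_ε (V) : (res D α).map (η.app V) ≫ ε.app ((res D α).obj V) = 𝟙 _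
  res_η₁_ε₁ (W) : (res D (pr₁ α)).map (η₁.app W) ≫ ε₁.app ((res D (pr₁ α)).obj W) = 𝟙 _
  res_b_ε (W) : (res D (pr₁ α)).map (b.app W) ≫ resSwap D (pr_condition α) (aPush.obj W) ≫
    (res D (pr₂ α)).map (ε.app W) = ε₁.app ((res D (pr₂ α)).obj W)
  η₁_b (V) : η₁.app ((res D α).obj V) ≫ pPush.map (resSwap D (pr_condition α) V) ≫
    b.app ((res D α).obj V) = (res D α).map (η.app V)
  c₁₂_κ (W) : c₁₂.app ((res D (pr₂ α)).obj W) ≫ qPush.map (resSwap D (pr₁₂_pr₂ α) W) ≫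
    κ.app ((res D (pr₁ α)).obj W) = b.app W ≫ (res D α).map (aPush.map (η₁.app W))
  η₁_c (W) : η₁.app W ≫ c₁₂.app ((res D (pr₁ α)).obj W) ≫
      qPush.map (resSwap D (pr₁₃_pr₁ α).symm W) =
    η₁.app W ≫ c₁₃.app ((res D (pr₁ α)).obj W)
  c₁₃_κ (W) : c₁₃.app ((res D (pr₂ α)).obj W) ≫ qPush.map (resSwap D (pr₁₃_pr₂ α) W) ≫
      κ.app ((res D (pr₂ α)).obj W) ≫ (res D α).map (aPush.map (b.app W)) =
    b.app W ≫ (res D α).map (η.app (aPush.obj W))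

namespace PushKit

variable {D α} (K : PushKit D α)

/-- Naturality of the retraction `ρ` recovers a morphism from its restriction. -/
theorem faithful_res (K : PushKit D α) : (res D α).Faithful where
  map_injective {V V'} f g h := by
    have key (f : V ⟶ V') : f = K.η.app V ≫ K.aPush.map ((res D α).map f) ≫ K.ρ.app V' := by
      have := K.ρ.naturality f
      dsimp at this
      rw [this, ← Category.assoc, K.η_ρ]
      exact (Category.id_comp f).symm
    rw [key f, key g, h]

/-- A morphism `f : α^* V ⟶ α^* V'` with `pr₁^* f = pr₂^* f` comes from a morphism `V ⟶ V'`. -/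
theorem exists_res_map (K : PushKit D α) {V V' : D.obj (op X)} (f : (res D α).obj V ⟶ (res D α).obj V')
    (hf : resSwap D (pr_condition α) V ≫ (res D (pr₂ α)).map f =
      (res D (pr₁ α)).map f ≫ resSwap D (pr_condition α) V') :
    ∃ g : V ⟶ V', (res D α).map g = f := by
  -- The average of `f`. To compute its restriction, `η₁_b` rewrites the restricted unit through the
  -- first projection; there `pr₂^* f` may be replaced by `pr₁^* f`, and naturality of `η₁` moves
  -- `f` to the front.
  refine ⟨K.η.app V ≫ K.aPush.map f ≫ K.ρ.app V', ?_⟩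
  have h₁ := K.b.naturality f
  have h₂ := K.η₁.naturality f
  dsimp at h₁ h₂
  rw [Functor.map_comp, Functor.map_comp, ← K.η₁_b V, Category.assoc, Category.assoc,
    ← reassoc_of% h₁, ← Functor.map_comp_assoc, hf, Functor.map_comp_assoc, ← reassoc_of% h₂]
  have h₃ := K.η₁_b V'
  rw [reassoc_of% h₃, ← Functor.map_comp, K.η_ρ, CategoryTheory.Functor.map_id, Category.comp_id]

/-- The coaction associated with a morphism `pr₁^* W ⟶ pr₂^* W'`. -/
noncomputable def coact {W W' : D.obj (op U)} (φ : (res D (pr₁ α)).obj W ⟶ (res D (pr₂ α)).obj W') :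
    W ⟶ (res D α).obj (K.aPush.obj W') :=
  K.η₁.app W ≫ K.pPush.map φ ≫ K.b.app W'

/-- The coaction is the transpose of `φ` read through base change, so transposing back loses
nothing. -/
theorem res_coact_ε {W W' : D.obj (op U)}
    (φ : (res D (pr₁ α)).obj W ⟶ (res D (pr₂ α)).obj W') :
    (res D (pr₁ α)).map (K.coact φ) ≫ resSwap D (pr_condition α) (K.aPush.obj W') ≫
      (res D (pr₂ α)).map (K.ε.app W') = φ := by
  have h := K.ε₁.naturality φ
  dsimp at h
  have h' := K.res_η₁_ε₁ W
  rw [coact, Functor.map_comp, Functor.map_comp, Category.assoc, Category.assoc, K.res_b_ε,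
    h, reassoc_of% h']

variable {W : D.obj (op U)} (φ : (res D (pr₁ α)).obj W ⟶ (res D (pr₂ α)).obj W)

/-- Both sides are computed over the triple fibre product. The iterated coaction becomes the
push-forward of `pr₁₂^* φ` followed by `pr₂₃^* φ`; the hypothesis turns this into `pr₁₃^* φ`, which
`c₁₃_κ` evaluates as the right-hand side. -/
theorem coact_coassoc
    (hφ : (res D (pr₁₂ α)).map φ ≫ resSwap D (pr₁₂_pr₂ α) W ≫ (res D (pr₂₃ α)).map φ =
      resSwap D (pr₁₃_pr₁ α).symm W ≫ (res D (pr₁₃ α)).map φ ≫ resSwap D (pr₁₃_pr₂ α) W) :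
    K.coact φ ≫ (res D α).map (K.aPush.map (K.coact φ)) =
      K.coact φ ≫ (res D α).map (K.η.app (K.aPush.obj W)) := by
  have h₁ := K.c₁₂_κ W
  have h₂ := K.κ.naturality φ
  have h₃ := K.c₁₂.naturality φ
  have h₄ := K.c₁₃.naturality φ
  have h₅ := K.η₁_c W
  have h₆ := K.c₁₃_κ W
  dsimp at h₂ h₃ h₄
  conv_lhs => simp only [coact, Functor.map_comp, Category.assoc]
  rw [← reassoc_of% h₁, ← reassoc_of% h₂, reassoc_of% h₃, ← Functor.map_comp_assoc,
    ← Functor.map_comp_assoc,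
    (Category.assoc _ _ _).trans hφ]
  simp only [Functor.map_comp, Category.assoc]
  rw [reassoc_of% h₅, ← reassoc_of% h₄, h₆]
  simp only [coact, Category.assoc]

section
variable {K φ}

variable (K φ) in
/-- The idempotent endomorphism of `α_* W` that is split by the descended object. -/
noncomputable def idem : K.aPush.obj W ⟶ K.aPush.obj W :=
  K.aPush.map (K.coact φ) ≫ K.ρ.app (K.aPush.obj W)

theorem coact_res_idem
    (hc : K.coact φ ≫ (res D α).map (K.aPush.map (K.coact φ)) =
      K.coact φ ≫ (res D α).map (K.η.app (K.aPush.obj W))) :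
    K.coact φ ≫ (res D α).map (K.idem φ) = K.coact φ := by
  rw [idem, Functor.map_comp, reassoc_of% hc, ← Functor.map_comp, K.η_ρ,
    CategoryTheory.Functor.map_id, Category.comp_id]

theorem idem_idem
    (hc : K.coact φ ≫ (res D α).map (K.aPush.map (K.coact φ)) =
      K.coact φ ≫ (res D α).map (K.η.app (K.aPush.obj W))) :
    K.idem φ ≫ K.idem φ = K.idem φ := by
  have h := K.ρ.naturality (K.idem φ)
  dsimp at h
  conv_lhs => arg 1; rw [idem]
  rw [Category.assoc, ← h, ← Functor.map_comp_assoc, coact_res_idem hc, idem]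

/-- This is one half of the isomorphism between `W` and the restriction of the image of the
idempotent. The other half is counitality of the coaction. -/
theorem res_idem_coact
    (hc : K.coact φ ≫ (res D α).map (K.aPush.map (K.coact φ)) =
      K.coact φ ≫ (res D α).map (K.η.app (K.aPush.obj W))) :
    (res D α).map (K.idem φ) ≫ K.ε.app W ≫ K.coact φ =
    (res D α).map (K.idem φ) := by
  have h := K.ε.naturality (K.coact φ)
  have h' := K.ρ.naturality (K.aPush.map (K.coact φ))
  have h'' := K.ρ.naturality (K.η.app (K.aPush.obj W))
  have h₃ := K.res_η_ε (K.aPush.obj W)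
  dsimp at h h' h''
  rw [← h, ← Functor.map_comp_assoc]
  conv_lhs => arg 1; rw [idem, Category.assoc, ← h', ← Functor.map_comp_assoc, hc,
    Functor.map_comp_assoc, h'', ← Category.assoc, Functor.map_comp, ← idem]
  rw [Category.assoc, h₃]
  exact Category.comp_id _

end

/-- Descent along `α`, in the presence of push-forward functors. -/
theorem isEquivalence_comparison (K : PushKit D α) [IsIdempotentComplete (D.obj (op X))] :
    (comparison D α).IsEquivalence where
  faithful := ⟨fun {V V'} f g h =>
    K.faithful_res.map_injective (congrArg DescentDatum.Hom.hom h)⟩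
  full := ⟨fun {V V'} f => by
    obtain ⟨g, hg⟩ := K.exists_res_map f.hom (by
      exact (hom_comm_iff_inv_comm _ _ _ _).1 f.comm)
    exact ⟨g, DescentDatum.Hom.ext hg⟩⟩
  essSurj := ⟨fun W => by
    -- The cocycle condition, inverted: the coaction is built from `pr₁^* W ⟶ pr₂^* W`, which is the
    -- inverse of the gluing isomorphism.
    have hφ : (res D (pr₁₂ α)).map W.glue.inv ≫ resSwap D (pr₁₂_pr₂ α) W.obj ≫
        (res D (pr₂₃ α)).map W.glue.inv = resSwap D (pr₁₃_pr₁ α).symm W.obj ≫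
          (res D (pr₁₃ α)).map W.glue.inv ≫ resSwap D (pr₁₃_pr₂ α) W.obj := by
      have h := W.cocycle
      replace h := congrArg (· ≫ pullHom D W.glue.inv (pr₁₂ α) (h₁ := pr₁₂ α ≫ pr₁ α)
        (h₂ := pr₁₂ α ≫ pr₂ α) rfl rfl ≫ pullHom D W.glue.inv (pr₂₃ α)
          (h₁ := pr₁₂ α ≫ pr₂ α) (h₂ := pr₂₃ α ≫ pr₂ α) (pr₁₂_pr₂ α).symm rfl) h
      conv_rhs at h => rw [Category.assoc, ← Category.assoc (pullHom D W.glue.hom (pr₁₂ α) _ _),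
        ← pullHom_comp, Iso.hom_inv_id, pullHom_id, Category.id_comp, ← pullHom_comp,
        Iso.hom_inv_id, pullHom_id]
      have h' := congrArg (pullHom D W.glue.inv (pr₁₃ α) (h₁ := pr₁₂ α ≫ pr₁ α)
        (h₂ := pr₂₃ α ≫ pr₂ α) (pr₁₃_pr₁ α) (pr₁₃_pr₂ α) ≫ ·) h
      rw [← Category.assoc, ← pullHom_comp, Iso.inv_hom_id, pullHom_id, Category.id_comp,
        Category.comp_id] at h'
      have h₂ := congrArg (eqToHom (res_obj_eq D rfl W.obj) ≫ · ≫
        eqToHom (res_obj_eq D rfl W.obj).symm) h'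
      simpa [pullHom, resSwap] using h₂
    have hc := K.coact_coassoc W.glue.inv hφ
    -- Counitality: by `res_coact_ε`, the composite is the restriction of the inverse gluing
    -- isomorphism to the diagonal.
    have he : K.coact W.glue.inv ≫ K.ε.app W.obj = 𝟙 _ := by
      let Δ : U ⟶ dbl α := pullback.lift (𝟙 U) (𝟙 U) rfl
      have Δ₁ : Δ ≫ pr₁ α = 𝟙 U := pullback.lift_fst _ _ _
      have Δ₂ : Δ ≫ pr₂ α = 𝟙 U := pullback.lift_snd _ _ _
      let δ : U ⟶ tpl α := pullback.lift Δ Δ (Δ₂.trans Δ₁.symm)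
      have δ₁ : δ ≫ pr₁₂ α = Δ := pullback.lift_fst _ _ _
      have δ₂ : δ ≫ pr₂₃ α = Δ := pullback.lift_snd _ _ _
      have δ₃ : δ ≫ pr₁₃ α = Δ := by
        apply pullback.hom_ext
        · rw [Category.assoc]
          exact (congrArg (δ ≫ ·) (pr₁₃_pr₁ α)).trans (by rw [← Category.assoc, δ₁])
        · rw [Category.assoc]
          exact (congrArg (δ ≫ ·) (pr₁₃_pr₂ α)).trans (by rw [← Category.assoc, δ₂])
      let ψ : (res D (𝟙 U)).obj W.obj ⟶ (res D (𝟙 U)).obj W.obj :=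
        pullHom D W.glue.hom Δ Δ₂ Δ₁
      let ψ' : (res D (𝟙 U)).obj W.obj ⟶ (res D (𝟙 U)).obj W.obj :=
        pullHom D W.glue.inv Δ Δ₁ Δ₂
      have hψ : ψ ≫ ψ' = 𝟙 _ := by
        rw [← pullHom_comp, Iso.hom_inv_id, pullHom_id]
      have hψ' : ψ' ≫ ψ = 𝟙 _ := by
        rw [← pullHom_comp, Iso.inv_hom_id, pullHom_id]
      -- The cocycle condition restricted to the small diagonal. As `ψ` is invertible, it must be
      -- the identity.
      have h₁ : ψ = ψ ≫ ψ := by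
        have h : pullHom D _ δ (h₁ := 𝟙 U) (h₂ := 𝟙 U) (by rw [← Category.assoc, δ₂, Δ₂])
            (by rw [← Category.assoc, δ₁, Δ₁]) =
          pullHom D _ δ (h₁ := 𝟙 U) (h₂ := 𝟙 U) (by rw [← Category.assoc, δ₂, Δ₂])
            (by rw [← Category.assoc, δ₁, Δ₁]) :=
          congrArg (fun x => pullHom D x δ (h₁ := 𝟙 U) (h₂ := 𝟙 U) _ _) W.cocycle
        rw [pullHom_comp D _ _ δ (h₂ := 𝟙 U) _ (by rw [← Category.assoc, δ₁, Δ₂]),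
          pullHom_pullHom _ _ _ _ _ _ _ _ _ δ₃, pullHom_pullHom _ _ _ _ _ _ _ _ _ δ₂,
          pullHom_pullHom _ _ _ _ _ _ _ _ _ δ₁] at h
        exact h
      have h₂ : ψ' = 𝟙 _ := by
        have h : ψ = 𝟙 _ := by
          have : ψ ≫ ψ' = (ψ ≫ ψ) ≫ ψ' := congrArg (· ≫ ψ') h₁
          rw [Category.assoc, hψ, Category.comp_id] at this
          exact this.symm
        rw [h, Category.id_comp] at hψ
        exact hψ
      have h₃ : pullHom D _ Δ Δ₁ Δ₂ = pullHom D _ Δ Δ₁ Δ₂ :=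
        congrArg (fun x => pullHom D x Δ Δ₁ Δ₂) (K.res_coact_ε W.glue.inv)
      rw [pullHom_comp D _ _ Δ Δ₁ Δ₁ Δ₂, pullHom_comp D _ _ Δ Δ₁ Δ₂ Δ₂,
        pullHom_res_map, pullHom_res_map, pullHom_resSwap] at h₃
      apply res_id_map_injective D
      rw [CategoryTheory.Functor.map_id, Functor.map_comp]
      refine Eq.trans ?_ (h₃.trans h₂)
      simp [resSwap]
    -- The descended object is the image of the idempotent.
    obtain ⟨V, i, r, hir, hri⟩ := IsIdempotentComplete.idempotents_split _ _ (idem_idem hc)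
    have hie : i ≫ K.idem W.glue.inv = i := by
      rw [← hri, reassoc_of% hir]
    have hj : (res D α).map i ≫ K.ε.app W.obj ≫ K.coact W.glue.inv = (res D α).map i := by
      rw [← hie, Functor.map_comp, Category.assoc, res_idem_coact hc]
    let j : (res D α).obj V ≅ W.obj :=
      { hom := (res D α).map i ≫ K.ε.app W.obj
        inv := K.coact W.glue.inv ≫ (res D α).map r
        hom_inv_id := by
          rw [Category.assoc, reassoc_of% hj, ← Functor.map_comp, hir,
            CategoryTheory.Functor.map_id]
        inv_hom_id := by
          rw [Category.assoc, ← Functor.map_comp_assoc, hri,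
            reassoc_of% coact_res_idem hc, he] }
    have hcomm : resSwap D (pr_condition α) V ≫ (res D (pr₂ α)).map j.hom =
        (res D (pr₁ α)).map j.hom ≫ W.glue.inv := by
      conv_rhs => rw [← K.res_coact_ε W.glue.inv]
      have hj' : j.hom ≫ K.coact W.glue.inv = (res D α).map i := (Category.assoc _ _ _).trans hj
      rw [← Functor.map_comp_assoc, hj', ← Category.assoc, resSwap_naturality, Category.assoc,
        ← Functor.map_comp]
    have h₁ : ((comparison D α).obj V).glue.hom ≫ (res D (pr₁ α)).map j.hom =
        (res D (pr₂ α)).map j.hom ≫ W.glue.hom := by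
      exact (hom_comm_iff_inv_comm _ _ _ _).2 hcomm
    have h₂ : W.glue.hom ≫ (res D (pr₁ α)).map j.inv =
        (res D (pr₂ α)).map j.inv ≫ ((comparison D α).obj V).glue.hom := by
      exact ((hom_comm_iff_inv_comm ((res D (pr₂ α)).mapIso j) ((res D (pr₁ α)).mapIso j) _ _).1
        h₁.symm).symm
    exact ⟨V, ⟨{
      hom := ⟨j.hom, h₁⟩
      inv := ⟨j.inv, h₂⟩
      hom_inv_id := DescentDatum.Hom.ext j.hom_inv_id
      inv_hom_id := DescentDatum.Hom.ext j.inv_hom_id }⟩⟩⟩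

end PushKit

end descentKit

/-! ### Push-forward of representations and its adjunction with restriction. -/

section push
variable {G : Type t} [Group G] {A : Type u} [Category.{v} A]

theorem map_arr_comp {X : GSets.{w} G} (V : RepCat A X) {x x' x'' : ActionCategory G X.V} (g g' : G)
    (h : g • x.back = x'.back) (h' : g' • x'.back = x''.back) :
    V.map (arr g h) ≫ V.map (arr g' h') =
      V.map (arr (y := x) (y' := x'') (g' * g) (by rw [mul_smul, h, h'])) :=
  (V.map_comp _ _).symm

theorem map_arr_congr {X : GSets.{w} G} (V : RepCat A X) {x x' : ActionCategory G X.V} {g g' : G}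
    (h : g • x.back = x'.back) (hg : g = g') :
    V.map (arr g h) = V.map (arr (y := x) (y' := x') g' (by rw [← hg, h])) := by
  subst hg; rfl

theorem map_arr_one {X : GSets.{w} G} (V : RepCat A X) {x : ActionCategory G X.V}
    (h : (1 : G) • x.back = x.back) : V.map (arr 1 h) = 𝟙 (V.obj x) :=
  V.map_id x

/-- Strict descent involves transports along equalities of objects. Reading them as the action of `1
: G` lets them be multiplied with the other group elements. -/
theorem map_arr_one_eqToHom {X : GSets.{w} G} (V : RepCat A X) {x x' : ActionCategory G X.V}
    (h : (1 : G) • x.back = x'.back) (e : V.obj x = V.obj x') : V.map (arr 1 h) = eqToHom e := by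
  obtain ⟨⟨⟩, x⟩ := x
  obtain ⟨⟨⟩, x'⟩ := x'
  have hx : x = x' := (one_smul G (show X.V from x)).symm.trans h
  subst hx
  exact V.map_id _

variable [Preadditive A] [HasFiniteBiproducts A] {X Y : GSets.{w} G} (f : Y ⟶ X)

/-- The action of a morphism of the action groupoid of `X` on `f_* N`. -/
noncomputable def pushMap (N : RepCat A Y) {x x' : ActionCategory G X.V} (g : x ⟶ x') :
    (⨁ fun y : Fib f x => N.obj (pt y.1)) ⟶ (⨁ fun y : Fib f x' => N.obj (pt y.1)) :=
  biproduct.lift fun y =>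
    biproduct.π (fun y : Fib f x => N.obj (pt y.1)) ⟨g.1⁻¹ • y.1, inv_mem_fib f g y⟩ ≫
      N.map (arr g.1 (smul_inv_smul g.1 y.1))

theorem pushMap_π (N : RepCat A Y) {x x' : ActionCategory G X.V} (g : x ⟶ x') (y : Fib f x)
    (y' : Fib f x') (h : g.1 • y.1 = y'.1) :
    pushMap f N g ≫ biproduct.π (fun y : Fib f x' => N.obj (pt y.1)) y' =
      biproduct.π (fun y : Fib f x => N.obj (pt y.1)) y ≫
        N.map (arr (y := pt y.1) (y' := pt y'.1) g.1 h) := by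
  have hy : y = ⟨g.1⁻¹ • y'.1, inv_mem_fib f g y'⟩ :=
    Subtype.ext ((inv_smul_smul g.1 y.1).symm.trans (congrArg _ h))
  subst hy
  exact biproduct.lift_π _ _

/-- The push-forward functor `f_*`. -/
noncomputable def push : RepCat A Y ⥤ RepCat A X where
  obj N :=
    { obj x := ⨁ fun y : Fib f x => N.obj (pt y.1)
      map g := pushMap f N g
      map_id x := by
        refine biproduct.hom_ext _ _ fun y => ?_
        rw [pushMap_π f N (𝟙 x) y y (one_smul G y.1)]
        exact (congrArg _ (N.map_id _)).trans ((Category.comp_id _).trans (Category.id_comp _).symm)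
      map_comp {x x' x''} g g' := by
        refine biproduct.hom_ext _ _ fun y => ?_
        let y' : Fib f x' := ⟨g'.1⁻¹ • y.1, inv_mem_fib f g' y⟩
        let y₀ : Fib f x := ⟨g.1⁻¹ • y'.1, inv_mem_fib f g y'⟩
        have h' : g'.1 • y'.1 = y.1 := smul_inv_smul _ _
        have h : g.1 • y₀.1 = y'.1 := smul_inv_smul _ _
        have h'' : (g ≫ g').1 • y₀.1 = y.1 :=
          (mul_smul g'.1 g.1 y₀.1).trans ((congrArg _ h).trans h')
        rw [Category.assoc, pushMap_π f N g' y' y h', ← Category.assoc, pushMap_π f N g y₀ y' h,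
          pushMap_π f N (g ≫ g') y₀ y h'', Category.assoc, ← N.map_comp]
        rfl }
  map {N M} φ :=
    { app x := biproduct.map fun y => φ.app (pt y.1)
      naturality x x' g := by
        refine biproduct.hom_ext _ _ fun y => ?_
        have h : g.1 • (⟨g.1⁻¹ • y.1, inv_mem_fib f g y⟩ : Fib f x).1 = y.1 := smul_inv_smul _ _
        have h₁ := pushMap_π f N g _ y h
        have h₂ := pushMap_π f M g _ y h
        rw [Category.assoc, biproduct.map_π, reassoc_of% h₁, Category.assoc, h₂,
          biproduct.map_π_assoc, φ.naturality] }
  map_id N := by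
    ext x : 2
    refine biproduct.hom_ext (f := fun y : Fib f x => N.obj (pt y.1)) _ _ fun y => ?_
    simp
  map_comp {N M P} φ ψ := by
    ext x : 2
    refine biproduct.hom_ext (f := fun y : Fib f x => P.obj (pt y.1)) _ _ fun y => ?_
    simp

/-- The projection from `(f_* N)_x` to `N_y`, for `y` over `x`. -/
noncomputable def pushπ (N : RepCat A Y) (x : ActionCategory G X.V) (y : Fib f x) :
    ((push f).obj N).obj x ⟶ N.obj (pt y.1) :=
  biproduct.π (fun y : Fib f x => N.obj (pt y.1)) y

/-- The morphism to `(f_* N)_x` with given components. -/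
noncomputable def pushLift (N : RepCat A Y) (x : ActionCategory G X.V) {T : A}
    (k : ∀ y : Fib f x, T ⟶ N.obj (pt y.1)) : T ⟶ ((push f).obj N).obj x :=
  biproduct.lift k

variable {f} in
theorem push_hom_ext {N : RepCat A Y} {x : ActionCategory G X.V} {T : A}
    {a b : T ⟶ ((push f).obj N).obj x} (h : ∀ y, a ≫ pushπ f N x y = b ≫ pushπ f N x y) : a = b :=
  biproduct.hom_ext _ _ h

theorem pushLift_π (N : RepCat A Y) (x : ActionCategory G X.V) {T : A}
    (k : ∀ y : Fib f x, T ⟶ N.obj (pt y.1)) (y : Fib f x) :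
    pushLift f N x k ≫ pushπ f N x y = k y :=
  biproduct.lift_π _ _

theorem pushπ_congr (N : RepCat A Y) {x : ActionCategory G X.V} {y y' : Fib f x} (h : y = y')
    {z : ActionCategory G Y.V} {g g' : G} (hg : g • y.1 = z.back) (hg' : g' • y'.1 = z.back)
    (e : g = g') :
    pushπ f N x y ≫ N.map (arr (y := pt y.1) (y' := z) g hg) =
      pushπ f N x y' ≫ N.map (arr (y := pt y'.1) (y' := z) g' hg') := by
  subst h e; rfl

theorem push_obj_map_π (N : RepCat A Y) {x x' : ActionCategory G X.V} (g : x ⟶ x')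
    (y' : Fib f x') :
    ((push f).obj N).map g ≫ pushπ f N x' y' =
      pushπ f N x ⟨g.1⁻¹ • y'.1, inv_mem_fib f g y'⟩ ≫
        N.map (arr (y := pt (g.1⁻¹ • y'.1)) (y' := pt y'.1) g.1 (smul_inv_smul g.1 y'.1)) :=
  pushMap_π f N g _ y' _

theorem push_map_app_π {N M : RepCat A Y} (φ : N ⟶ M) (x : ActionCategory G X.V) (y : Fib f x) :
    ((push f).map φ).app x ≫ pushπ f M x y = pushπ f N x y ≫ φ.app (pt y.1) :=
  biproduct.map_π (fun y : Fib f x => φ.app (pt y.1)) y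

theorem pushLift_natural {N : RepCat A Y} {x x' : ActionCategory G X.V} (g : x ⟶ x') {T T' : A}
    (a : T ⟶ T') (k : ∀ y : Fib f x, T ⟶ N.obj (pt y.1)) (k' : ∀ y : Fib f x', T' ⟶ N.obj (pt y.1))
    (h : ∀ y' : Fib f x', a ≫ k' y' = k ⟨g.1⁻¹ • y'.1, inv_mem_fib f g y'⟩ ≫
      N.map (arr (y := pt (g.1⁻¹ • y'.1)) (y' := pt y'.1) g.1 (smul_inv_smul g.1 y'.1))) :
    a ≫ pushLift f N x' k' = pushLift f N x k ≫ ((push f).obj N).map g := by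
  refine push_hom_ext fun y => ?_
  rw [Category.assoc, pushLift_π, h, Category.assoc, push_obj_map_π, (reassoc_of% pushLift_π)]

theorem pushLift_comp_map {N M : RepCat A Y} (φ : N ⟶ M) {x : ActionCategory G X.V} {T T' : A}
    (a : T ⟶ T') (k : ∀ y : Fib f x, T ⟶ N.obj (pt y.1)) (k' : ∀ y : Fib f x, T' ⟶ M.obj (pt y.1))
    (h : ∀ y : Fib f x, a ≫ k' y = k y ≫ φ.app (pt y.1)) :
    a ≫ pushLift f M x k' = pushLift f N x k ≫ ((push f).map φ).app x := by
  refine push_hom_ext fun y => ?_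
  rw [Category.assoc, pushLift_π, h, Category.assoc, push_map_app_π, (reassoc_of% pushLift_π)]

instance push_additive : (push (A := A) f).Additive where
  map_add {N M φ ψ} := by
    ext x
    refine push_hom_ext fun y => ?_
    rw [push_map_app_π, NatTrans.app_add, NatTrans.app_add, Preadditive.add_comp, push_map_app_π,
      push_map_app_π, Preadditive.comp_add]

theorem one_smul_fib (x : ActionCategory G X.V) (y : Fib f x) :
    (1 : G) • x.back = ((actionMap f).obj (pt y.1)).back :=
  (one_smul G _).trans y.2.symm

theorem one_smul_fib' (x : ActionCategory G X.V) (y : Fib f x) :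
    (1 : G) • ((actionMap f).obj (pt y.1)).back = x.back :=
  (one_smul G _).trans y.2

/-- The unit `1 ⟶ f_* f^*`. -/
noncomputable def pushUnit : 𝟭 (RepCat A X) ⟶ repRes A f ⋙ push f where
  app V :=
    { app x := pushLift f ((repRes A f).obj V) x fun y => V.map (arr 1 (one_smul_fib f x y))
      naturality x x' g := by
        refine pushLift_natural f g _ _ _ fun y => ?_
        refine (map_arr_comp V g.1 1 g.2 _).trans (Eq.trans ?_ (map_arr_comp V 1 g.1 _ (by
          exact (hom_smul f _ _).symm.trans (congrArg _ (smul_inv_smul g.1 y.1)))).symm)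
        exact map_arr_congr _ _ (by simp) }
  naturality V V' φ := by
    ext x
    exact pushLift_comp_map f ((repRes A f).map φ) _ _ _ fun y => (φ.naturality _).symm

theorem pushUnit_app_π (V : RepCat A X) (x : ActionCategory G X.V) (y : Fib f x) :
    ((pushUnit f).app V).app x ≫ pushπ f ((repRes A f).obj V) x y =
      V.map (arr 1 (one_smul_fib f x y)) :=
  pushLift_π _ _ _ _ _

/-- The counit `f^* f_* ⟶ 1`. -/
noncomputable def pushCounit : push f ⋙ repRes A f ⟶ 𝟭 (RepCat A Y) where
  app N :=
    { app y := pushπ f N ((actionMap f).obj y) ⟨y.back, rfl⟩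
      naturality y y' g := by
        refine (push_obj_map_π f N ((actionMap f).map g) ⟨y'.back, rfl⟩).trans ?_
        exact pushπ_congr f N (Subtype.ext (inv_smul_eq_iff.2 (by exact g.2.symm))) _ _ rfl }
  naturality N M φ := by
    ext y
    exact push_map_app_π f φ ((actionMap f).obj y) ⟨y.back, rfl⟩

theorem pushUnit_counit (W : RepCat A Y) :
    (pushUnit f).app ((push f).obj W) ≫ (push f).map ((pushCounit f).app W) = 𝟙 _ := by
  ext x
  refine push_hom_ext fun y => ?_
  erw [Category.assoc, push_map_app_π, (reassoc_of% pushUnit_app_π), push_obj_map_π,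
    Category.id_comp]
  refine (pushπ_congr f W (y' := y) (Subtype.ext (by exact inv_smul_eq_iff.2 (one_smul G _).symm))
    _ (by exact one_smul G _) rfl).trans ?_
  erw [map_arr_one, Category.comp_id]
  rfl

theorem res_pushUnit_counit (V : RepCat A X) :
    (repRes A f).map ((pushUnit f).app V) ≫ (pushCounit f).app ((repRes A f).obj V) = 𝟙 _ := by
  ext y
  exact (pushUnit_app_π f V ((actionMap f).obj y) ⟨y.back, rfl⟩).trans (map_arr_one _ _)

/-- Push-forward is right adjoint to restriction. -/
noncomputable def pushAdj : repRes A f ⊣ push f where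
  unit := pushUnit f
  counit := pushCounit f
  left_triangle_components := res_pushUnit_counit f
  right_triangle_components := pushUnit_counit f

end push

/-! ### Fibre products, refinement and base change. -/

section baseChange
variable {G : Type t} [Group G]

/-- The point of a fibre product given by two points with the same image. -/
noncomputable def pbMk {X Y Z : GSets.{w} G} (f : X ⟶ Z) (g : Y ⟶ Z) (x : X.V) (y : Y.V)
    (h : f.hom x = g.hom y) : (pullback f g).V :=
  (exists_pullback f g x y h).choose

theorem fst_pbMk {X Y Z : GSets.{w} G} (f : X ⟶ Z) (g : Y ⟶ Z) (x : X.V) (y : Y.V)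
    (h : f.hom x = g.hom y) : (pullback.fst f g).hom (pbMk f g x y h) = x :=
  (exists_pullback f g x y h).choose_spec.1

theorem snd_pbMk {X Y Z : GSets.{w} G} (f : X ⟶ Z) (g : Y ⟶ Z) (x : X.V) (y : Y.V)
    (h : f.hom x = g.hom y) : (pullback.snd f g).hom (pbMk f g x y h) = y :=
  (exists_pullback f g x y h).choose_spec.2

theorem hom_comp_apply {X Y Z : GSets.{w} G} (f : X ⟶ Y) (g : Y ⟶ Z) (x : X.V) :
    (f ≫ g).hom x = g.hom (f.hom x) := rfl

variable {A : Type u} [Category.{v} A]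

/-- The identification of `g^* f^* V` with `g'^* f'^* V` for a commutative square. -/
def repSwap {X Y Y' Z : GSets.{w} G} {f : Y ⟶ X} {f' : Y' ⟶ X} {g : Z ⟶ Y} {g' : Z ⟶ Y'}
    (h : g ≫ f = g' ≫ f') : repRes A f ⋙ repRes A g ⟶ repRes A f' ⋙ repRes A g' where
  app V :=
    { app z := V.map (arr (y := (actionMap f).obj ((actionMap g).obj z))
        (y' := (actionMap f').obj ((actionMap g').obj z)) 1
        ((one_smul G _).trans (congrArg (fun k => k.hom z.back) h)))
      naturality z z' k := by
        refine (map_arr_comp V k.1 1 _ _).trans (Eq.trans ?_ (map_arr_comp V 1 k.1 _ _).symm)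
        exact map_arr_congr _ _ (by simp) }
  naturality V V' φ := by
    ext z
    exact (φ.naturality _).symm

theorem repSwap_eqToHom {X Y Y' Z : GSets.{w} G} {f : Y ⟶ X} {f' : Y' ⟶ X} {g : Z ⟶ Y}
    {g' : Z ⟶ Y'} (h : g ≫ f = g' ≫ f') (V : RepCat A X)
    (e : (repRes A g).obj ((repRes A f).obj V) = (repRes A g').obj ((repRes A f').obj V)) :
    (repSwap h).app V = eqToHom e := by
  ext z
  rw [eqToHom_app]
  exact map_arr_one_eqToHom V _ _

variable [Preadditive A] [HasFiniteBiproducts A]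

theorem pushπ_res_congr {X Y T : GSets.{w} G} (f : Y ⟶ X) (s : Y ⟶ T) (W : RepCat A T)
    {x : ActionCategory G X.V} {y y' : Fib f x} (h : y = y')
    {z : ActionCategory G T.V} {g g' : G} (hg : g • ((actionMap s).obj (pt y.1)).back = z.back)
    (hg' : g' • ((actionMap s).obj (pt y'.1)).back = z.back) (e : g = g') :
    pushπ f ((repRes A s).obj W) x y ≫ W.map (arr (y := (actionMap s).obj (pt y.1)) g hg) =
      pushπ f ((repRes A s).obj W) x y' ≫ W.map (arr (y := (actionMap s).obj (pt y'.1)) g' hg') := by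
  subst h e; rfl

/-- Refinement `f_* ⟶ k_* t^*` for a morphism `t` over `X`. -/
noncomputable def pushRefine {X Y Z : GSets.{w} G} (t : Z ⟶ Y) (f : Y ⟶ X) (k : Z ⟶ X)
    (h : t ≫ f = k) : push (A := A) f ⟶ repRes A t ⋙ push k where
  app N :=
    { app x := pushLift k ((repRes A t).obj N) x fun z =>
        pushπ f N x ⟨t.hom z.1, by rw [← hom_comp_apply, h, z.2]⟩
      naturality x x' g := by
        refine pushLift_natural k g _ _ _ fun z => ?_
        refine (push_obj_map_π f N g _).trans ?_
        exact pushπ_congr f N (Subtype.ext (hom_smul t _ _).symm) _ _ rfl }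
  naturality N M φ := by
    ext x
    exact pushLift_comp_map k ((repRes A t).map φ) _ _ _ fun z => push_map_app_π f φ x _

theorem pushRefine_π {X Y Z : GSets.{w} G} (t : Z ⟶ Y) (f : Y ⟶ X) (k : Z ⟶ X)
    (h : t ≫ f = k) (N : RepCat A Y) (x : ActionCategory G X.V) (z : Fib k x) :
    ((pushRefine t f k h).app N).app x ≫ pushπ k ((repRes A t).obj N) x z =
      pushπ f N x ⟨t.hom z.1, by rw [← hom_comp_apply, h, z.2]⟩ :=
  pushLift_π _ _ _ _ _

/-- The comparison `(t ≫ f)_* ⟶ f_* t_*`. -/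
noncomputable def pushComp {X Y Z : GSets.{w} G} (t : Z ⟶ Y) (f : Y ⟶ X) :
    push (A := A) (t ≫ f) ⟶ push t ⋙ push f where
  app N :=
    { app x := pushLift f ((push t).obj N) x fun y => pushLift t N (pt y.1) fun z =>
        pushπ (t ≫ f) N x ⟨z.1, by rw [hom_comp_apply, z.2]; exact y.2⟩
      naturality x x' g := by
        refine pushLift_natural f g _ _ _ fun y => ?_
        refine pushLift_natural t (N := N) (x' := pt y.1) (arr (y := pt (g.1⁻¹ • y.1)) g.1
          (smul_inv_smul g.1 y.1)) _ _ _ fun z => ?_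
        exact push_obj_map_π (t ≫ f) N g _ }
  naturality N M φ := by
    ext x
    refine pushLift_comp_map f ((push t).map φ) _ _ _ fun y => ?_
    exact pushLift_comp_map t φ _ _ _ fun z => push_map_app_π (t ≫ f) φ x _

theorem pushComp_π {X Y Z : GSets.{w} G} (t : Z ⟶ Y) (f : Y ⟶ X) (N : RepCat A Z)
    (x : ActionCategory G X.V) (y : Fib f x) (z : Fib t (pt y.1)) :
    ((pushComp t f).app N).app x ≫ pushπ f ((push t).obj N) x y ≫ pushπ t N (pt y.1) z =
      pushπ (t ≫ f) N x ⟨z.1, by rw [hom_comp_apply, z.2]; exact y.2⟩ := by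
  erw [(reassoc_of% pushLift_π), pushLift_π]

/-- The point of `X' ×_X Y` over `x'` given by a point `y` over `f x'`. -/
noncomputable def pbFib {X X' Y : GSets.{w} G} (h : X' ⟶ X) (f : Y ⟶ X)
    (x' : ActionCategory G X'.V) (y : Fib f ((actionMap h).obj x')) : Fib (pullback.fst h f) x' :=
  ⟨pbMk h f x'.back y.1 y.2.symm, fst_pbMk h f x'.back y.1 y.2.symm⟩

theorem snd_pbFib {X X' Y : GSets.{w} G} (h : X' ⟶ X) (f : Y ⟶ X)
    (x' : ActionCategory G X'.V) (y : Fib f ((actionMap h).obj x')) :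
    (pullback.snd h f).hom (pbFib h f x' y).1 = y.1 :=
  snd_pbMk h f x'.back y.1 y.2.symm

theorem one_smul_pbFib {X X' Y : GSets.{w} G} (h : X' ⟶ X) (f : Y ⟶ X)
    (x' : ActionCategory G X'.V) (y : Fib f ((actionMap h).obj x')) :
    (1 : G) • ((actionMap (pullback.snd h f)).obj (pt (pbFib h f x' y).1)).back =
      (pt y.1 : ActionCategory G Y.V).back :=
  (one_smul G _).trans (snd_pbFib h f x' y)

theorem fib_pullback_ext {X X' Y : GSets.{w} G} {h : X' ⟶ X} {f : Y ⟶ X}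
    {x' : ActionCategory G X'.V} {z z' : Fib (pullback.fst h f) x'}
    (e : (pullback.snd h f).hom z.1 = (pullback.snd h f).hom z'.1) : z = z' :=
  Subtype.ext (pullback_ext h f _ _ (z.2.trans z'.2.symm) e)

/-- Base change `pr₁_* pr₂^* ⟶ h^* f_*`. -/
noncomputable def baseChange {X X' Y : GSets.{w} G} (h : X' ⟶ X) (f : Y ⟶ X) :
    repRes A (pullback.snd h f) ⋙ push (pullback.fst h f) ⟶ push f ⋙ repRes A h where
  app N :=
    { app x' := pushLift f N ((actionMap h).obj x') fun y =>
        pushπ (pullback.fst h f) ((repRes A (pullback.snd h f)).obj N) x' (pbFib h f x' y) ≫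
          N.map (arr (y := (actionMap (pullback.snd h f)).obj (pt (pbFib h f x' y).1)) 1
            (one_smul_pbFib h f x' y))
      naturality x x' g := by
        refine pushLift_natural f ((actionMap h).map g) _ _ _ fun y => ?_
        refine (Category.assoc _ _ _).symm.trans ?_
        refine (congrArg (· ≫ _) (push_obj_map_π _ _ g _)).trans ?_
        refine (Category.assoc _ _ _).trans ?_
        refine Eq.trans ?_ (Category.assoc _ _ _).symm
        refine (congrArg _ (map_arr_comp N _ _ _ _)).trans
          (Eq.trans ?_ (congrArg _ (map_arr_comp N _ _ _ _).symm))
        refine pushπ_res_congr _ _ N (fib_pullback_ext ?_) _ _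
          ((one_mul _).trans (mul_one _).symm)
        refine (hom_smul _ _ _).trans ?_
        refine (congrArg _ (snd_pbFib h f x' y)).trans (snd_pbFib h f x
          ⟨((actionMap h).map g).1⁻¹ • y.1, inv_mem_fib f ((actionMap h).map g) y⟩).symm }
  naturality N M φ := by
    ext x
    refine pushLift_comp_map f φ _ _ _ fun y => ?_
    refine (Category.assoc _ _ _).symm.trans ?_
    refine (congrArg (· ≫ _) (push_map_app_π _ _ x _)).trans ?_
    refine (Category.assoc _ _ _).trans (Eq.trans ?_ (Category.assoc _ _ _).symm)
    exact congrArg _ (φ.naturality _).symm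

theorem baseChange_π {X X' Y : GSets.{w} G} (h : X' ⟶ X) (f : Y ⟶ X) (N : RepCat A Y)
    (x' : ActionCategory G X'.V) (y : Fib f ((actionMap h).obj x')) :
    ((baseChange h f).app N).app x' ≫ pushπ f N ((actionMap h).obj x') y =
      pushπ (pullback.fst h f) ((repRes A (pullback.snd h f)).obj N) x' (pbFib h f x' y) ≫
          N.map (arr (y := (actionMap (pullback.snd h f)).obj (pt (pbFib h f x' y).1)) 1
            (one_smul_pbFib h f x' y)) :=
  pushLift_π _ _ _ _ _

end baseChange

/-! ### The identities between unit, counit, base change and refinement. -/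

section kit
variable {G : Type t} [Group G] {A : Type u} [Category.{v} A] [Preadditive A]
  [HasFiniteBiproducts A]

/-- On families, base change is the relabelling of points `(x', y)` of the fibre product by `y`. The
identities in this section compare components, with group elements `1` or `1⁻¹` to absorb. -/
theorem res_baseChange_counit {X X' Y : GSets.{w} G} (h : X' ⟶ X) (f : Y ⟶ X) (W : RepCat A Y) :
    (repRes A (pullback.fst h f)).map ((baseChange h f).app W) ≫
        (repSwap pullback.condition).app ((push f).obj W) ≫
          (repRes A (pullback.snd h f)).map ((pushCounit f).app W) =
      (pushCounit (pullback.fst h f)).app ((repRes A (pullback.snd h f)).obj W) := by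
  ext z
  refine (congrArg _ (push_obj_map_π f W _ _)).trans ?_
  refine ((reassoc_of% baseChange_π) h f W _ _ _).trans ?_
  refine (congrArg _ (map_arr_comp W _ _ _ _)).trans ?_
  refine (pushπ_res_congr _ _ W (y' := ⟨z.back, rfl⟩) (g' := 1) (fib_pullback_ext ?_) _
    (one_smul G _) (one_mul 1)).trans ?_
  · refine (snd_pbFib _ _ _ _).trans ?_
    exact inv_smul_eq_iff.2 (one_smul G _).symm
  · exact (congrArg _ (map_arr_one W _)).trans (Category.comp_id _)

theorem unit_baseChange {X X' Y : GSets.{w} G} (h : X' ⟶ X) (f : Y ⟶ X) (V : RepCat A X) :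
    (pushUnit (pullback.fst h f)).app ((repRes A h).obj V) ≫
        (push (pullback.fst h f)).map ((repSwap pullback.condition).app V) ≫
          (baseChange h f).app ((repRes A f).obj V) =
      (repRes A h).map ((pushUnit f).app V) := by
  ext x
  refine push_hom_ext fun y => ?_
  refine (Category.assoc _ _ _).trans ((congrArg _ (Category.assoc _ _ _)).trans ?_)
  refine (congrArg (_ ≫ _ ≫ ·) (baseChange_π h f _ x y)).trans ?_
  refine (congrArg (_ ≫ ·) ((reassoc_of% push_map_app_π) _ _ x _ _)).trans ?_
  refine ((reassoc_of% pushUnit_app_π) _ _ x _ _).trans ?_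
  refine (congrArg (_ ≫ ·) (map_arr_comp V _ _ _ _)).trans ((map_arr_comp V _ _ _ _).trans ?_)
  refine Eq.trans ?_ (pushUnit_app_π f V ((actionMap h).obj x) y).symm
  exact map_arr_congr V _ (by simp)

theorem unit_refine {X Y Z : GSets.{w} G} (t t' : Z ⟶ Y) (f : Y ⟶ X) (k : Z ⟶ X)
    (h : t ≫ f = k) (h' : t' ≫ f = k) (W : RepCat A X) :
    (pushUnit f).app W ≫ (pushRefine t f k h).app ((repRes A f).obj W) ≫
        (push k).map ((repSwap (h.trans h'.symm)).app W) =
      (pushUnit f).app W ≫ (pushRefine t' f k h').app ((repRes A f).obj W) := by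
  ext x
  refine push_hom_ext fun z => ?_
  refine (Category.assoc _ _ _).trans ((congrArg _ (Category.assoc _ _ _)).trans ?_)
  refine (congrArg (_ ≫ _ ≫ ·) (push_map_app_π _ _ x _)).trans ?_
  refine (congrArg (_ ≫ ·) ((reassoc_of% pushRefine_π) t f k h _ x z _)).trans ?_
  refine ((reassoc_of% pushUnit_app_π) _ _ x _ _).trans ?_
  refine (map_arr_comp W _ _ _ _).trans ?_
  refine Eq.trans ?_ ((Category.assoc _ _ _).trans
    ((congrArg (_ ≫ ·) (pushRefine_π t' f k h' _ x z)).trans (pushUnit_app_π _ _ x _))).symm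
  exact map_arr_congr W _ (by simp)

variable {X U : GSets.{w} G} (α : U ⟶ X)

/-- Base change for the push-forward along the first projection of the triple fibre product. -/
noncomputable def pushTriple :
    repRes A (pr₂₃ α) ⋙ push (pr₁₂ α ≫ pr₁ α) ⟶ push (pr₁ α) ⋙ push α ⋙ repRes A α where
  app N := (pushComp (pr₁₂ α) (pr₁ α)).app ((repRes A (pr₂₃ α)).obj N) ≫
    (push (pr₁ α)).map ((baseChange (pr₂ α) (pr₁ α)).app N) ≫
      (baseChange α α).app ((push (pr₁ α)).obj N)
  naturality N M φ := by
    have h₁ := (pushComp (pr₁₂ α) (pr₁ α)).naturality ((repRes A (pr₂₃ α)).map φ)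
    have h₂ := (baseChange (pr₂ α) (pr₁ α)).naturality φ
    have h₃ := (baseChange α α).naturality ((push (pr₁ α)).map φ)
    refine ((Category.assoc _ _ _).symm.trans (congrArg (· ≫ _) h₁)).trans ?_
    refine (Category.assoc _ _ _).trans (Eq.trans ?_ (Category.assoc _ _ _).symm)
    refine congrArg (_ ≫ ·) ?_
    refine Eq.trans ?_ (Category.assoc _ _ _).symm
    refine Eq.trans ?_ (congrArg (_ ≫ ·) h₃)
    refine (Category.assoc _ _ _).symm.trans (Eq.trans ?_ (Category.assoc _ _ _))
    refine congrArg (· ≫ _) ?_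
    exact ((push (pr₁ α)).map_comp _ _).symm.trans ((congrArg _ h₂).trans
      ((push (pr₁ α)).map_comp _ _))

/-- The point of the triple fibre product given by a point `u'` over `α u` and a point `z` of the
double fibre product over `u'`. -/
noncomputable def tplFib (u : ActionCategory G U.V) (u' : Fib α ((actionMap α).obj u))
    (z : Fib (pr₁ α) (pt u'.1)) : Fib (pr₁₂ α ≫ pr₁ α) u :=
  ⟨(pbFib (pr₂ α) (pr₁ α) (pt (pbFib α α u u').1)
    ⟨z.1, z.2.trans (snd_pbFib α α u u').symm⟩).1, by
      rw [hom_comp_apply]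
      refine (congrArg _ (pbFib (pr₂ α) (pr₁ α) (pt (pbFib α α u u').1)
        ⟨z.1, z.2.trans (snd_pbFib α α u u').symm⟩).2).trans ?_
      exact (pbFib α α u u').2⟩

theorem pr₁₂_tplFib (u : ActionCategory G U.V) (u' : Fib α ((actionMap α).obj u))
    (z : Fib (pr₁ α) (pt u'.1)) : (pr₁₂ α).hom (tplFib α u u' z).1 = (pbFib α α u u').1 :=
  (pbFib (pr₂ α) (pr₁ α) (pt (pbFib α α u u').1)
    ⟨z.1, z.2.trans (snd_pbFib α α u u').symm⟩).2

theorem pr₂₃_tplFib (u : ActionCategory G U.V) (u' : Fib α ((actionMap α).obj u))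
    (z : Fib (pr₁ α) (pt u'.1)) : (pr₂₃ α).hom (tplFib α u u' z).1 = z.1 :=
  snd_pbFib (pr₂ α) (pr₁ α) _ _

theorem pushTriple_π (N : RepCat A (dbl α)) (u : ActionCategory G U.V)
    (u' : Fib α ((actionMap α).obj u)) (z : Fib (pr₁ α) (pt u'.1)) :
    ((pushTriple α).app N).app u ≫ pushπ α ((push (pr₁ α)).obj N) ((actionMap α).obj u) u' ≫
        pushπ (pr₁ α) N (pt u'.1) z =
      pushπ (pr₁₂ α ≫ pr₁ α) ((repRes A (pr₂₃ α)).obj N) u (tplFib α u u' z) ≫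
        N.map (arr (y := (actionMap (pr₂₃ α)).obj (pt (tplFib α u u' z).1)) (y' := pt z.1) 1
          ((one_smul G _).trans (pr₂₃_tplFib α u u' z))) := by
  refine (Category.assoc _ _ _).trans ((congrArg _ (Category.assoc _ _ _)).trans ?_)
  refine (congrArg (_ ≫ _ ≫ ·) ((reassoc_of% baseChange_π) α α _ u u' _)).trans ?_
  refine (congrArg (_ ≫ _ ≫ _ ≫ ·) (push_obj_map_π (pr₁ α) N _ z)).trans ?_
  refine (congrArg (_ ≫ ·) ((reassoc_of% push_map_app_π) _ _ u _ _)).trans ?_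
  refine (congrArg (_ ≫ _ ≫ ·) ((reassoc_of% baseChange_π) (pr₂ α) (pr₁ α) N _ _ _)).trans ?_
  refine ((reassoc_of% pushComp_π) _ _ _ u _ _ _).trans ?_
  refine (congrArg (_ ≫ ·) (map_arr_comp N _ _ _ _)).trans ?_
  refine pushπ_res_congr _ _ N (Subtype.ext ?_) _ _ (one_mul 1)
  exact congrArg (fun y => (pbFib (pr₂ α) (pr₁ α) (pt (pbFib α α u u').1) y).1)
    (Subtype.ext (inv_smul_eq_iff.2 (one_smul G z.1).symm))

/-- Over `u`, both sides send a family `(w_{u'})` to the family with value `w_{u'}` at `(u', u'')`.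
-/
theorem refine_triple₁₂ (W : RepCat A U) :
    (pushRefine (pr₁₂ α) (pr₁ α) (pr₁₂ α ≫ pr₁ α) rfl).app ((repRes A (pr₂ α)).obj W) ≫
        (push (pr₁₂ α ≫ pr₁ α)).map ((repSwap (pr₁₂_pr₂ α)).app W) ≫
          (pushTriple α).app ((repRes A (pr₁ α)).obj W) =
      (baseChange α α).app W ≫ (repRes A α).map ((push α).map ((pushUnit (pr₁ α)).app W)) := by
  ext u
  refine push_hom_ext fun u' => push_hom_ext fun z => ?_
  refine (Category.assoc _ _ _).trans ((Category.assoc _ _ _).trans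
    ((congrArg _ (Category.assoc _ _ _)).trans ?_))
  refine (congrArg (_ ≫ _ ≫ ·) (pushTriple_π α _ u u' z)).trans ?_
  refine (congrArg (_ ≫ ·) ((reassoc_of% push_map_app_π) _ _ u _ _)).trans ?_
  refine ((reassoc_of% pushRefine_π) _ _ _ _ _ u _ _).trans ?_
  refine (congrArg (_ ≫ ·) (map_arr_comp W _ _ _ _)).trans ?_
  refine Eq.trans ?_ ((Category.assoc _ _ _).trans ((Category.assoc _ _ _).trans
    ((congrArg (_ ≫ ·) ((reassoc_of% push_map_app_π) _ _ _ u' _)).trans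
      ((congrArg (_ ≫ _ ≫ ·) (pushUnit_app_π (pr₁ α) W _ z)).trans
        (((reassoc_of% baseChange_π) α α W u u' _).trans
          (congrArg (_ ≫ ·) (map_arr_comp W _ _ _ _))))))).symm
  exact pushπ_res_congr _ _ W (Subtype.ext (pr₁₂_tplFib α u u' z)) _ _ rfl

/-- Over `u`, both sides send a family `(w_{u'})` to the family with value `w_{u''}` at `(u', u'')`.
-/
theorem refine_triple₁₃ (W : RepCat A U) :
    (pushRefine (pr₁₃ α) (pr₁ α) (pr₁₂ α ≫ pr₁ α) (pr₁₃_pr₁ α)).app ((repRes A (pr₂ α)).obj W) ≫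
        (push (pr₁₂ α ≫ pr₁ α)).map ((repSwap (pr₁₃_pr₂ α)).app W) ≫
          (pushTriple α).app ((repRes A (pr₂ α)).obj W) ≫
            (repRes A α).map ((push α).map ((baseChange α α).app W)) =
      (baseChange α α).app W ≫ (repRes A α).map ((pushUnit α).app ((push α).obj W)) := by
  ext u
  refine push_hom_ext fun u' => push_hom_ext fun v => ?_
  refine (Category.assoc _ _ _).trans ((Category.assoc _ _ _).trans
    ((congrArg _ (Category.assoc _ _ _)).trans
      ((congrArg (_ ≫ _ ≫ ·) (Category.assoc _ _ _)).trans ?_)))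
  refine (congrArg (_ ≫ _ ≫ _ ≫ ·) ((reassoc_of% push_map_app_π) _ _ _ u' _)).trans ?_
  refine (congrArg (_ ≫ _ ≫ _ ≫ _ ≫ ·) (baseChange_π α α _ _ _)).trans ?_
  refine (congrArg (_ ≫ _ ≫ ·) ((congrArg (_ ≫ ·) (Category.assoc _ _ _).symm).trans
    (Category.assoc _ _ _).symm)).trans ?_
  refine (congrArg (fun k => _ ≫ _ ≫ k ≫ _) (pushTriple_π α _ u u' _)).trans ?_
  refine (congrArg (_ ≫ _ ≫ ·) (Category.assoc _ _ _)).trans ?_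
  refine (congrArg (_ ≫ ·) ((reassoc_of% push_map_app_π) _ _ u _ _)).trans ?_
  refine ((reassoc_of% pushRefine_π) _ _ _ _ _ u _ _).trans ?_
  refine (congrArg (_ ≫ _ ≫ ·) (map_arr_comp W _ _ _ _)).trans ?_
  refine (congrArg (_ ≫ ·) (map_arr_comp W _ _ _ _)).trans ?_
  refine Eq.trans ?_ ((Category.assoc _ _ _).trans ((Category.assoc _ _ _).trans
    ((congrArg (_ ≫ ·) ((Category.assoc _ _ _).symm.trans
      (congrArg (· ≫ _) (pushUnit_app_π α _ _ u')))).trans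
      ((congrArg (_ ≫ ·) (push_obj_map_π α W _ v)).trans
        (((reassoc_of% baseChange_π) α α W u _ _).trans
          (congrArg (_ ≫ ·) (map_arr_comp W _ _ _ _))))))).symm
  refine pushπ_res_congr _ _ W (fib_pullback_ext (h := α) (f := α) ?_) _ _ (by simp)
  refine (congrArg (fun k : tpl α ⟶ U =>
    k.hom (tplFib α u u' (pbFib α α (pt u'.1) v)).1) (pr₁₃_pr₂ α)).trans ?_
  refine (congrArg (pr₂ α).hom (pr₂₃_tplFib α u u' _)).trans ?_
  refine (snd_pbFib α α _ _).trans (Eq.trans ?_ (snd_pbFib α α u _).symm)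
  exact (inv_smul_eq_iff.2 (one_smul G _).symm).symm

end kit

/-! ### The weighted trace, a retraction of the unit. -/

section trace
variable {G : Type t} [Group G] {A : Type u} [Category.{v} A] [Preadditive A]
  [HasFiniteBiproducts A] {R : Type*} [CommRing R] [Linear R A] {X Y : GSets.{w} G} (f : Y ⟶ X)

noncomputable instance fibFintype (x : ActionCategory G X.V) : Fintype (Fib f x) :=
  Fintype.ofFinite _

/-- The bijection between fibres given by a morphism of the action groupoid. -/
def fibEquiv {x x' : ActionCategory G X.V} (g : x ⟶ x') : Fib f x' ≃ Fib f x where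
  toFun y := ⟨g.1⁻¹ • y.1, inv_mem_fib f g y⟩
  invFun y := ⟨g.1 • y.1, (hom_smul f _ _).trans ((congrArg (g.1 • ·) y.2).trans g.2)⟩
  left_inv y := Subtype.ext (smul_inv_smul g.1 y.1)
  right_inv y := Subtype.ext (inv_smul_smul g.1 y.1)

/-- The weighted trace `f_* f^* ⟶ 1`. -/
noncomputable def pushTrace (c : Y.V → R) (hc : ∀ (g : G) (y : Y.V), c (g • y) = c y) :
    repRes A f ⋙ push f ⟶ 𝟭 (RepCat A X) where
  app V :=
    { app x := ∑ y : Fib f x, c y.1 • (pushπ f ((repRes A f).obj V) x y ≫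
        V.map (arr (y := (actionMap f).obj (pt y.1)) 1 (one_smul_fib' f x y)))
      naturality x x' g := by
        refine (Preadditive.comp_sum _ _ _).trans (Eq.trans ?_ (Preadditive.sum_comp _ _ _).symm)
        refine Fintype.sum_equiv (fibEquiv f g) _ _ fun y => ?_
        refine (Linear.comp_smul _ _ _ _ _ _).trans (Eq.trans ?_ (Linear.smul_comp _ _ _ _ _ _).symm)
        refine congrArg₂ (· • ·) (hc _ _).symm ?_
        refine (Category.assoc _ _ _).symm.trans ?_
        refine (congrArg (· ≫ _) (push_obj_map_π _ _ g y)).trans ?_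
        refine (Category.assoc _ _ _).trans (Eq.trans ?_ (Category.assoc _ _ _).symm)
        refine (congrArg (_ ≫ ·) (map_arr_comp V _ _ _ _)).trans
          (Eq.trans ?_ (congrArg (_ ≫ ·) (map_arr_comp V _ _ _ g.2)).symm)
        exact pushπ_res_congr _ _ V rfl _ _ ((one_mul _).trans (mul_one _).symm) }
  naturality V V' φ := by
    ext x
    refine (Preadditive.comp_sum _ _ _).trans (Eq.trans ?_ (Preadditive.sum_comp _ _ _).symm)
    refine Finset.sum_congr rfl fun y _ => ?_
    refine (Linear.comp_smul _ _ _ _ _ _).trans (Eq.trans ?_ (Linear.smul_comp _ _ _ _ _ _).symm)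
    refine congrArg (_ • ·) ?_
    refine (Category.assoc _ _ _).symm.trans ?_
    refine (congrArg (· ≫ _) (push_map_app_π _ _ x y)).trans ?_
    refine (Category.assoc _ _ _).trans (Eq.trans ?_ (Category.assoc _ _ _).symm)
    exact congrArg (_ ≫ ·) (φ.naturality _).symm

/-- The unit is diagonal, so the composite is multiplication by the sum of the weights over the
fibre. -/
theorem pushUnit_trace (c : Y.V → R) (hc : ∀ (g : G) (y : Y.V), c (g • y) = c y)
    (hs : ∀ x : ActionCategory G X.V, ∑ y : Fib f x, c y.1 = 1) (V : RepCat A X) :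
    (pushUnit f).app V ≫ (pushTrace f c hc).app V = 𝟙 V := by
  ext x
  refine (Preadditive.comp_sum _ _ _).trans ?_
  refine (Finset.sum_congr rfl fun y _ => ?_ : _ = ∑ y : Fib f x, c y.1 • 𝟙 (V.obj x)).trans ?_
  · refine (Linear.comp_smul _ _ _ _ _ _).trans (congrArg (_ • ·) ?_)
    refine ((reassoc_of% pushUnit_app_π) f V x y _).trans ((map_arr_comp V _ _ _ _).trans ?_)
    exact (map_arr_congr V _ (one_mul 1)).trans (map_arr_one V _)
  · rw [← Finset.sum_smul, hs, one_smul]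
    rfl

end trace

/-! ### The push-forward kit for representations. -/

section repKit

theorem resSwap_rep {G : Type t} [Group G] {A : Type u} [Category.{v} A]
    {X Y Y' Z : GSets.{w} G} {f : Y ⟶ X} {f' : Y' ⟶ X} {g : Z ⟶ Y}
    {g' : Z ⟶ Y'} (h : g ≫ f = g' ≫ f') (V : RepCat A X) :
    resSwap (Rep G A) h V = (repSwap h).app V :=
  (repSwap_eqToHom h V _).symm

variable {G : Type t} [Group G] {A : Type u} [Category.{v} A] [Preadditive A]
  [HasFiniteBiproducts A] {R : Type*} [CommRing R] [Linear R A] {X U : GSets.{w} G} (α : U ⟶ X)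
  (c : U.V → R) (hc : ∀ (g : G) (y : U.V), c (g • y) = c y)
  (hs : ∀ x : ActionCategory G X.V, ∑ y : Fib α x, c y.1 = 1)

/-- The push-forward functors for representations. -/
noncomputable def repKit : PushKit (Rep G A) α where
  aPush := push α
  pPush := push (pr₁ α)
  qPush := push (pr₁₂ α ≫ pr₁ α)
  η := pushUnit α
  ρ := pushTrace α c hc
  ε := pushCounit α
  η₁ := pushUnit (pr₁ α)
  ε₁ := pushCounit (pr₁ α)
  b := baseChange α α
  c₁₂ := pushRefine (pr₁₂ α) (pr₁ α) (pr₁₂ α ≫ pr₁ α) rfl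
  c₁₃ := pushRefine (pr₁₃ α) (pr₁ α) (pr₁₂ α ≫ pr₁ α) (pr₁₃_pr₁ α)
  κ := pushTriple α
  η_ρ V := pushUnit_trace α c hc hs V
  res_η_ε V := res_pushUnit_counit α V
  res_η₁_ε₁ W := res_pushUnit_counit (pr₁ α) W
  res_b_ε W := (congrArg (fun k => (repRes A (pr₁ α)).map ((baseChange α α).app W) ≫ k ≫
    (repRes A (pr₂ α)).map ((pushCounit α).app W)) (resSwap_rep _ _)).trans
      (res_baseChange_counit α α W)
  η₁_b V := (congrArg (fun k => (pushUnit (pr₁ α)).app ((repRes A α).obj V) ≫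
    (push (pr₁ α)).map k ≫ (baseChange α α).app ((repRes A α).obj V)) (resSwap_rep _ _)).trans
      (unit_baseChange α α V)
  c₁₂_κ W := (congrArg (fun k => (pushRefine (pr₁₂ α) (pr₁ α) (pr₁₂ α ≫ pr₁ α) rfl).app
    ((repRes A (pr₂ α)).obj W) ≫ (push (pr₁₂ α ≫ pr₁ α)).map k ≫
      (pushTriple α).app ((repRes A (pr₁ α)).obj W)) (resSwap_rep _ _)).trans (refine_triple₁₂ α W)
  η₁_c W := (congrArg (fun k => (pushUnit (pr₁ α)).app W ≫
    (pushRefine (pr₁₂ α) (pr₁ α) (pr₁₂ α ≫ pr₁ α) rfl).app ((repRes A (pr₁ α)).obj W) ≫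
      (push (pr₁₂ α ≫ pr₁ α)).map k) (resSwap_rep _ _)).trans (unit_refine _ _ _ _ _ _ W)
  c₁₃_κ W := (congrArg (fun k =>
    (pushRefine (pr₁₃ α) (pr₁ α) (pr₁₂ α ≫ pr₁ α) (pr₁₃_pr₁ α)).app ((repRes A (pr₂ α)).obj W) ≫
      (push (pr₁₂ α ≫ pr₁ α)).map k ≫ (pushTriple α).app ((repRes A (pr₂ α)).obj W) ≫
        (repRes A α).map ((push α).map ((baseChange α α).app W))) (resSwap_rep _ _)).trans
          (refine_triple₁₃ α W)

end repKit

/-! ### Invariant weights on a sipp cover. -/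

section weight
variable {G : Type t} [Group G]

/-- Over a sipp-cover there are invariant weights with sum `1` along the fibres. -/
theorem exists_weight (p : ℕ) {R : Type*} [CommRing R]
    (hR : ∀ n : ℕ, n.Coprime p → IsUnit (n : R)) {X U : GSets.{w} G} (α : U ⟶ X)
    (hα : IsSippCovering p (Presieve.singleton α)) :
    ∃ c : U.V → R, (∀ (g : G) (u : U.V), c (g • u) = c u) ∧
      ∀ x : ActionCategory G X.V, ∑ y : Fib α x, c y.1 = 1 := by
  classical
  have hα' (x : X.V) : ∃ u : U.V, α.hom u = x ∧
      ((MulAction.stabilizer G u).relIndex (MulAction.stabilizer G x)).Coprime p := by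
    obtain ⟨_, _, ⟨⟩, h⟩ := hα x
    exact h
  choose s hs hc using hα'
  -- The points `s x` are not chosen equivariantly. Using only the choice at one representative `q
  -- x` of each orbit makes the sets `S x` below equivariant in `x`.
  let q (x : X.V) : X.V := (Quotient.mk (MulAction.orbitRel G X.V) x).out
  have hq (g : G) (x : X.V) : q (g • x) = q x :=
    congrArg Quotient.out (Quotient.sound (s := MulAction.orbitRel G X.V) ⟨g, rfl⟩)
  have hq' (x : X.V) : ∃ g : G, g • q x = x := by
    obtain ⟨g, hg⟩ := Quotient.exact (s := MulAction.orbitRel G X.V)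
      (Quotient.out_eq (Quotient.mk (MulAction.orbitRel G X.V) x))
    exact ⟨g⁻¹, inv_smul_eq_iff.2 hg.symm⟩
  let S (x : X.V) : Set U.V := {u | α.hom u = x ∧ u ∈ MulAction.orbit G (s (q x))}
  have hS (g : G) (x : X.V) : S (g • x) = (g • ·) '' S x := by
    ext u
    constructor
    · rintro ⟨h₁, h₂⟩
      refine ⟨g⁻¹ • u, ⟨?_, ?_⟩, smul_inv_smul g u⟩
      · rw [hom_smul, h₁, inv_smul_smul]
      · rw [hq] at h₂
        exact MulAction.mem_orbit_of_mem_orbit g⁻¹ h₂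
    · rintro ⟨v, ⟨h₁, h₂⟩, rfl⟩
      refine ⟨by rw [hom_smul, h₁], ?_⟩
      rw [hq]
      exact MulAction.mem_orbit_of_mem_orbit g h₂
  have hcard (x : X.V) : ((S x).ncard).Coprime p := by
    obtain ⟨g, hg⟩ := hq' x
    have h₁ : (S x).ncard = (S (q x)).ncard := by
      conv_lhs => rw [← hg, hS]
      exact Set.ncard_image_of_injective _ (MulAction.injective g)
    have hqq : q (q x) = q x := by conv_rhs => rw [← hg, hq]
    -- Hence the cardinality of `S (q x)` is the index that the sipp condition makes prime to `p`.
    have h₂ : S (q x) = MulAction.orbit (MulAction.stabilizer G (q x)) (s (q x)) := by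
      ext u
      constructor
      · rintro ⟨h₁, h₂⟩
        rw [hqq] at h₂
        obtain ⟨k, rfl⟩ := h₂
        have hk : k • q x = q x := by
          have := h₁
          dsimp only at this
          rw [hom_smul, hs] at this
          exact this
        exact ⟨⟨k, hk⟩, rfl⟩
      · rintro ⟨⟨k, hk⟩, rfl⟩
        refine ⟨?_, ?_⟩
        · refine (hom_smul α k _).trans ?_
          rw [hs]
          exact hk
        · rw [hqq]
          exact ⟨k, rfl⟩
    rw [h₁, h₂, ← MulAction.index_stabilizer]
    exact hc (q x)
  -- The uniform weight on each `S x`. The cardinality is a unit, so `Ring.inverse` is a true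
  -- inverse here.
  refine ⟨fun u => if u ∈ S (α.hom u) then Ring.inverse ((S (α.hom u)).ncard : R) else 0,
    fun g u => ?_, fun x => ?_⟩
  · have h₁ : g • u ∈ S (α.hom (g • u)) ↔ u ∈ S (α.hom u) := by
      rw [hom_smul, hS]
      exact (MulAction.injective g).mem_set_image
    have h₂ : (S (α.hom (g • u))).ncard = (S (α.hom u)).ncard := by
      rw [hom_smul, hS]
      exact Set.ncard_image_of_injective _ (MulAction.injective g)
    simp only [h₁, h₂]
  · have h : ∀ y : Fib α x, (if y.1 ∈ S (α.hom y.1) then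
        Ring.inverse ((S (α.hom y.1)).ncard : R) else 0) =
        if y.1 ∈ S x.back then Ring.inverse ((S x.back).ncard : R) else 0 := fun y => by
      simp only [y.2]
    rw [Finset.sum_congr rfl fun y _ => h y, Finset.sum_ite, Finset.sum_const_zero, add_zero,
      Finset.sum_const, nsmul_eq_mul]
    have h' : (Finset.univ.filter fun y : Fib α x => y.1 ∈ S x.back).card = (S x.back).ncard := by
      rw [← Set.ncard_coe_finset]
      have : S x.back = Subtype.val '' (↑(Finset.univ.filter fun y : Fib α x => y.1 ∈ S x.back) :
          Set (Fib α x)) := by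
        ext u
        constructor
        · intro hu
          exact ⟨⟨u, hu.1⟩, by simpa using hu, rfl⟩
        · rintro ⟨y, hy, rfl⟩
          simpa using hy
      conv_rhs => rw [this]
      exact (Set.ncard_image_of_injective _ Subtype.val_injective).symm
    rw [h']
    exact Ring.mul_inverse_cancel _ (hR _ (hcard _))

theorem isUnit_natCast_zLoc (p : ℕ) [Fact p.Prime] (n : ℕ) (hn : n.Coprime p) :
    IsUnit (n : ZLoc p) := by
  have h : (n : ℤ) ∈ (Ideal.span {(p : ℤ)}).primeCompl := by
    intro h
    have h' : (p : ℤ) ∣ n := Ideal.mem_span_singleton.1 h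
    exact (Nat.Prime.coprime_iff_not_dvd Fact.out).1 hn.symm (by exact_mod_cast h')
  have := IsLocalization.map_units (ZLoc p) ⟨(n : ℤ), h⟩
  simpa using this

theorem isUnit_natCast_field (p : ℕ) [Fact p.Prime] (k : Type*) [Field k] [CharP k p] (n : ℕ)
    (hn : n.Coprime p) : IsUnit (n : k) := by
  rw [isUnit_iff_ne_zero, Ne, CharP.cast_eq_zero_iff k p]
  exact (Nat.Prime.coprime_iff_not_dvd Fact.out).1 hn.symm

end weight

/-! ### Case (a): representations in an idempotent-complete category. -/

section rep
variable {G : Type t} [Group G] {A : Type u} [Category.{v} A] [Preadditive A]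

theorem isAdditivePresheaf_rep [HasFiniteProducts A] : IsAdditivePresheaf (Rep.{w} G A) :=
  ⟨fun X => inferInstanceAs (Preadditive (RepCat A X)),
    fun X => inferInstanceAs (HasFiniteProducts (RepCat A X)),
    fun _ _ f => inferInstanceAs (repRes A f).Additive⟩

theorem isStrictStack_rep [Finite G] (p : ℕ) [Fact p.Prime] [HasFiniteProducts A]
    [Linear (ZLoc p) A] [IsIdempotentComplete A] :
    IsStrictStack (Rep.{w} G A) (sippTopology G p) := fun X U α hα => by
  have : HasFiniteBiproducts A := HasFiniteBiproducts.of_hasFiniteProducts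
  obtain ⟨c, hc, hs⟩ := exists_weight p (isUnit_natCast_zLoc p) α hα
  have : IsIdempotentComplete ((Rep.{w} G A).obj (op X)) :=
    inferInstanceAs (IsIdempotentComplete (RepCat A X))
  exact (repKit α c hc hs).isEquivalence_comparison

end rep

/-! ### The push-forward kit for derived categories. -/

section derKit

attribute [local instance] Abelian.hasFiniteBiproducts

/-- As a right adjoint, push-forward preserves kernels; it preserves epimorphisms because it is
pointwise a finite biproduct. -/
instance push_preservesHomology {G : Type t} [Group G] {A : Type u} [Category.{v} A] [Abelian A]
    {X Y : GSets.{w} G} (f : Y ⟶ X) : (push (A := A) f).PreservesHomology := by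
  have : PreservesLimitsOfSize.{0, 0} (push (A := A) f) :=
    (pushAdj f).rightAdjoint_preservesLimits
  have : (push (A := A) f).PreservesEpimorphisms := ⟨fun {N M} φ hφ => by
    rw [NatTrans.epi_iff_epi_app] at hφ ⊢
    intro x
    have (y : Fib f x) := hφ (pt y.1)
    change Epi (biproduct.map fun y : Fib f x => φ.app (pt y.1))
    infer_instance⟩
  exact Functor.preservesHomology_of_preservesEpis_and_kernels _

namespace Der

variable {C C' : Type*} [Category* C] [Category* C'] [Abelian C] [Abelian C']

/-- The localization functor from complexes to the derived category. -/
abbrev Q (C : Type*) [Category* C] [Abelian C] : CochainComplex C ℤ ⥤ Der C :=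
  MorphismProperty.Q _

theorem map_Q_map (F : C ⥤ C') [F.Additive] [F.PreservesHomology] {K L : CochainComplex C ℤ}
    (f : K ⟶ L) : (Der.map F).map ((Q C).map f) =
      (Q C').map ((F.mapHomologicalComplex (ComplexShape.up ℤ)).map f) := by
  have h := Functor.congr_hom (Der.fac F) f
  refine h.trans ?_
  exact (Category.id_comp _).trans (Category.comp_id _)

/-- A natural transformation between functors on the derived category, given by its components at
complexes. -/
def natMk {E : Type*} [Category* E] (F₁ F₂ : Der C ⥤ E)
    (τ : ∀ K : CochainComplex C ℤ, F₁.obj ((Q C).obj K) ⟶ F₂.obj ((Q C).obj K))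
    (h : ∀ {K L : CochainComplex C ℤ} (f : K ⟶ L),
      F₁.map ((Q C).map f) ≫ τ L = τ K ≫ F₂.map ((Q C).map f)) : F₁ ⟶ F₂ where
  app X := τ X.as.obj
  naturality := by
    let τ' : ∀ X : Der C, F₁.obj X ⟶ F₂.obj X := fun X => τ X.as.obj
    -- The morphisms at which the family is natural include the images of morphisms of complexes and
    -- are stable under inverses, so they are all the morphisms of the localization.
    suffices MorphismProperty.naturalityProperty τ' = ⊤ by
      intro X Y f
      have h : (⊤ : MorphismProperty (Der C)) f := MorphismProperty.top_apply f
      rw [← this] at h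
      exact h
    exact Localization.Construction.morphismProperty_eq_top' _ (fun _ _ f => h f)
      (MorphismProperty.naturalityProperty.stableUnderInverse _)

theorem map_map_Q_map {C'' : Type*} [Category* C''] [Abelian C''] (F : C ⥤ C') (F' : C' ⥤ C'')
    [F.Additive] [F.PreservesHomology] [F'.Additive] [F'.PreservesHomology]
    {K L : CochainComplex C ℤ} (f : K ⟶ L) :
    (Der.map F').map ((Der.map F).map ((Q C).map f)) =
      (Q C'').map ((F'.mapHomologicalComplex (ComplexShape.up ℤ)).map
        ((F.mapHomologicalComplex (ComplexShape.up ℤ)).map f)) :=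
  (congrArg (Der.map F').map (map_Q_map F f)).trans (map_Q_map F' _)

theorem map_map_map_Q_map {C'' C₃ : Type*} [Category* C''] [Abelian C''] [Category* C₃] [Abelian C₃]
    (F : C ⥤ C') (F' : C' ⥤ C'') (F'' : C'' ⥤ C₃)
    [F.Additive] [F.PreservesHomology] [F'.Additive] [F'.PreservesHomology]
    [F''.Additive] [F''.PreservesHomology] {K L : CochainComplex C ℤ} (f : K ⟶ L) :
    (Der.map F'').map ((Der.map F').map ((Der.map F).map ((Q C).map f))) =
      (Q C₃).map ((F''.mapHomologicalComplex (ComplexShape.up ℤ)).map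
        ((F'.mapHomologicalComplex (ComplexShape.up ℤ)).map
          ((F.mapHomologicalComplex (ComplexShape.up ℤ)).map f))) :=
  (congrArg (Der.map F'').map (map_map_Q_map F F' f)).trans (map_Q_map F'' _)

theorem Q_square {K₁ K₂ L₁ L₂ : CochainComplex C ℤ} {a : (Q C).obj K₁ ⟶ (Q C).obj K₂}
    {a' : K₁ ⟶ K₂} (ha : a = (Q C).map a') {b : (Q C).obj L₁ ⟶ (Q C).obj L₂} {b' : L₁ ⟶ L₂}
    (hb : b = (Q C).map b') (s : K₁ ⟶ L₁) (t : K₂ ⟶ L₂) (h : a' ≫ t = s ≫ b') :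
    a ≫ (Q C).map t = (Q C).map s ≫ b := by
  rw [ha, hb, ← Functor.map_comp, ← Functor.map_comp, h]

/-- The morphism of complexes induced by a natural transformation. -/
abbrev chMap {P₁ P₂ : C ⥤ C'} [P₁.Additive] [P₂.Additive] (τ : P₁ ⟶ P₂)
    (K : CochainComplex C ℤ) :=
  (NatTrans.mapHomologicalComplex τ (ComplexShape.up ℤ)).app K

theorem chMap_naturality {P₁ P₂ : C ⥤ C'} [P₁.Additive] [P₂.Additive] (τ : P₁ ⟶ P₂)
    {K L : CochainComplex C ℤ} (f : K ⟶ L) :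
    (P₁.mapHomologicalComplex (ComplexShape.up ℤ)).map f ≫ chMap τ L =
      chMap τ K ≫ (P₂.mapHomologicalComplex (ComplexShape.up ℤ)).map f :=
  (NatTrans.mapHomologicalComplex τ (ComplexShape.up ℤ)).naturality f

variable {C₁ C₂ C₃ : Type*} [Category* C₁] [Abelian C₁] [Category* C₂] [Abelian C₂]
  [Category* C₃] [Abelian C₃]

/-- The natural transformation on derived categories induced by `1 ⟶ F ⋙ F'`. -/
noncomputable def natUnit (F : C ⥤ C') (F' : C' ⥤ C) [F.Additive] [F.PreservesHomology]
    [F'.Additive] [F'.PreservesHomology] (τ : 𝟭 C ⟶ F ⋙ F') :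
    𝟭 (Der C) ⟶ Der.map F ⋙ Der.map F' :=
  natMk _ _ (fun K => (Q C).map (chMap τ K)) fun {K L} f =>
    Q_square (a := (Q C).map f) rfl (map_map_Q_map F F' f) (chMap τ K) (chMap τ L)
      (chMap_naturality τ f)

/-- The natural transformation on derived categories induced by `F ⋙ F' ⟶ 1`. -/
noncomputable def natCounit (F : C ⥤ C') (F' : C' ⥤ C) [F.Additive] [F.PreservesHomology]
    [F'.Additive] [F'.PreservesHomology] (τ : F ⋙ F' ⟶ 𝟭 C) :
    Der.map F ⋙ Der.map F' ⟶ 𝟭 (Der C) :=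
  natMk _ _ (fun K => (Q C).map (chMap τ K)) fun {K L} f =>
    Q_square (map_map_Q_map F F' f) (b := (Q C).map f) rfl (chMap τ K) (chMap τ L)
      (chMap_naturality τ f)

/-- The natural transformation on derived categories induced by `F₁ ⋙ F₁' ⟶ F₂ ⋙ F₂'`. -/
noncomputable def natSquare (F₁ : C ⥤ C₁) (F₁' : C₁ ⥤ C') (F₂ : C ⥤ C₂) (F₂' : C₂ ⥤ C')
    [F₁.Additive] [F₁.PreservesHomology] [F₁'.Additive] [F₁'.PreservesHomology]
    [F₂.Additive] [F₂.PreservesHomology] [F₂'.Additive] [F₂'.PreservesHomology]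
    (τ : F₁ ⋙ F₁' ⟶ F₂ ⋙ F₂') : Der.map F₁ ⋙ Der.map F₁' ⟶ Der.map F₂ ⋙ Der.map F₂' :=
  natMk _ _ (fun K => (Q C').map (chMap τ K)) fun {K L} f =>
    Q_square (map_map_Q_map F₁ F₁' f) (map_map_Q_map F₂ F₂' f) (chMap τ K) (chMap τ L)
      (chMap_naturality τ f)

/-- The natural transformation on derived categories induced by `F ⟶ F₁ ⋙ F₂`. -/
noncomputable def natTriangle (F : C ⥤ C') (F₁ : C ⥤ C₁) (F₂ : C₁ ⥤ C')
    [F₁.Additive] [F₁.PreservesHomology] [F.Additive] [F.PreservesHomology]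
    [F₂.Additive] [F₂.PreservesHomology] (τ : F ⟶ F₁ ⋙ F₂) :
    Der.map F ⟶ Der.map F₁ ⋙ Der.map F₂ :=
  natMk _ _ (fun K => (Q C').map (chMap τ K)) fun {K L} f =>
    Q_square (map_Q_map F f) (map_map_Q_map F₁ F₂ f) (chMap τ K) (chMap τ L)
      (chMap_naturality τ f)

/-- The natural transformation on derived categories induced by `F₁ ⋙ F₁' ⟶ F₂ ⋙ F₂' ⋙ F₂''`. -/
noncomputable def natPentagon (F₁ : C ⥤ C₁) (F₁' : C₁ ⥤ C') (F₂ : C ⥤ C₂) (F₂' : C₂ ⥤ C₃)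
    (F₂'' : C₃ ⥤ C') [F₁.Additive] [F₁.PreservesHomology] [F₁'.Additive] [F₁'.PreservesHomology]
    [F₂.Additive] [F₂.PreservesHomology] [F₂'.Additive] [F₂'.PreservesHomology]
    [F₂''.Additive] [F₂''.PreservesHomology] (τ : F₁ ⋙ F₁' ⟶ F₂ ⋙ F₂' ⋙ F₂'') :
    Der.map F₁ ⋙ Der.map F₁' ⟶ Der.map F₂ ⋙ Der.map F₂' ⋙ Der.map F₂'' :=
  natMk _ _ (fun K => (Q C').map (chMap τ K)) fun {K L} f =>
    Q_square (map_map_Q_map F₁ F₁' f) (map_map_map_Q_map F₂ F₂' F₂'' f) (chMap τ K) (chMap τ L)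
      (chMap_naturality τ f)

end Der

variable {G : Type t} [Group G] {A : Type u} [Category.{v} A] [Abelian A]

/-- It suffices to treat objects `Q K`, since objects of the localization are complexes. In each
degree the claim is `repSwap_eqToHom`. -/
theorem resSwap_derRep {X Y Y' Z : GSets.{w} G} {f : Y ⟶ X} {f' : Y' ⟶ X} {g : Z ⟶ Y}
    {g' : Z ⟶ Y'} (h : g ≫ f = g' ≫ f') (K : CochainComplex (RepCat A X) ℤ) :
    resSwap (DerRep G A) h ((Der.Q _).obj K) =
      (Der.Q (RepCat A Z)).map (Der.chMap (repSwap (A := A) h) K) := by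
  have e : ((repRes A f ⋙ repRes A g).mapHomologicalComplex (ComplexShape.up ℤ)).obj K =
      ((repRes A f' ⋙ repRes A g').mapHomologicalComplex (ComplexShape.up ℤ)).obj K := by
    have h' : repRes A f ⋙ repRes A g = repRes A f' ⋙ repRes A g' := by
      change repRes A (g ≫ f) = repRes A (g' ≫ f')
      rw [h]
    congr
  have h' : Der.chMap (repSwap (A := A) h) K = eqToHom e := by
    ext n : 1
    rw [HomologicalComplex.eqToHom_f]
    exact repSwap_eqToHom h (K.X n) _
  rw [h', eqToHom_map]
  rfl

variable {R : Type*} [CommRing R] [Linear R A] {X U : GSets.{w} G} (α : U ⟶ X)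
  (c : U.V → R) (hc : ∀ (g : G) (y : U.V), c (g • y) = c y)
  (hs : ∀ x : ActionCategory G X.V, ∑ y : Fib α x, c y.1 = 1)

set_option maxHeartbeats 1600000 in
open Der in
/-- The push-forward functors for derived categories of representations. -/
noncomputable def derKit : PushKit (DerRep G A) α where
  aPush := Der.map (push α)
  pPush := Der.map (push (pr₁ α))
  qPush := Der.map (push (pr₁₂ α ≫ pr₁ α))
  η := natUnit (repRes A α) (push α) (pushUnit α)
  ρ := natCounit (repRes A α) (push α) (pushTrace α c hc)
  ε := natCounit (push α) (repRes A α) (pushCounit α)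
  η₁ := natUnit (repRes A (pr₁ α)) (push (pr₁ α)) (pushUnit (pr₁ α))
  ε₁ := natCounit (push (pr₁ α)) (repRes A (pr₁ α)) (pushCounit (pr₁ α))
  b := natSquare (repRes A (pr₂ α)) (push (pr₁ α)) (push α) (repRes A α) (baseChange α α)
  c₁₂ := natTriangle (push (pr₁ α)) (repRes A (pr₁₂ α)) (push (pr₁₂ α ≫ pr₁ α))
    (pushRefine (pr₁₂ α) (pr₁ α) _ rfl)
  c₁₃ := natTriangle (push (pr₁ α)) (repRes A (pr₁₃ α)) (push (pr₁₂ α ≫ pr₁ α))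
    (pushRefine (pr₁₃ α) (pr₁ α) _ (pr₁₃_pr₁ α))
  κ := natPentagon (repRes A (pr₂₃ α)) (push (pr₁₂ α ≫ pr₁ α)) (push (pr₁ α)) (push α)
    (repRes A α) (pushTriple α)
  -- Each identity of the kit is written as the image under `Q` of an identity of morphisms of
  -- complexes, which holds in each degree by the corresponding identity for representations.
  η_ρ V := by
    refine ((Q _).map_comp _ _).symm.trans ((congrArg (Q _).map ?_).trans ((Q _).map_id _))
    exact HomologicalComplex.hom_ext _ _ fun n => pushUnit_trace α c hc hs (V.as.obj.X n)
  res_η_ε V := by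
    refine (congrArg (· ≫ _) (map_Q_map _ _)).trans ?_
    refine ((Q _).map_comp _ _).symm.trans ((congrArg (Q _).map ?_).trans ((Q _).map_id _))
    exact HomologicalComplex.hom_ext _ _ fun n => res_pushUnit_counit α (V.as.obj.X n)
  res_η₁_ε₁ W := by
    refine (congrArg (· ≫ _) (map_Q_map _ _)).trans ?_
    refine ((Q _).map_comp _ _).symm.trans ((congrArg (Q _).map ?_).trans ((Q _).map_id _))
    exact HomologicalComplex.hom_ext _ _ fun n => res_pushUnit_counit (pr₁ α) (W.as.obj.X n)
  res_b_ε W := by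
    refine (congrArg₂ (· ≫ ·) (map_Q_map _ _) (congrArg₂ (· ≫ ·)
      (resSwap_derRep (pr_condition α) _) (map_Q_map _ _))).trans ?_
    refine (congrArg (_ ≫ ·) ((Q _).map_comp _ _).symm).trans ?_
    refine ((Q _).map_comp _ _).symm.trans (congrArg (Q _).map ?_)
    exact HomologicalComplex.hom_ext _ _ fun n => res_baseChange_counit α α (W.as.obj.X n)
  η₁_b V := by
    refine (congrArg (_ ≫ · ≫ _) ((congrArg _ (resSwap_derRep (pr_condition α) V.as.obj)).trans
      (map_Q_map _ _))).trans (Eq.trans ?_ (map_Q_map _ _).symm)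
    refine (congrArg (_ ≫ ·) ((Q _).map_comp _ _).symm).trans ?_
    refine ((Q _).map_comp _ _).symm.trans (congrArg (Q _).map ?_)
    exact HomologicalComplex.hom_ext _ _ fun n => unit_baseChange α α (V.as.obj.X n)
  c₁₂_κ W := by
    refine (congrArg (_ ≫ · ≫ _) ((congrArg _ (resSwap_derRep (pr₁₂_pr₂ α) W.as.obj)).trans
      (map_Q_map _ _))).trans (Eq.trans ?_ (congrArg (_ ≫ ·) (map_map_Q_map _ _ _)).symm)
    refine (congrArg (_ ≫ ·) ((Q _).map_comp _ _).symm).trans ?_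
    refine ((Q _).map_comp _ _).symm.trans (Eq.trans ?_ ((Q _).map_comp _ _))
    refine congrArg (Q _).map ?_
    exact HomologicalComplex.hom_ext _ _ fun n => refine_triple₁₂ α (W.as.obj.X n)
  η₁_c W := by
    refine (congrArg (_ ≫ _ ≫ ·) ((congrArg _ (resSwap_derRep (pr₁₃_pr₁ α).symm
      W.as.obj)).trans (map_Q_map _ _))).trans ?_
    refine (congrArg (_ ≫ ·) ((Q _).map_comp _ _).symm).trans ?_
    refine ((Q _).map_comp _ _).symm.trans (Eq.trans ?_ ((Q _).map_comp _ _))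
    refine congrArg (Q _).map ?_
    exact HomologicalComplex.hom_ext _ _ fun n =>
      unit_refine (pr₁₂ α) (pr₁₃ α) (pr₁ α) _ rfl (pr₁₃_pr₁ α) (W.as.obj.X n)
  c₁₃_κ W := by
    refine (congrArg₂ (fun k l => _ ≫ k ≫ _ ≫ l) ((congrArg _ (resSwap_derRep (pr₁₃_pr₂ α)
      W.as.obj)).trans (map_Q_map _ _)) (map_map_Q_map _ _ _)).trans
        (Eq.trans ?_ (congrArg (_ ≫ ·) (map_Q_map _ _)).symm)
    refine (congrArg (_ ≫ _ ≫ ·) ((Q _).map_comp _ _).symm).trans ?_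
    refine (congrArg (_ ≫ ·) ((Q _).map_comp _ _).symm).trans ?_
    refine ((Q _).map_comp _ _).symm.trans (Eq.trans ?_ ((Q _).map_comp _ _))
    refine congrArg (Q _).map ?_
    exact HomologicalComplex.hom_ext _ _ fun n => refine_triple₁₃ α (W.as.obj.X n)

end derKit

/-! ### Averages over the group and Higman's criterion for projectivity. -/

section average
variable {G : Type t} [Group G] {A : Type u} [Category.{v} A] {X : GSets.{w} G}

theorem smul_congr_map {M N : RepCat A X} (θ : ∀ x, M.obj x ⟶ N.obj x)
    {x x' y y' : ActionCategory G X.V} (h : y.back = y'.back) {g g' k k' : G}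
    (hg : g • x.back = y.back) (hg' : g' • x.back = y'.back)
    (hk : k • y.back = x'.back) (hk' : k' • y'.back = x'.back) (e : g = g') (e' : k = k') :
    M.map (arr g hg) ≫ θ y ≫ N.map (arr k hk) = M.map (arr g' hg') ≫ θ y' ≫ N.map (arr k' hk') := by
  obtain ⟨⟨⟩, y⟩ := y
  obtain ⟨⟨⟩, y'⟩ := y'
  change y = y' at h
  subst h e e'
  rfl

variable [Fintype G] [Preadditive A]

/-- The sum of the conjugates of a family of morphisms, which is a morphism of representations. -/
noncomputable def average {M N : RepCat A X} (θ : ∀ x, M.obj x ⟶ N.obj x) : M ⟶ N where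
  app x := ∑ g : G, M.map (arr (y := x) (y' := pt (g • x.back)) g rfl) ≫ θ (pt (g • x.back)) ≫
    N.map (arr (y := pt (g • x.back)) (y' := x) g⁻¹ (inv_smul_smul g x.back))
  naturality x x' h := by
    rw [Preadditive.comp_sum, Preadditive.sum_comp]
    have hh : h.1 • x.back = x'.back := h.2
    -- Reindexing the sum by right translation by `h` gives the naturality.
    refine Fintype.sum_equiv (Equiv.mulRight h.1) _ _ fun g => ?_
    rw [Category.assoc, Category.assoc]
    refine (Category.assoc _ _ _).symm.trans ((congrArg (· ≫ _) (map_arr_comp M h.1 g hh rfl)).trans ?_)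
    refine Eq.trans ?_ (congrArg (_ ≫ _ ≫ ·) (map_arr_comp N _ h.1 _ hh).symm)
    refine smul_congr_map θ ?_ _ _ _ _ rfl ?_
    · change g • x'.back = (g * h.1) • x.back
      rw [mul_smul, hh]
    · simp

theorem average_app {M N : RepCat A X} (θ : ∀ x, M.obj x ⟶ N.obj x) (x : ActionCategory G X.V) :
    (average θ).app x = ∑ g : G, M.map (arr (y := x) (y' := pt (g • x.back)) g rfl) ≫
      θ (pt (g • x.back)) ≫
        N.map (arr (y := pt (g • x.back)) (y' := x) g⁻¹ (inv_smul_smul g x.back)) := rfl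

theorem comp_average {L M N : RepCat A X} (φ : L ⟶ M) (θ : ∀ x, M.obj x ⟶ N.obj x) :
    φ ≫ average θ = average fun x => φ.app x ≫ θ x := by
  ext x
  rw [NatTrans.comp_app, average_app, average_app, Preadditive.comp_sum]
  refine Finset.sum_congr rfl fun g _ => ?_
  rw [← Category.assoc, ← φ.naturality, Category.assoc, Category.assoc]

theorem average_comp {L M N : RepCat A X} (θ : ∀ x, L.obj x ⟶ M.obj x) (φ : M ⟶ N) :
    average θ ≫ φ = average fun x => θ x ≫ φ.app x := by
  ext x
  rw [NatTrans.comp_app, average_app, average_app, Preadditive.sum_comp]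
  refine Finset.sum_congr rfl fun g _ => ?_
  rw [Category.assoc, Category.assoc, φ.naturality, Category.assoc]

/-- The identity of `V` is an average. -/
def IsAveraged (V : RepCat A X) : Prop :=
  ∃ θ : ∀ x, V.obj x ⟶ V.obj x, average θ = 𝟙 V

theorem IsAveraged.of_retract {V P : RepCat A X} (h : IsAveraged V) (i : P ⟶ V) (r : V ⟶ P)
    (hir : i ≫ r = 𝟙 P) : IsAveraged P := by
  obtain ⟨θ, hθ⟩ := h
  refine ⟨fun x => i.app x ≫ θ x ≫ r.app x, ?_⟩
  rw [← comp_average, ← average_comp, hθ, Category.id_comp, hir]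

/-- Lifts are chosen at each object of the groupoid, without compatibility; averaging `θ` followed
by these lifts makes a morphism of representations. -/
theorem IsAveraged.projective {V : RepCat A X} (h : IsAveraged V)
    (hp : ∀ {a b c : A} (f : a ⟶ c) (e : b ⟶ c) [Epi e], ∃ l : a ⟶ b, l ≫ e = f)
    [HasPushouts A] : Projective V where
  factors {N M} f e _ := by
    obtain ⟨θ, hθ⟩ := h
    have he : ∀ x, Epi (e.app x) := fun x => inferInstance
    choose l hl using fun x => hp (f.app x) (e.app x)
    refine ⟨average fun x => θ x ≫ l x, ?_⟩
    rw [average_comp]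
    simp only [Category.assoc, hl]
    rw [← average_comp, hθ, Category.id_comp]

/-- The diagonal family with entries `θ` works: the action permutes the fibres compatibly, so its
average is computed entry by entry. -/
theorem IsAveraged.push [HasFiniteBiproducts A] {Y : GSets.{w} G} (f : Y ⟶ X) {V : RepCat A Y}
    (h : IsAveraged V) : IsAveraged ((push f).obj V) := by
  obtain ⟨θ, hθ⟩ := h
  refine ⟨fun x => pushLift f V x fun y => pushπ f V x y ≫ θ (pt y.1), ?_⟩
  ext x
  refine push_hom_ext fun y => ?_
  rw [average_app, Preadditive.sum_comp, NatTrans.id_app, Category.id_comp]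
  have h' := congrArg (fun φ => φ.app (pt y.1)) hθ
  dsimp only at h'
  rw [average_app] at h'
  refine Eq.trans ?_ ((Preadditive.comp_sum _ _ _).symm.trans
    ((congrArg (pushπ f V x y ≫ ·) h').trans (Category.comp_id _)))
  refine Finset.sum_congr rfl fun g _ => ?_
  have hy : f.hom (g • y.1) = (pt (g • x.back) : ActionCategory G X.V).back :=
    (hom_smul f g y.1).trans (congrArg (g • ·) y.2)
  have h₁ : ((Sipp.push f).obj V).map (arr (y := pt (g • x.back)) (y' := x) g⁻¹
      (inv_smul_smul g x.back)) ≫ pushπ f V x y = pushπ f V (pt (g • x.back)) ⟨g • y.1, hy⟩ ≫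
        V.map (arr (y := pt (g • y.1)) (y' := pt y.1) g⁻¹ (inv_smul_smul g y.1)) :=
    pushMap_π f V _ _ y _
  have h₂ : ((Sipp.push f).obj V).map (arr (y := x) (y' := pt (g • x.back)) g rfl) ≫
      pushπ f V (pt (g • x.back)) ⟨g • y.1, hy⟩ = pushπ f V x y ≫
        V.map (arr (y := pt y.1) (y' := pt (g • y.1)) g rfl) :=
    pushMap_π f V _ y _ _
  rw [Category.assoc, Category.assoc, h₁, (reassoc_of% pushLift_π), Category.assoc, reassoc_of% h₂]
  rfl

section free
variable [HasFiniteBiproducts A] (M : RepCat A X)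

/-- The representation `M ⊗ ℤ[G]`. -/
noncomputable def freeRep : RepCat A X where
  obj x := ⨁ fun _ : G => M.obj x
  map {x x'} h := biproduct.lift fun g : G =>
    biproduct.π (fun _ : G => M.obj x) (h.1⁻¹ * g) ≫ M.map h
  map_id x := by
    refine biproduct.hom_ext _ _ fun g => ?_
    rw [biproduct.lift_π, M.map_id, Category.comp_id, Category.id_comp]
    exact congrArg _ ((congrArg (· * g) inv_one).trans (one_mul g))
  map_comp {x x' x''} h h' := by
    refine biproduct.hom_ext _ _ fun g => ?_
    rw [biproduct.lift_π, Category.assoc, biproduct.lift_π, biproduct.lift_π_assoc, M.map_comp,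
      Category.assoc]
    refine congrArg (biproduct.π (fun _ : G => M.obj x) · ≫ _) ?_
    exact (congrArg (· * g) (mul_inv_rev h'.1 h.1)).trans (mul_assoc _ _ _)

/-- The projection of `M ⊗ ℤ[G]` to the component of `g`. -/
noncomputable def freeπ (x : ActionCategory G X.V) (g : G) : (freeRep M).obj x ⟶ M.obj x :=
  biproduct.π (fun _ : G => M.obj x) g

/-- The inclusion in `M ⊗ ℤ[G]` of the component of `g`. -/
noncomputable def freeι (x : ActionCategory G X.V) (g : G) : M.obj x ⟶ (freeRep M).obj x :=
  biproduct.ι (fun _ : G => M.obj x) g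

variable {M} in
theorem freeRep_hom_ext {x : ActionCategory G X.V} {T : A} {a b : T ⟶ (freeRep M).obj x}
    (h : ∀ g, a ≫ freeπ M x g = b ≫ freeπ M x g) : a = b :=
  biproduct.hom_ext _ _ h

theorem freeι_π_self (x : ActionCategory G X.V) (g : G) : freeι M x g ≫ freeπ M x g = 𝟙 _ :=
  biproduct.ι_π_self _ _

theorem freeι_π_ne (x : ActionCategory G X.V) {g g' : G} (h : g ≠ g') :
    freeι M x g ≫ freeπ M x g' = 0 :=
  biproduct.ι_π_ne _ h

theorem freeRep_map_π {x x' : ActionCategory G X.V} (h : x ⟶ x') (g : G) :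
    (freeRep M).map h ≫ freeπ M x' g = freeπ M x (h.1⁻¹ * g) ≫ M.map h :=
  biproduct.lift_π _ _

/-- The sum map `M ⊗ ℤ[G] ⟶ M`. -/
noncomputable def ofFreeRep : freeRep M ⟶ M where
  app x := ∑ g : G, freeπ M x g
  naturality x x' h := by
    rw [Preadditive.comp_sum, Preadditive.sum_comp]
    exact Fintype.sum_equiv (Equiv.mulLeft h.1⁻¹) _ _ fun g => freeRep_map_π M h g

theorem freeι_ofFreeRep (x : ActionCategory G X.V) (g : G) :
    freeι M x g ≫ (ofFreeRep M).app x = 𝟙 _ := by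
  refine (Preadditive.comp_sum _ _ _).trans ((Finset.sum_eq_single g ?_ ?_).trans ?_)
  · intro g' _ hg
    exact freeι_π_ne M x hg.symm
  · intro h
    exact absurd (Finset.mem_univ g) h
  · exact freeι_π_self M x g

instance epi_ofFreeRep : Epi (ofFreeRep M) := by
  have h : ∀ x, Epi ((ofFreeRep M).app x) := fun x => epi_of_epi_fac (freeι_ofFreeRep M x 1)
  exact NatTrans.epi_of_epi_app _

/-- The projector on the component of `1` works, as its conjugates are the projectors on all the
components. -/
theorem isAveraged_freeRep : IsAveraged (freeRep M) := by
  refine ⟨fun x => freeπ M x 1 ≫ freeι M x 1, ?_⟩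
  ext x
  refine freeRep_hom_ext fun h => ?_
  rw [average_app, Preadditive.sum_comp, NatTrans.id_app, Category.id_comp]
  have h₁ : ∀ g : G, (freeRep M).map (arr (y := pt (g • x.back)) (y' := x) g⁻¹
      (inv_smul_smul g x.back)) ≫ freeπ M x h = freeπ M (pt (g • x.back)) (g * h) ≫
        M.map (arr (y := pt (g • x.back)) (y' := x) g⁻¹ (inv_smul_smul g x.back)) := fun g => by
    rw [freeRep_map_π]
    exact congrArg (freeπ M (pt (g • x.back)) · ≫ _) (by rw [inv_inv])
  refine (Finset.sum_eq_single h⁻¹ ?_ ?_).trans ?_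
  · intro g _ hg
    have hne : (1 : G) ≠ g * h := fun e => hg (eq_inv_of_mul_eq_one_left e.symm)
    rw [Category.assoc, Category.assoc, h₁, Category.assoc, reassoc_of% (freeι_π_ne M _ hne)]
    simp
  · intro hn
    exact absurd (Finset.mem_univ _) hn
  · have h₂ : (freeRep M).map (arr (y := x) (y' := pt (h⁻¹ • x.back)) h⁻¹ rfl) ≫
        freeπ M (pt (h⁻¹ • x.back)) 1 = freeπ M x h ≫
          M.map (arr (y := x) (y' := pt (h⁻¹ • x.back)) h⁻¹ rfl) := by
      rw [freeRep_map_π]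
      exact congrArg (freeπ M x · ≫ _) (by rw [inv_inv, mul_one])
    have h₃ : freeι M (pt (h⁻¹ • x.back)) 1 ≫ freeπ M (pt (h⁻¹ • x.back)) (h⁻¹ * h) = 𝟙 _ := by
      rw [inv_mul_cancel]
      exact freeι_π_self M _ _
    rw [Category.assoc, Category.assoc, h₁, Category.assoc, reassoc_of% h₂, reassoc_of% h₃]
    refine (congrArg (freeπ M x h ≫ ·) ?_).trans (Category.comp_id _)
    refine (map_arr_comp M _ _ _ _).trans ?_
    rw [map_arr_congr M _ (by rw [inv_inv, mul_inv_cancel] : h⁻¹⁻¹ * h⁻¹ = 1)]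
    exact map_arr_one _ _

end free

end average

/-! ### Push-forward preserves projectives over a field. -/

section field
variable {G : Type t} [Group G] {k : Type u} [Field k] {X Y : GSets.{w} G}

/-- The epimorphism `ofFreeRep P` splits, so `P` is a retract of an averaged representation. -/
theorem isAveraged_of_projective [Fintype G] {P : RepCat (ModuleCat.{u} k) X}
    (hP : Projective P) : IsAveraged P :=
  (isAveraged_freeRep P).of_retract (Projective.factorThru (𝟙 P) (ofFreeRep P)) (ofFreeRep P)
    (Projective.factorThru_comp _ _)

theorem IsAveraged.projective_rep [Fintype G] {P : RepCat (ModuleCat.{u} k) X}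
    (hP : IsAveraged P) : Projective P :=
  hP.projective fun {a _ _} f e _ =>
    have : Projective a := ModuleCat.projective_of_free (Module.Basis.ofVectorSpace k a)
    ⟨Projective.factorThru f e, Projective.factorThru_comp f e⟩

/-- Projectivity is equivalent to being averaged, a property that is visibly preserved by
push-forward. This makes push-forward defined on stable categories. -/
theorem projective_push [Finite G] (f : Y ⟶ X) (P : RepCat (ModuleCat.{u} k) Y)
    (hP : Projective P) : Projective ((push f).obj P) :=
  have := Fintype.ofFinite G
  ((isAveraged_of_projective hP).push f).projective_rep

end field

/-! ### Splitting idempotents by the Eilenberg swindle. -/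

section split
variable {D : Type*} [Category* D]

/-- An endomorphism that is a retraction followed by a section. -/
def Splits {X : D} (e : X ⟶ X) : Prop :=
  ∃ (Y : D) (i : Y ⟶ X) (r : X ⟶ Y), i ≫ r = 𝟙 Y ∧ r ≫ i = e

theorem Splits.of_comp {X Y : D} (a : X ⟶ Y) (b : Y ⟶ X)
    (hab : (a ≫ b) ≫ (a ≫ b) = a ≫ b) (h : Splits (b ≫ a)) : Splits (a ≫ b) := by
  obtain ⟨N, i, r, hir, hri⟩ := h
  refine ⟨N, i ≫ b, a ≫ r, ?_, ?_⟩
  · rw [Category.assoc, ← Category.assoc b, ← hri, Category.assoc, reassoc_of% hir, hir]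
  · rw [Category.assoc, reassoc_of% hri]
    simpa only [Category.assoc] using hab

variable [Preadditive D]

/-- The Eilenberg swindle: an idempotent `e` on `X` splits if there is an object `Y` isomorphic to
the sum of `X` and `Y`, compatibly with `e` and an idempotent of `Y`, provided that complements of
direct summands exist. -/
theorem splits_of_swindle
    (hD : ∀ {A B : D} (s : A ⟶ B) (r : B ⟶ A), s ≫ r = 𝟙 A → Splits (𝟙 B - r ≫ s))
    {X Y : D} {e : X ⟶ X} (he : e ≫ e = e) {f : Y ⟶ Y} (hf : f ≫ f = f)
    {u : X ⟶ Y} {v : Y ⟶ X} {a c : Y ⟶ Y} (huv : u ≫ v = 𝟙 X) (hca : c ≫ a = 𝟙 Y)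
    (h : v ≫ u + a ≫ c = 𝟙 Y) (hu : u ≫ f = e ≫ u)
    (ha : a ≫ f = f ≫ a) (hc : c ≫ f = f ≫ c) : Splits e := by
  have hff : (𝟙 Y - f) ≫ f = 0 := by rw [Preadditive.sub_comp, hf, Category.id_comp, sub_self]
  have hff' : f ≫ (𝟙 Y - f) = 0 := by rw [Preadditive.comp_sub, hf, Category.comp_id, sub_self]
  have hff'' : (𝟙 Y - f) ≫ (𝟙 Y - f) = 𝟙 Y - f := by
    rw [Preadditive.comp_sub, hff, Category.comp_id, sub_zero]
  -- The section is the identity on the image of `1 - f` and the shift `c` on the image of `f`. What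
  -- it misses is the image of `e` in the summand `X`.
  have h₁ : ((𝟙 Y - f) + f ≫ c) ≫ ((𝟙 Y - f) + a ≫ f) = 𝟙 Y := by
    simp only [Preadditive.add_comp, Preadditive.comp_add, hff'', Category.assoc]
    rw [← reassoc_of% hc, hff', ha, reassoc_of% hff, ← ha, reassoc_of% hca, hf]
    simp
  have h₂ : 𝟙 Y - ((𝟙 Y - f) + a ≫ f) ≫ ((𝟙 Y - f) + f ≫ c) = v ≫ e ≫ u := by
    simp only [Preadditive.add_comp, Preadditive.comp_add, hff'', Category.assoc]
    have h' : a ≫ c = 𝟙 Y - v ≫ u := eq_sub_of_add_eq' h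
    rw [reassoc_of% hff, hff', reassoc_of% hf, ← hc, reassoc_of% h', Preadditive.sub_comp,
      Category.assoc, hu]
    simp
  have h₃ : (e ≫ u) ≫ v = e := by rw [Category.assoc, huv, Category.comp_id]
  exact h₃ ▸ Splits.of_comp (e ≫ u) v (by rw [h₃, he]) (h₂ ▸ hD _ _ h₁)

end split

/-! ### The stable category is additive and idempotent complete. -/

section stab

theorem projective_sigma {C : Type u} [Category.{v} C] [HasCoproductsOfShape ℕ C] {P : C}
    (hP : Projective P) :
    Projective (∐ fun _ : ℕ => P) where
  factors f e _ := ⟨Limits.Sigma.desc fun n => Projective.factorThru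
    (Limits.Sigma.ι (fun _ : ℕ => P) n ≫ f) e, Limits.Sigma.hom_ext _ _ fun n => by simp⟩

variable {C : Type u} [Category.{v} C] [Preadditive C] [HasFiniteBiproducts C]

attribute [local instance] hasBinaryBiproducts_of_finite_biproducts

theorem stableRel_add ⦃X Y : C⦄ (f₁ f₂ g₁ g₂ : X ⟶ Y) (hf : stableRel C f₁ f₂)
    (hg : stableRel C g₁ g₂) : stableRel C (f₁ + g₁) (f₂ + g₂) := by
  obtain ⟨P, hP, i, q, h⟩ := hf
  obtain ⟨P', hP', i', q', h'⟩ := hg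
  refine ⟨P ⊞ P', inferInstance, biprod.lift i i', biprod.desc q q', ?_⟩
  rw [biprod.lift_desc, ← h, ← h']
  abel

instance congruence_stableRel : Congruence (stableRel C) where
  equivalence {X Y} :=
    { refl f := ⟨⨁ fun j : Fin 0 => j.elim0, ⟨fun _ _ _ => ⟨0, biproduct.hom_ext' _ _ fun j => j.elim0⟩⟩, 0, 0,
        by simp⟩
      symm := fun {f g} ⟨P, hP, i, q, h⟩ => ⟨P, hP, -i, q, by rw [Preadditive.neg_comp, ← h, neg_sub]⟩
      -- Transitivity is additivity: `(f + g) - (g + h) = f - h`.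
      trans := fun {f g h} hf hg => by
        obtain ⟨P, hP, i, q, e⟩ := stableRel_add _ _ _ _ hf hg
        refine ⟨P, hP, i, q, ?_⟩
        rw [← e]; abel }
  comp_left f _ _ := fun ⟨P, hP, i, q, h⟩ => ⟨P, hP, f ≫ i, q, by
    rw [← Preadditive.comp_sub, h, Category.assoc]⟩
  comp_right f := fun ⟨P, hP, i, q, h⟩ => ⟨P, hP, i, q ≫ f, by
    rw [← Preadditive.sub_comp, h, Category.assoc]⟩

noncomputable instance preadditiveStab : Preadditive (Stab C) :=
  CategoryTheory.Quotient.preadditive _ stableRel_add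

variable (C) in
/-- The functor to the stable category. -/
abbrev toStab : C ⥤ Stab C := CategoryTheory.Quotient.functor (stableRel C)

instance : (toStab C).Additive := CategoryTheory.Quotient.functor_additive _ stableRel_add

theorem toStab_eq_zero_of_factors {X P Y : C} (hP : Projective P) (i : X ⟶ P) (q : P ⟶ Y) :
    (toStab C).map (i ≫ q) = 0 :=
  CategoryTheory.Quotient.sound (stableRel C) ⟨P, hP, i, q, sub_zero _⟩

instance hasFiniteBiproducts_stab : HasFiniteBiproducts (Stab C) :=
  ⟨fun _ => ⟨fun f => inferInstanceAs (HasBiproduct fun j => (toStab C).obj (f j).as)⟩⟩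

theorem stab_map_additive {C' : Type*} [Category* C'] [Preadditive C'] [HasFiniteBiproducts C']
    (F : C ⥤ C') [F.Additive] (hF : ∀ P : C, Projective P → Projective (F.obj P)) :
    (Stab.map F hF).Additive where
  map_add := by
    rintro _ _ ⟨f⟩ ⟨g⟩
    exact congrArg (toStab C').map F.map_add

/-- Complements of direct summands exist in the stable category. -/
theorem splits_compl_stab [IsIdempotentComplete C] {A B : Stab C} (s : A ⟶ B) (r : B ⟶ A)
    (h : s ≫ r = 𝟙 A) : Splits (𝟙 B - r ≫ s) := by
  obtain ⟨A⟩ := A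
  obtain ⟨B⟩ := B
  obtain ⟨s, rfl⟩ := (toStab C).map_surjective s
  obtain ⟨r, rfl⟩ := (toStab C).map_surjective r
  have h' : (toStab C).map (s ≫ r) = (toStab C).map (𝟙 A) := h
  rw [CategoryTheory.Quotient.functor_map_eq_iff] at h'
  obtain ⟨P, hP, i, q, hiq⟩ := h'
  -- Adding the projective `P` to `B` does not change it stably and makes the retraction hold
  -- exactly in `C`, where the complement can be split.
  let s' : A ⟶ B ⊞ P := biprod.lift s i
  let r' : B ⊞ P ⟶ A := biprod.desc r (-q)
  have hsr : s' ≫ r' = 𝟙 A := by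
    rw [biprod.lift_desc, Preadditive.comp_neg, ← hiq]; abel
  obtain ⟨N, j, t, hjt, htj⟩ := IsIdempotentComplete.idempotents_split (B ⊞ P) (𝟙 _ - r' ≫ s') (by
    have h₀ : (r' ≫ s') ≫ (𝟙 _ - r' ≫ s') = 0 := by
      rw [Preadditive.comp_sub, Category.comp_id, Category.assoc, reassoc_of% hsr, sub_self]
    rw [Preadditive.sub_comp, Category.id_comp, h₀, sub_zero])
  refine ⟨(toStab C).obj N, (toStab C).map (j ≫ biprod.fst), (toStab C).map (biprod.inl ≫ t), ?_, ?_⟩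
  · have e : j ≫ t = (j ≫ biprod.fst) ≫ biprod.inl ≫ t + (j ≫ biprod.snd) ≫ biprod.inr ≫ t := by
      have := congrArg (fun φ => j ≫ φ ≫ t) (biprod.total (X := B) (Y := P))
      rw [Category.id_comp, Preadditive.add_comp, Preadditive.comp_add] at this
      simpa only [Category.assoc] using this.symm
    have e' := congrArg (toStab C).map e
    rw [Functor.map_add, toStab_eq_zero_of_factors hP, add_zero, hjt, Functor.map_comp] at e'
    exact e'.symm.trans ((toStab C).map_id N)
  · refine ((toStab C).map_comp _ _).symm.trans ?_
    have e : (biprod.inl ≫ t) ≫ j ≫ biprod.fst = 𝟙 B - r ≫ s := by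
      rw [Category.assoc, reassoc_of% htj]
      simp [s', r']
    rw [e, Functor.map_sub, Functor.map_comp]
    rfl

variable [HasCoproductsOfShape ℕ C]

/-- The swindle takes place on the countable coproduct of copies of `X`. It is formed in `C`, from a
lift `e` that is idempotent only up to a map through a projective. -/
theorem isIdempotentComplete_stab [IsIdempotentComplete C] : IsIdempotentComplete (Stab C) := by
  refine ⟨fun X e he => ?_⟩
  obtain ⟨X⟩ := X
  obtain ⟨e, rfl⟩ := (toStab C).map_surjective e
  have he' : (toStab C).map (e ≫ e) = (toStab C).map e := he
  rw [CategoryTheory.Quotient.functor_map_eq_iff] at he'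
  obtain ⟨P, hP, i, q, hiq⟩ := he'
  let F : (∐ fun _ : ℕ => X) ⟶ ∐ fun _ : ℕ => X := Limits.Sigma.map fun _ => e
  let a : (∐ fun _ : ℕ => X) ⟶ ∐ fun _ : ℕ => X :=
    Limits.Sigma.desc fun n => n.casesOn 0 fun n => Limits.Sigma.ι (fun _ : ℕ => X) n
  let c : (∐ fun _ : ℕ => X) ⟶ ∐ fun _ : ℕ => X :=
    Limits.Sigma.desc fun n => Limits.Sigma.ι (fun _ : ℕ => X) (n + 1)
  let u : X ⟶ ∐ fun _ : ℕ => X := Limits.Sigma.ι (fun _ : ℕ => X) 0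
  let v : (∐ fun _ : ℕ => X) ⟶ X := Limits.Sigma.desc fun n => n.casesOn (𝟙 X) fun n => 0
  -- The error terms factor together through the coproduct of copies of `P`, which is projective.
  have hF : F ≫ F - F = (Limits.Sigma.map fun _ => i) ≫ Limits.Sigma.map fun _ => q := by
    refine Limits.Sigma.hom_ext _ _ fun n => ?_
    simp only [F, Preadditive.comp_sub, Limits.Sigma.ι_map_assoc, Limits.Sigma.ι_map]
    rw [← reassoc_of% hiq, Preadditive.sub_comp, Category.assoc]
  have hFP : (toStab C).map F ≫ (toStab C).map F = (toStab C).map F := by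
    refine ((toStab C).map_comp _ _).symm.trans ?_
    rw [CategoryTheory.Quotient.functor_map_eq_iff]
    exact ⟨_, projective_sigma hP, _, _, hF⟩
  have huF : u ≫ F = e ≫ u := Limits.Sigma.ι_map _ _
  have huv : u ≫ v = 𝟙 X := Limits.Sigma.ι_desc _ _
  have hca : c ≫ a = 𝟙 _ := Limits.Sigma.hom_ext _ _ fun n => by simp [a, c]
  have hvu : v ≫ u + a ≫ c = 𝟙 _ := Limits.Sigma.hom_ext _ _ fun n => by
    cases n <;> simp [a, c, u, v]
  have haF : a ≫ F = F ≫ a := Limits.Sigma.hom_ext _ _ fun n => by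
    cases n <;> simp [a, F]
  have hcF : c ≫ F = F ≫ c := Limits.Sigma.hom_ext _ _ fun n => by simp [c, F]
  have hm : ∀ {A B B' A' : C} {x : A ⟶ B} {y : B ⟶ A'} {x' : A ⟶ B'} {y' : B' ⟶ A'},
      x ≫ y = x' ≫ y' → (toStab C).map x ≫ (toStab C).map y =
        (toStab C).map x' ≫ (toStab C).map y' := fun h => by
    rw [← Functor.map_comp, h, Functor.map_comp]
  have h₁ : ∀ {A B : C} {x : A ⟶ B} {y : B ⟶ A}, x ≫ y = 𝟙 A →
      (toStab C).map x ≫ (toStab C).map y = 𝟙 _ := fun h => by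
    rw [← Functor.map_comp, h, CategoryTheory.Functor.map_id]
  refine splits_of_swindle splits_compl_stab he hFP (h₁ huv) (h₁ hca) ?_ (hm huF) (hm haF) (hm hcF)
  rw [← Functor.map_comp, ← Functor.map_comp, ← Functor.map_add, hvu,
    CategoryTheory.Functor.map_id]

end stab

/-! ### Case (c): the stable category. -/

section stabKit
variable {G : Type t} [Group G] {k : Type u} [Field k]

theorem resSwap_stRep {X Y Y' Z : GSets.{w} G} {f : Y ⟶ X} {f' : Y' ⟶ X} {g : Z ⟶ Y}
    {g' : Z ⟶ Y'} (h : g ≫ f = g' ≫ f') (V : RepCat (ModuleCat.{u} k) X) :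
    resSwap (StRep G k) h ⟨V⟩ = (toStab _).map ((repSwap h).app V) := by
  have e : (repRes (ModuleCat.{u} k) f ⋙ repRes (ModuleCat.{u} k) g).obj V =
      (repRes (ModuleCat.{u} k) f' ⋙ repRes (ModuleCat.{u} k) g').obj V := by
    have h' : repRes (ModuleCat.{u} k) f ⋙ repRes (ModuleCat.{u} k) g =
        repRes (ModuleCat.{u} k) f' ⋙ repRes (ModuleCat.{u} k) g' := by
      change repRes _ (g ≫ f) = repRes _ (g' ≫ f')
      rw [h]
    rw [h']
  have h' : (repSwap h).app V = eqToHom e := repSwap_eqToHom h V _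
  rw [h', eqToHom_map]
  rfl

instance hasFiniteBiproducts_rep (X : GSets.{w} G) :
    HasFiniteBiproducts (RepCat (ModuleCat.{u} k) X) :=
  HasFiniteBiproducts.of_hasFiniteProducts

theorem isAdditivePresheaf_stRep : IsAdditivePresheaf (StRep.{w} G k) :=
  ⟨fun X => inferInstanceAs (Preadditive (Stab (RepCat (ModuleCat.{u} k) X))),
    fun X => inferInstanceAs (HasFiniteProducts (Stab (RepCat (ModuleCat.{u} k) X))),
    fun _ _ f => stab_map_additive (repRes _ f) (projective_repRes f)⟩

variable [Finite G]

/-- The push-forward functor for stable categories. -/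
noncomputable def stPush {X Y : GSets.{w} G} (f : Y ⟶ X) :
    Stab (RepCat (ModuleCat.{u} k) Y) ⥤ Stab (RepCat (ModuleCat.{u} k) X) :=
  Stab.map (push f) (projective_push f)

variable {X U : GSets.{w} G} (α : U ⟶ X)
  (c : U.V → k) (hc : ∀ (g : G) (y : U.V), c (g • y) = c y)
  (hs : ∀ x : ActionCategory G X.V, ∑ y : Fib α x, c y.1 = 1)

/-- The push-forward functors for stable categories of representations. -/
noncomputable def stKit : PushKit (StRep G k) α where
  aPush := stPush α
  pPush := stPush (pr₁ α)
  qPush := stPush (pr₁₂ α ≫ pr₁ α)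
  η := CategoryTheory.Quotient.natTransLift _ (Functor.whiskerRight (pushUnit α) (toStab _))
  ρ := CategoryTheory.Quotient.natTransLift _ (Functor.whiskerRight (pushTrace α c hc) (toStab _))
  ε := CategoryTheory.Quotient.natTransLift _ (Functor.whiskerRight (pushCounit α) (toStab _))
  η₁ := CategoryTheory.Quotient.natTransLift _
    (Functor.whiskerRight (pushUnit (pr₁ α)) (toStab _))
  ε₁ := CategoryTheory.Quotient.natTransLift _
    (Functor.whiskerRight (pushCounit (pr₁ α)) (toStab _))
  b := CategoryTheory.Quotient.natTransLift _ (Functor.whiskerRight (baseChange α α) (toStab _))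
  c₁₂ := CategoryTheory.Quotient.natTransLift _
    (Functor.whiskerRight (pushRefine (pr₁₂ α) (pr₁ α) (pr₁₂ α ≫ pr₁ α) rfl) (toStab _))
  c₁₃ := CategoryTheory.Quotient.natTransLift _ (Functor.whiskerRight
    (pushRefine (pr₁₃ α) (pr₁ α) (pr₁₂ α ≫ pr₁ α) (pr₁₃_pr₁ α)) (toStab _))
  κ := CategoryTheory.Quotient.natTransLift _ (Functor.whiskerRight (pushTriple α) (toStab _))
  η_ρ V := congrArg (toStab _).map (pushUnit_trace α c hc hs V.as)
  res_η_ε V := congrArg (toStab _).map (res_pushUnit_counit α V.as)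
  res_η₁_ε₁ W := congrArg (toStab _).map (res_pushUnit_counit (pr₁ α) W.as)
  res_b_ε W := (congrArg (_ ≫ · ≫ _) (resSwap_stRep _ _)).trans
    (congrArg (toStab _).map (res_baseChange_counit α α W.as))
  η₁_b V := (congrArg (_ ≫ (stPush (pr₁ α)).map · ≫ _) (resSwap_stRep _ _)).trans
    (congrArg (toStab _).map (unit_baseChange α α V.as))
  c₁₂_κ W := (congrArg (_ ≫ (stPush (pr₁₂ α ≫ pr₁ α)).map · ≫ _) (resSwap_stRep _ _)).trans
    (congrArg (toStab _).map (refine_triple₁₂ α W.as))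
  η₁_c W := (congrArg (_ ≫ _ ≫ (stPush (pr₁₂ α ≫ pr₁ α)).map ·) (resSwap_stRep _ _)).trans
    (congrArg (toStab _).map (unit_refine _ _ _ _ _ _ W.as))
  c₁₃_κ W := (congrArg (_ ≫ (stPush (pr₁₂ α ≫ pr₁ α)).map · ≫ _ ≫ _) (resSwap_stRep _ _)).trans
    (congrArg (toStab _).map (refine_triple₁₃ α W.as))

theorem isStrictStack_stRep (p : ℕ) [Fact p.Prime] [CharP k p] :
    IsStrictStack (StRep.{w} G k) (sippTopology G p) := fun X U α hα => by
  obtain ⟨c, hc, hs⟩ := exists_weight p (isUnit_natCast_field p k) α hα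
  have : IsIdempotentComplete ((StRep.{w} G k).obj (op X)) :=
    isIdempotentComplete_stab (C := RepCat (ModuleCat.{u} k) X)
  exact (stKit α c hc hs).isEquivalence_comparison

end stabKit

/-! ### Idempotents in pretriangulated categories. -/

section triangulated
open Pretriangulated
variable {D : Type u} [Category.{v} D]

/-- An object `Z` with its decomposition as the sum of the images of the idempotents `f` and `m`
in the idempotent completion. -/
structure ImageSum [Preadditive D] {Y M : D} (f : Y ⟶ Y) (m : M ⟶ M) where
  /-- the object -/
  Z : D
  /-- inclusion of the first summand -/
  i₁ : Y ⟶ Z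
  /-- projection to the first summand -/
  p₁ : Z ⟶ Y
  /-- inclusion of the second summand -/
  i₂ : M ⟶ Z
  /-- projection to the second summand -/
  p₂ : Z ⟶ M
  i₁_p₁ : i₁ ≫ p₁ = f
  i₂_p₂ : i₂ ≫ p₂ = m
  i₁_p₂ : i₁ ≫ p₂ = 0
  i₂_p₁ : i₂ ≫ p₁ = 0
  total : p₁ ≫ i₁ + p₂ ≫ i₂ = 𝟙 Z

namespace ImageSum
variable [Preadditive D] {Y M : D} {f : Y ⟶ Y} {m : M ⟶ M} (S : ImageSum f m)

theorem p₁_f : S.p₁ ≫ f = S.p₁ := by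
  have := congrArg (· ≫ S.p₁) S.total
  simpa [S.i₁_p₁, S.i₂_p₁] using this

theorem m_i₂ : m ≫ S.i₂ = S.i₂ := by
  have := congrArg (S.i₂ ≫ ·) S.total
  simpa [reassoc_of% S.i₂_p₂, reassoc_of% S.i₂_p₁] using this

theorem f_i₁ : f ≫ S.i₁ = S.i₁ := by
  have := congrArg (S.i₁ ≫ ·) S.total
  simpa [reassoc_of% S.i₁_p₂, reassoc_of% S.i₁_p₁] using this

end ImageSum

/-- The Eilenberg swindle with a shift. -/
theorem splits_of_imageSum [Preadditive D]
    (hD : ∀ {A B : D} (s : A ⟶ B) (r : B ⟶ A), s ≫ r = 𝟙 A → Splits (𝟙 B - r ≫ s))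
    {X Y M Y' : D} {e : X ⟶ X} (he : e ≫ e = e) {f : Y ⟶ Y} {m : M ⟶ M} {f' : Y' ⟶ Y'}
    (S : ImageSum f m) (S' : ImageSum m f') {u : X ⟶ Y} {v : Y ⟶ X} {a : Y ⟶ Y'} {c : Y' ⟶ Y}
    (huv : u ≫ v = 𝟙 X) (hca : c ≫ a = 𝟙 Y') (h : v ≫ u + a ≫ c = 𝟙 Y) (hu : u ≫ f = e ≫ u)
    (ha : a ≫ f' = f ≫ a) (hc : c ≫ f = f' ≫ c) : Splits e := by
  -- In the idempotent completion `im f = im e ⊕ im f'`, so `S.Z = im f ⊕ im m` is the sum of `S'.Z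
  -- = im m ⊕ im f'` and `im e`. Thus `S'.Z` is a direct summand of `S.Z`, with complement the image
  -- of `e`.
  have h₁ : (S'.p₁ ≫ S.i₂ + S'.p₂ ≫ c ≫ S.i₁) ≫ (S.p₂ ≫ S'.i₁ + S.p₁ ≫ a ≫ S'.i₂) = 𝟙 _ := by
    simp only [Preadditive.add_comp, Preadditive.comp_add, Category.assoc,
      reassoc_of% S.i₂_p₂, reassoc_of% S.i₂_p₁, reassoc_of% S.i₁_p₂, reassoc_of% S.i₁_p₁,
      zero_comp, comp_zero, add_zero, zero_add]
    rw [S'.f_i₁, reassoc_of% hc, reassoc_of% hca, S'.m_i₂, S'.total]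
  have h₂ : 𝟙 S.Z - (S.p₂ ≫ S'.i₁ + S.p₁ ≫ a ≫ S'.i₂) ≫ (S'.p₁ ≫ S.i₂ + S'.p₂ ≫ c ≫ S.i₁) =
      (S.p₁ ≫ v) ≫ u ≫ S.i₁ := by
    have h' : a ≫ c = 𝟙 Y - v ≫ u := eq_sub_of_add_eq' h
    simp only [Preadditive.add_comp, Preadditive.comp_add, Category.assoc,
      reassoc_of% S'.i₂_p₂, reassoc_of% S'.i₂_p₁, reassoc_of% S'.i₁_p₂, reassoc_of% S'.i₁_p₁,
      zero_comp, comp_zero, add_zero, zero_add]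
    rw [S.m_i₂, reassoc_of% ha, reassoc_of% S.p₁_f, reassoc_of% h', ← S.total]
    simp only [Preadditive.sub_comp, Preadditive.comp_sub, Category.id_comp, Category.assoc]
    abel
  have h₃ : (u ≫ S.i₁) ≫ S.p₁ ≫ v = e := by
    rw [Category.assoc, reassoc_of% S.i₁_p₁, reassoc_of% hu, huv, Category.comp_id]
  exact h₃ ▸ Splits.of_comp _ _ (by rw [h₃, he]) (h₂ ▸ hD _ _ h₁)

variable [Preadditive D] [HasZeroObject D] [HasShift D ℤ] [∀ n : ℤ, (shiftFunctor D n).Additive]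
  [Pretriangulated D]

/-- Complements of direct summands exist in a pretriangulated category. -/
theorem splits_compl {A B : D} (s : A ⟶ B) (r : B ⟶ A) (hsr : s ≫ r = 𝟙 A) :
    Splits (𝟙 B - r ≫ s) := by
  obtain ⟨N, g, h, hT⟩ := distinguished_cocone_triangle s
  have hsg : s ≫ g = 0 := comp_distTriang_mor_zero₁₂ _ hT
  -- As `s` is a split monomorphism, so is its shift, and the connecting morphism vanishes.
  have h₀ : h = 0 := by
    have h₁ : h ≫ s⟦(1 : ℤ)⟧' = 0 := comp_distTriang_mor_zero₃₁ _ hT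
    have h₂ : h ≫ s⟦(1 : ℤ)⟧' ≫ r⟦(1 : ℤ)⟧' = h := by
      rw [← Functor.map_comp, hsr, CategoryTheory.Functor.map_id, Category.comp_id]
    rw [← h₂, reassoc_of% h₁, zero_comp]
  obtain ⟨j, hj⟩ : ∃ j : N ⟶ B, 𝟙 N = j ≫ g := Triangle.coyoneda_exact₃ _ hT (𝟙 N) (by
    change 𝟙 N ≫ h = 0
    rw [h₀, comp_zero])
  obtain ⟨t, ht⟩ : ∃ t : N ⟶ B, 𝟙 B - r ≫ s = g ≫ t :=
    Triangle.yoneda_exact₂ _ hT (𝟙 B - r ≫ s) (by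
      change s ≫ (𝟙 B - r ≫ s) = 0
      rw [Preadditive.comp_sub, reassoc_of% hsr, Category.comp_id, sub_self])
  refine ⟨N, t, g, ?_, ht.symm⟩
  have h₁ : g ≫ t ≫ g = g := by
    rw [← Category.assoc, ← ht, Preadditive.sub_comp, Category.assoc, hsg, comp_zero, sub_zero,
      Category.id_comp]
  calc t ≫ g = (𝟙 N) ≫ t ≫ g := (Category.id_comp _).symm
    _ = 𝟙 N := by rw [hj, Category.assoc, h₁]

/-- Such an `n` factors through `T.mor₁`, so `n ≫ n` vanishes. This proves equalities of idempotents
although fillers of triangles are not unique. -/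
theorem eq_zero_of_distTriang {T : Triangle D} (hT : T ∈ distTriang D) {n : T.obj₂ ⟶ T.obj₂}
    (hn : n ≫ n = n) (h₁ : T.mor₁ ≫ n = 0) (h₂ : n ≫ T.mor₂ = 0) : n = 0 := by
  obtain ⟨q, hq⟩ := Triangle.coyoneda_exact₂ _ hT n h₂
  calc n = (q ≫ T.mor₁) ≫ n := by rw [← hq, hn]
    _ = 0 := by rw [Category.assoc, h₁, comp_zero]

/-- The cone of `1 - f`, for an idempotent `f` of `Y`, is the sum of the images of `f` and of the
shift of `f`. -/
theorem nonempty_imageSum {Y : D} {f : Y ⟶ Y} (hf : f ≫ f = f) :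
    Nonempty (ImageSum f (f⟦(1 : ℤ)⟧')) := by
  obtain ⟨Z, g, h, hT⟩ := distinguished_cocone_triangle (𝟙 Y - f)
  have hf' : f⟦(1 : ℤ)⟧' ≫ f⟦(1 : ℤ)⟧' = f⟦(1 : ℤ)⟧' := by rw [← Functor.map_comp, hf]
  have h₁ : (𝟙 Y - f) ≫ g = 0 := comp_distTriang_mor_zero₁₂ _ hT
  have hgh : g ≫ h = 0 := comp_distTriang_mor_zero₂₃ _ hT
  have h₃ : h ≫ (𝟙 Y - f)⟦(1 : ℤ)⟧' = 0 := comp_distTriang_mor_zero₃₁ _ hT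
  obtain ⟨k, hk⟩ : ∃ k : Z ⟶ Y, f = g ≫ k := Triangle.yoneda_exact₂ _ hT f (by
    change (𝟙 Y - f) ≫ f = 0
    rw [Preadditive.sub_comp, hf, Category.id_comp, sub_self])
  obtain ⟨l, hl⟩ : ∃ l : Y⟦(1 : ℤ)⟧ ⟶ Z, f⟦(1 : ℤ)⟧' = l ≫ h :=
    Triangle.coyoneda_exact₁ _ hT (f⟦(1 : ℤ)⟧') (by
    change f⟦(1 : ℤ)⟧' ≫ (𝟙 Y - f)⟦(1 : ℤ)⟧' = 0
    rw [← Functor.map_comp, Preadditive.comp_sub, hf, Category.comp_id, sub_self,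
      Functor.map_zero])
  have hg : f ≫ g = g := by
    rw [Preadditive.sub_comp, Category.id_comp, sub_eq_zero] at h₁
    exact h₁.symm
  have hh : h ≫ f⟦(1 : ℤ)⟧' = h := by
    rw [Functor.map_sub, Preadditive.comp_sub, CategoryTheory.Functor.map_id, Category.comp_id,
      sub_eq_zero] at h₃
    exact h₃.symm
  -- The section `l` is corrected to become orthogonal to the projection `k ≫ f` on the first
  -- summand.
  let l' := f⟦(1 : ℤ)⟧' ≫ (l - l ≫ k ≫ f ≫ g)
  have hl' : l' ≫ h = f⟦(1 : ℤ)⟧' := by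
    simp only [l', Preadditive.sub_comp, Preadditive.comp_sub, Category.assoc, hgh, comp_zero,
      sub_zero, ← hl, hf']
  have hlk : l' ≫ k ≫ f = 0 := by
    simp only [l', Preadditive.sub_comp, Preadditive.comp_sub, Category.assoc, ← reassoc_of% hk,
      hf, sub_self]
  have hfl : f⟦(1 : ℤ)⟧' ≫ l' = l' := by
    simp only [l']
    rw [reassoc_of% hf']
  have hgk : g ≫ k ≫ f = f := by rw [← reassoc_of% hk, hf]
  obtain ⟨p, hgp, hlp⟩ : ∃ p : Z ⟶ Y, g ≫ p = f ∧ l' ≫ p = 0 := ⟨k ≫ f, hgk, hlk⟩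
  have hn : 𝟙 Z - (p ≫ g + h ≫ l') = 0 := by
    have hπ : (p ≫ g + h ≫ l') ≫ (p ≫ g + h ≫ l') = p ≫ g + h ≫ l' := by
      simp only [Preadditive.add_comp, Preadditive.comp_add, Category.assoc, reassoc_of% hgh,
        reassoc_of% hgp, reassoc_of% hl', reassoc_of% hlp, hg, hfl, comp_zero, zero_comp, add_zero,
        zero_add]
    refine eq_zero_of_distTriang (rot_of_distTriang _ hT) (n := 𝟙 Z - (p ≫ g + h ≫ l')) ?_ ?_ ?_
    · change (𝟙 Z - (p ≫ g + h ≫ l')) ≫ (𝟙 Z - (p ≫ g + h ≫ l')) = 𝟙 Z - (p ≫ g + h ≫ l')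
      rw [Preadditive.sub_comp, Preadditive.comp_sub, Preadditive.comp_sub, hπ, Category.id_comp,
        Category.id_comp, Category.comp_id, sub_self, sub_zero]
    · change g ≫ (𝟙 Z - (p ≫ g + h ≫ l')) = 0
      simp only [Preadditive.comp_add, Preadditive.comp_sub, reassoc_of% hgh,
        reassoc_of% hgp, hg, zero_comp, Category.comp_id, add_zero, sub_self]
    · change (𝟙 Z - (p ≫ g + h ≫ l')) ≫ h = 0
      simp only [Preadditive.add_comp, Preadditive.sub_comp, Category.assoc, hgh, hl', hh,
        comp_zero, Category.id_comp, zero_add, sub_self]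
  exact ⟨{  Z := Z, i₁ := g, p₁ := p, i₂ := l', p₂ := h
            i₁_p₁ := hgp, i₂_p₂ := hl', i₁_p₂ := hgh, i₂_p₁ := hlp
            total := (sub_eq_zero.1 hn).symm }⟩

/-- An idempotent of the middle term of a distinguished triangle splits if it is part of an
endomorphism of the triangle with split outer components. -/
theorem splits_of_distTriang {T : Triangle D} (hT : T ∈ distTriang D) {φ : T ⟶ T}
    (h₁ : Splits φ.hom₁) (h₂ : φ.hom₂ ≫ φ.hom₂ = φ.hom₂) (h₃ : Splits φ.hom₃) :
    Splits φ.hom₂ := by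
  obtain ⟨Y₁, i₁, r₁, hir₁, hri₁⟩ := h₁
  obtain ⟨Y₃, i₃, r₃, hir₃, hri₃⟩ := h₃
  have c₁ := φ.comm₁
  have c₂ := φ.comm₂
  have c₃ := φ.comm₃
  -- The candidate image is the extension of `Y₃` by `Y₁` whose connecting morphism is that of `T`,
  -- compressed to the outer images.
  obtain ⟨Y, y₁, y₃, hS⟩ := distinguished_cocone_triangle₂ (i₃ ≫ T.mor₃ ≫ r₁⟦(1 : ℤ)⟧')
  have hi : i₃ ≫ φ.hom₃ = i₃ := by rw [← hri₃, reassoc_of% hir₃]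
  have hr : φ.hom₃ ≫ r₃ = r₃ := by rw [← hri₃, Category.assoc, hir₃, Category.comp_id]
  have hr₁ : φ.hom₁ ≫ r₁ = r₁ := by rw [← hri₁, Category.assoc, hir₁, Category.comp_id]
  obtain ⟨a, ha₁, ha₂⟩ : ∃ a : Y ⟶ T.obj₂, y₁ ≫ a = i₁ ≫ T.mor₁ ∧ y₃ ≫ i₃ = a ≫ T.mor₂ :=
    complete_distinguished_triangle_morphism₂ _ _ hS hT i₁ i₃ (by
      change (i₃ ≫ T.mor₃ ≫ r₁⟦(1 : ℤ)⟧') ≫ i₁⟦(1 : ℤ)⟧' = i₃ ≫ T.mor₃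
      rw [Category.assoc, Category.assoc, ← Functor.map_comp, hri₁, c₃, reassoc_of% hi])
  obtain ⟨b, hb₁, hb₂⟩ : ∃ b : T.obj₂ ⟶ Y, T.mor₁ ≫ b = r₁ ≫ y₁ ∧ T.mor₂ ≫ r₃ = b ≫ y₃ :=
    complete_distinguished_triangle_morphism₂ _ _ hT hS r₁ r₃ (by
      change T.mor₃ ≫ r₁⟦(1 : ℤ)⟧' = r₃ ≫ i₃ ≫ T.mor₃ ≫ r₁⟦(1 : ℤ)⟧'
      rw [reassoc_of% hri₃, ← reassoc_of% c₃, ← Functor.map_comp, hr₁])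
  let e : T.obj₂ ⟶ T.obj₂ := φ.hom₂
  have h₂' : e ≫ e = e := h₂
  have he₁ : T.mor₁ ≫ e = φ.hom₁ ≫ T.mor₁ := c₁
  have he₃ : e ≫ T.mor₂ = T.mor₂ ≫ φ.hom₃ := c₂.symm
  have e₁ : y₁ ≫ a ≫ e ≫ b = y₁ := by
    rw [reassoc_of% ha₁, reassoc_of% he₁, hb₁, ← reassoc_of% hri₁, reassoc_of% hir₁,
      reassoc_of% hir₁]
  have e₃ : (a ≫ e ≫ b) ≫ y₃ = y₃ := by
    rw [Category.assoc, Category.assoc, ← hb₂, reassoc_of% he₃, ← reassoc_of% ha₂, hr, hir₃,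
      Category.comp_id]
  let ψ : Triangle.mk y₁ y₃ (i₃ ≫ T.mor₃ ≫ r₁⟦(1 : ℤ)⟧') ⟶
      Triangle.mk y₁ y₃ (i₃ ≫ T.mor₃ ≫ r₁⟦(1 : ℤ)⟧') :=
    { hom₁ := 𝟙 Y₁
      hom₂ := a ≫ e ≫ b
      hom₃ := 𝟙 Y₃
      comm₁ := e₁.trans (Category.id_comp _).symm
      comm₂ := (Category.comp_id _).trans e₃.symm
      comm₃ := ((congrArg (_ ≫ ·) (CategoryTheory.Functor.map_id _ _)).trans
        (Category.comp_id _)).trans (Category.id_comp _).symm }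
  have hψ₁ : IsIso ψ.hom₁ := inferInstanceAs (IsIso (𝟙 Y₁))
  have hψ₃ : IsIso ψ.hom₃ := inferInstanceAs (IsIso (𝟙 Y₃))
  -- The fillers `a` and `b` need not make this composite the identity, but it is invertible by the
  -- five lemma; `θ` corrects it.
  have hψ : IsIso (a ≫ e ≫ b) := isIso₂_of_isIso₁₃ ψ hS hS hψ₁ hψ₃
  obtain ⟨θ, hθ, hθ'⟩ := hψ
  have j₁ : y₁ ≫ θ = y₁ := by
    calc y₁ ≫ θ = (y₁ ≫ a ≫ e ≫ b) ≫ θ := by rw [e₁]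
      _ = y₁ := by rw [Category.assoc, hθ, Category.comp_id]
  have j₃ : θ ≫ y₃ = y₃ := by
    calc θ ≫ y₃ = θ ≫ (a ≫ e ≫ b) ≫ y₃ := by rw [e₃]
      _ = y₃ := by rw [← Category.assoc, hθ', Category.id_comp]
  have hir : (θ ≫ a ≫ e) ≫ e ≫ b = 𝟙 Y := by
    rw [Category.assoc, Category.assoc, reassoc_of% h₂', hθ']
  refine ⟨Y, θ ≫ a ≫ e, e ≫ b, hir, ?_⟩
  have hπ : ((e ≫ b) ≫ θ ≫ a ≫ e) ≫ (e ≫ b) ≫ θ ≫ a ≫ e = (e ≫ b) ≫ θ ≫ a ≫ e := by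
    rw [Category.assoc, ← Category.assoc (θ ≫ a ≫ e), hir, Category.id_comp]
  -- The new idempotent is absorbed by `e` on both sides and agrees with it on the outer terms, so
  -- their difference is an idempotent that the triangle kills.
  refine (sub_eq_zero.1 (eq_zero_of_distTriang hT
    (n := e - (e ≫ b) ≫ θ ≫ a ≫ e) ?_ ?_ ?_)).symm
  · have hπe : ((e ≫ b) ≫ θ ≫ a ≫ e) ≫ e = (e ≫ b) ≫ θ ≫ a ≫ e := by
      simp only [Category.assoc, h₂']
    rw [Preadditive.sub_comp, Preadditive.comp_sub, Preadditive.comp_sub, hπ, h₂', ← Category.assoc e,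
      ← Category.assoc e, h₂', hπe, sub_self, sub_zero]
  · rw [Preadditive.comp_sub, Category.assoc, reassoc_of% he₁, reassoc_of% hb₁, reassoc_of% j₁,
      reassoc_of% ha₁, he₁, ← hri₁]
    simp only [Category.assoc, reassoc_of% hir₁, sub_self]
  · simp only [Preadditive.sub_comp, Category.assoc, he₃]
    rw [← reassoc_of% ha₂, reassoc_of% j₃, ← reassoc_of% hb₂, reassoc_of% he₃, ← hri₃]
    simp only [Category.assoc, reassoc_of% hir₃, sub_self]

end triangulated

/-! ### The orbit sum `F = ∐ Sⁿ T`, with `F ≅ T ⊕ S F`. -/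

section iterate
variable {K : Type u} [Category.{v} K]

/-- The iterates of an endofunctor. -/
def iterate (S : K ⥤ K) : ℕ → (K ⥤ K)
  | 0 => 𝟭 K
  | n + 1 => iterate S n ⋙ S

variable (S T : K ⥤ K)

/-- The family of the objects `Sⁿ T X`. -/
abbrev iterFam (X : K) (n : ℕ) : K := (iterate S n).obj (T.obj X)

variable [hST : ∀ X, HasCoproduct (iterFam S T X)]

/-- The functor `X ↦ ∐ Sⁿ T X`. -/
noncomputable def orbitSum : K ⥤ K where
  obj X := ∐ iterFam S T X
  map f := Limits.Sigma.map fun n => (iterate S n).map (T.map f)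
  map_id X := Limits.Sigma.hom_ext _ _ fun n => by simp
  map_comp f g := Limits.Sigma.hom_ext _ _ fun n => by simp

/-- The inclusion of the summand `Sⁿ T X`. -/
noncomputable def orbitι (X : K) (n : ℕ) : (iterate S n).obj (T.obj X) ⟶ (orbitSum S T).obj X :=
  Limits.Sigma.ι (iterFam S T X) n

/-- The inclusion of the first summand. -/
noncomputable def orbitIn : T ⟶ orbitSum S T where
  app X := orbitι S T X 0
  naturality _ _ f := (Limits.Sigma.ι_map (fun n => (iterate S n).map (T.map f)) 0).symm

/-- The inclusion of the summand `Sⁿ⁺¹ T X`. -/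
noncomputable def orbitSucc (X : K) (n : ℕ) :
    S.obj ((iterate S n).obj (T.obj X)) ⟶ (orbitSum S T).obj X :=
  orbitι S T X (n + 1)

/-- The morphism from `∐ Sⁿ T X` with given components. -/
noncomputable def orbitDesc {X Z : K} (k : T.obj X ⟶ Z)
    (l : ∀ n, S.obj ((iterate S n).obj (T.obj X)) ⟶ Z) : (orbitSum S T).obj X ⟶ Z :=
  Limits.Sigma.desc fun
    | 0 => k
    | n + 1 => l n

variable {S T} in
theorem orbit_hom_ext {X Z : K} {f g : (orbitSum S T).obj X ⟶ Z}
    (h : (orbitIn S T).app X ≫ f = (orbitIn S T).app X ≫ g)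
    (h' : ∀ n, orbitSucc S T X n ≫ f = orbitSucc S T X n ≫ g) : f = g :=
  Limits.Sigma.hom_ext _ _ fun
    | 0 => h
    | n + 1 => h' n

variable {S T} in
theorem orbitIn_desc {X Z : K} (k : T.obj X ⟶ Z)
    (l : ∀ n, S.obj ((iterate S n).obj (T.obj X)) ⟶ Z) :
    (orbitIn S T).app X ≫ orbitDesc S T k l = k :=
  Limits.Sigma.ι_desc _ _

variable {S T} in
theorem orbitSucc_desc {X Z : K} (k : T.obj X ⟶ Z)
    (l : ∀ n, S.obj ((iterate S n).obj (T.obj X)) ⟶ Z) (n : ℕ) :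
    orbitSucc S T X n ≫ orbitDesc S T k l = l n :=
  Limits.Sigma.ι_desc _ _

theorem orbitι_map {X Y : K} (f : X ⟶ Y) (n : ℕ) :
    orbitι S T X n ≫ (orbitSum S T).map f = (iterate S n).map (T.map f) ≫ orbitι S T Y n :=
  Limits.Sigma.ι_map (fun n => (iterate S n).map (T.map f)) n

theorem orbitSucc_map {X Y : K} (f : X ⟶ Y) (n : ℕ) :
    orbitSucc S T X n ≫ (orbitSum S T).map f =
      S.map ((iterate S n).map (T.map f)) ≫ orbitSucc S T Y n :=
  orbitι_map S T f (n + 1)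

section
variable [S.IsEquivalence]

/-- The functor `S` preserves the coproduct `∐ Sⁿ T X`. -/
noncomputable def orbitIsColimit (X : K) :
    IsColimit (Cofan.mk (S.obj ((orbitSum S T).obj X)) fun n => S.map (orbitι S T X n)) :=
  isColimitCofanMkObjOfIsColimit S _ _ (coproductIsCoproduct (iterFam S T X))

variable {S T} in
theorem map_orbit_hom_ext {X Z : K} {f g : S.obj ((orbitSum S T).obj X) ⟶ Z}
    (h : ∀ n, S.map (orbitι S T X n) ≫ f = S.map (orbitι S T X n) ≫ g) : f = g :=
  Cofan.IsColimit.hom_ext (orbitIsColimit S T X) _ _ h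

/-- The inclusion of the summands other than the first. -/
noncomputable def orbitUntail : orbitSum S T ⋙ S ⟶ orbitSum S T where
  app X := Cofan.IsColimit.desc (orbitIsColimit S T X) fun n => orbitSucc S T X n
  naturality X Y f := map_orbit_hom_ext fun n => by
    have h : ∀ X n, S.map (orbitι S T X n) ≫ Cofan.IsColimit.desc (orbitIsColimit S T X)
        (fun n => orbitSucc S T X n) = orbitSucc S T X n :=
      fun X n => Cofan.IsColimit.fac (orbitIsColimit S T X) _ _
    rw [Functor.comp_map, ← Category.assoc, ← S.map_comp, orbitι_map, S.map_comp, Category.assoc,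
      h, reassoc_of% h, orbitSucc_map]

theorem orbitι_untail (X : K) (n : ℕ) :
    S.map (orbitι S T X n) ≫ (orbitUntail S T).app X = orbitSucc S T X n :=
  Cofan.IsColimit.fac (orbitIsColimit S T X) _ _

end

variable [Preadditive K]

/-- The projection to the first summand. -/
noncomputable def orbitOut : orbitSum S T ⟶ T where
  app X := orbitDesc S T (𝟙 _) fun _ => 0
  naturality X Y f := by
    refine orbit_hom_ext ?_ fun n => ?_
    · rw [← reassoc_of% (orbitIn S T).naturality, orbitIn_desc, reassoc_of% orbitIn_desc,
        Category.comp_id, Category.id_comp]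
    · rw [reassoc_of% orbitSucc_map, orbitSucc_desc, reassoc_of% orbitSucc_desc, comp_zero,
        zero_comp]

/-- The projection to the summands other than the first. -/
noncomputable def orbitTail : orbitSum S T ⟶ orbitSum S T ⋙ S where
  app X := orbitDesc S T 0 fun n => S.map (orbitι S T X n)
  naturality X Y f := by
    refine orbit_hom_ext ?_ fun n => ?_
    · rw [← reassoc_of% (orbitIn S T).naturality, orbitIn_desc, reassoc_of% orbitIn_desc,
        comp_zero, zero_comp]
    · rw [reassoc_of% orbitSucc_map, orbitSucc_desc, reassoc_of% orbitSucc_desc, Functor.comp_map,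
        ← S.map_comp, ← S.map_comp, orbitι_map]

variable (X : K)

theorem orbitIn_out : (orbitIn S T).app X ≫ (orbitOut S T).app X = 𝟙 _ :=
  orbitIn_desc _ _

theorem orbitSucc_tail (n : ℕ) :
    orbitSucc S T X n ≫ (orbitTail S T).app X = S.map (orbitι S T X n) :=
  orbitSucc_desc _ _ _

theorem orbitUntail_tail [S.IsEquivalence] :
    (orbitUntail S T).app X ≫ (orbitTail S T).app X = 𝟙 _ :=
  map_orbit_hom_ext fun n => by
    rw [reassoc_of% orbitι_untail, orbitSucc_tail]
    exact (Category.comp_id _).symm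

/-- With `orbitIn_out` and `orbitUntail_tail`, this gives the decomposition `F ≅ T ⊕ S F` naturally,
so that it passes to a localization. -/
theorem orbit_total [S.IsEquivalence] : (orbitOut S T).app X ≫ (orbitIn S T).app X +
    (orbitTail S T).app X ≫ (orbitUntail S T).app X = 𝟙 _ := by
  have h₁ : (orbitIn S T).app X ≫ (orbitTail S T).app X = 0 := orbitIn_desc _ _
  have h₂ : ∀ n, orbitSucc S T X n ≫ (orbitOut S T).app X = 0 := fun n => orbitSucc_desc _ _ _
  refine orbit_hom_ext ?_ fun n => ?_
  · rw [Preadditive.comp_add, reassoc_of% orbitIn_out, reassoc_of% h₁, zero_comp, add_zero,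
      Category.comp_id]
  · rw [Preadditive.comp_add, reassoc_of% h₂, reassoc_of% orbitSucc_tail, orbitι_untail, zero_comp,
      zero_add, Category.comp_id]

end iterate

/-! ### Orbit sums of truncated complexes under even shifts. -/

section

theorem hasCoproduct_of_isZero {C : Type u} [Category.{v} C] [HasZeroMorphisms C]
    [HasFiniteCoproducts C] (Z : ℕ → C) (N : ℕ) (hZ : ∀ n, N ≤ n → IsZero (Z n)) :
    HasCoproduct Z := by
  let ι : ∀ n, Z n ⟶ ∐ fun i : Fin N => Z i := fun n =>
    if h : n < N then Limits.Sigma.ι (fun i : Fin N => Z i) ⟨n, h⟩ else 0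
  have hι : ∀ i : Fin N, ι i = Limits.Sigma.ι (fun i : Fin N => Z i) i := fun i => dif_pos i.2
  let d : ∀ s : Cofan Z, (∐ fun i : Fin N => Z i) ⟶ s.pt := fun s =>
    Limits.Sigma.desc fun i : Fin N => s.inj i
  have hd : ∀ s n, ι n ≫ d s = s.inj n := fun s n => by
    by_cases h : n < N
    · exact (congrArg (· ≫ d s) (hι ⟨n, h⟩)).trans (Limits.Sigma.ι_desc _ _)
    · exact (hZ n (not_lt.1 h)).eq_of_src _ _
  exact ⟨⟨⟨Cofan.mk _ ι, Cofan.IsColimit.mk _ d hd fun s m hm => Limits.Sigma.hom_ext _ _ fun i =>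
    ((congrArg (· ≫ m) (hι i)).symm.trans (hm i)).trans
      (Limits.Sigma.ι_desc (fun i : Fin N => s.inj i) i).symm⟩⟩⟩

theorem isIso_of_total {D : Type*} [Category* D] [Preadditive D] {A B A₁ A₂ B₁ B₂ : D}
    {u : A₁ ⟶ A} {v : A ⟶ A₁} {c : A₂ ⟶ A} {a : A ⟶ A₂} {u' : B₁ ⟶ B} {v' : B ⟶ B₁}
    {c' : B₂ ⟶ B} {a' : B ⟶ B₂} (h : v ≫ u + a ≫ c = 𝟙 A) (h' : v' ≫ u' + a' ≫ c' = 𝟙 B)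
    (φ : A ⟶ B) (φ₁ : A₁ ⟶ B₁) (φ₂ : A₂ ⟶ B₂) [IsIso φ₁] [IsIso φ₂] (hu : φ₁ ≫ u' = u ≫ φ)
    (hv : φ ≫ v' = v ≫ φ₁) (hc : φ₂ ≫ c' = c ≫ φ) (ha : φ ≫ a' = a ≫ φ₂) : IsIso φ := by
  refine ⟨v' ≫ inv φ₁ ≫ u + a' ≫ inv φ₂ ≫ c, ?_, ?_⟩
  · rw [Preadditive.comp_add, reassoc_of% hv, reassoc_of% ha, IsIso.hom_inv_id_assoc,
      IsIso.hom_inv_id_assoc, h]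
  · rw [Preadditive.add_comp, Category.assoc, Category.assoc, Category.assoc, Category.assoc, ← hu,
      ← hc, IsIso.inv_hom_id_assoc, IsIso.inv_hom_id_assoc, h']

variable {C : Type u} [Category.{v} C] [Abelian C]

/-- The square of the shift by `ε` on complexes. -/
abbrev shiftTwice (C : Type u) [Category.{v} C] [Abelian C] (ε : ℤ) :
    CochainComplex C ℤ ⥤ CochainComplex C ℤ :=
  shiftFunctor _ ε ⋙ shiftFunctor _ ε

theorem isZero_iterate_shiftTwice (ε : ℤ) (K : CochainComplex C ℤ) (n : ℕ) (i : ℤ)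
    (h : IsZero (K.X (i + 2 * ε * n))) :
    IsZero (((iterate (shiftTwice C ε) n).obj K).X i) := by
  induction n generalizing i with
  | zero => exact (show i + 2 * ε * (0 : ℕ) = i by simp) ▸ h
  | succ n ih =>
    refine ih (i + ε + ε) ?_
    convert h using 2
    push_cast
    ring

variable {ε : ℤ} {T : CochainComplex C ℤ ⥤ CochainComplex C ℤ}

theorem hasColimit_eval_iterFam (hε : ε * ε = 1)
    (hT : ∀ K i, 0 < ε * i → IsZero ((T.obj K).X i)) (K : CochainComplex C ℤ) (i : ℤ) :
    HasColimit (Discrete.functor (iterFam (shiftTwice C ε) T K) ⋙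
      HomologicalComplex.eval C (ComplexShape.up ℤ) i) := by
  have : HasCoproduct fun n => (iterFam (shiftTwice C ε) T K n).X i := by
    -- The `n`-th summand is zero in degree `i` once `ε * i + 2 * n` is positive, which this bound
    -- guarantees.
    refine hasCoproduct_of_isZero _ ((-(ε * i)).toNat + 1) fun n hn => ?_
    refine isZero_iterate_shiftTwice ε _ n i (hT _ _ ?_)
    have h₁ : ε * (i + 2 * ε * n) = ε * i + 2 * n := by linear_combination 2 * (n : ℤ) * hε
    rw [h₁]
    omega
  let e : Discrete.functor (iterFam (shiftTwice C ε) T K) ⋙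
      HomologicalComplex.eval C (ComplexShape.up ℤ) i ≅
        Discrete.functor fun n => (iterFam (shiftTwice C ε) T K n).X i :=
    Discrete.natIso fun _ => Iso.refl _
  exact hasColimit_of_iso e

theorem hasCoproduct_iterFam (hε : ε * ε = 1)
    (hT : ∀ K i, 0 < ε * i → IsZero ((T.obj K).X i)) (K : CochainComplex C ℤ) :
    HasCoproduct (iterFam (shiftTwice C ε) T K) := by
  have := hasColimit_eval_iterFam hε hT K
  infer_instance

theorem isZero_orbitSum (hε : ε * ε = 1)
    (hT : ∀ K i, 0 < ε * i → IsZero ((T.obj K).X i))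
    [∀ K, HasCoproduct (iterFam (shiftTwice C ε) T K)]
    (K : CochainComplex C ℤ) (i : ℤ) (hi : 0 < ε * i) :
    IsZero (((orbitSum (shiftTwice C ε) T).obj K).X i) := by
  have := hasColimit_eval_iterFam hε hT K
  rw [IsZero.iff_id_eq_zero]
  refine (isColimitOfPreserves (HomologicalComplex.eval C (ComplexShape.up ℤ) i)
    (colimit.isColimit (Discrete.functor (iterFam (shiftTwice C ε) T K)))).hom_ext fun ⟨n⟩ => ?_
  refine IsZero.eq_of_src (isZero_iterate_shiftTwice ε (T.obj K) n i (hT _ _ ?_)) _ _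
  have h₁ : ε * (i + 2 * ε * n) = ε * i + 2 * n := by linear_combination 2 * (n : ℤ) * hε
  rw [h₁]
  omega

theorem quasiIso_orbitSum_map (hε : ε * ε = 1)
    (hT : ∀ K i, 0 < ε * i → IsZero ((T.obj K).X i))
    [∀ K, HasCoproduct (iterFam (shiftTwice C ε) T K)]
    {K L : CochainComplex C ℤ} (f : K ⟶ L) [QuasiIso (T.map f)] :
    QuasiIso ((orbitSum (shiftTwice C ε) T).map f) := by
  -- Induction towards the vanishing range `0 < ε * i`: by `F ≅ T ⊕ F[2ε]`, degree `i` follows from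
  -- `T` and from degree `i + 2ε`. No exactness of infinite coproducts is used.
  have key : ∀ (m : ℕ) (i : ℤ), 0 < ε * i + 2 * m →
      QuasiIsoAt ((orbitSum (shiftTwice C ε) T).map f) i := by
    intro m
    induction m with
    | zero =>
      intro i hi
      have h : ∀ K, ((orbitSum (shiftTwice C ε) T).obj K).ExactAt i := fun K =>
        ShortComplex.exact_of_isZero_X₂ _ (isZero_orbitSum hε hT K i (by simpa using hi))
      exact (quasiIsoAt_iff_exactAt _ _ (h K)).2 (h L)
    | succ m ih =>
      intro i hi
      have h₁ : QuasiIsoAt ((shiftTwice C ε).map ((orbitSum (shiftTwice C ε) T).map f)) i := by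
        refine (CochainComplex.quasiIsoAt_shift_iff _ _ _ _ rfl).2
          ((CochainComplex.quasiIsoAt_shift_iff _ _ _ _ rfl).2 (ih _ ?_))
        push_cast at hi
        have : ε * (ε + (ε + i)) = ε * i + 2 := by linear_combination 2 * hε
        rw [this]
        linarith
      rw [quasiIsoAt_iff_isIso_homologyMap] at h₁ ⊢
      have h₂ : IsIso (HomologicalComplex.homologyMap (T.map f) i) := inferInstance
      let H := HomologicalComplex.homologyFunctor C (ComplexShape.up ℤ) i
      have ht : ∀ K, H.map ((orbitOut (shiftTwice C ε) T).app K) ≫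
          H.map ((orbitIn (shiftTwice C ε) T).app K) + H.map ((orbitTail (shiftTwice C ε) T).app K) ≫
            H.map ((orbitUntail (shiftTwice C ε) T).app K) = 𝟙 _ := fun K => by
        rw [← H.map_comp, ← H.map_comp, ← H.map_add, orbit_total, H.map_id]
      have hn : ∀ {F F' : CochainComplex C ℤ ⥤ CochainComplex C ℤ} (τ : F ⟶ F'),
          H.map (F.map f) ≫ H.map (τ.app L) = H.map (τ.app K) ≫ H.map (F'.map f) := fun τ => by
        rw [← H.map_comp, ← H.map_comp, τ.naturality]
      exact @isIso_of_total _ _ _ _ _ _ _ _ _ _ _ _ _ _ _ _ _ (ht K) (ht L)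
        (H.map ((orbitSum (shiftTwice C ε) T).map f)) _ _ h₂ h₁
        (hn (orbitIn (shiftTwice C ε) T)) (hn (orbitOut (shiftTwice C ε) T))
        (hn (orbitUntail (shiftTwice C ε) T)) (hn (orbitTail (shiftTwice C ε) T))
  refine ⟨fun i => ?_⟩
  exact key ((-(ε * i)).toNat + 1) i (by omega)

end

/-! ### Transport of splittings and image sums. -/

section

theorem Splits.of_conj {D : Type*} [Category* D] {X Y : D} {e : X ⟶ X} {f : Y ⟶ Y}
    (he : e ≫ e = e) (j : X ⟶ Y) [IsIso j] (h : e ≫ j = j ≫ f) (hf : Splits f) : Splits e := by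
  have h₁ : e = j ≫ f ≫ inv j := by rw [← reassoc_of% h, IsIso.hom_inv_id, Category.comp_id]
  have h₂ : (f ≫ inv j) ≫ j = f := by rw [Category.assoc, IsIso.inv_hom_id, Category.comp_id]
  rw [h₁] at he ⊢
  exact Splits.of_comp _ _ he (h₂.symm ▸ hf)

/-- The two summands may be exchanged. -/
def ImageSum.swap {D : Type*} [Category* D] [Preadditive D] {Y M : D} {f : Y ⟶ Y} {m : M ⟶ M}
    (S : ImageSum f m) : ImageSum m f :=
  ⟨S.Z, S.i₂, S.p₂, S.i₁, S.p₁, S.i₂_p₂, S.i₁_p₁, S.i₂_p₁, S.i₁_p₂, by rw [add_comm, S.total]⟩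

/-- Transport of the second idempotent along an isomorphism. -/
def ImageSum.ofIso {D : Type*} [Category* D] [Preadditive D] {Y M M' : D} {f : Y ⟶ Y}
    {m : M ⟶ M} {m' : M' ⟶ M'} (S : ImageSum f m) (j : M ≅ M') (h : m ≫ j.hom = j.hom ≫ m') :
    ImageSum f m' where
  Z := S.Z
  i₁ := S.i₁
  p₁ := S.p₁
  i₂ := j.inv ≫ S.i₂
  p₂ := S.p₂ ≫ j.hom
  i₁_p₁ := S.i₁_p₁
  i₂_p₂ := by rw [Category.assoc, reassoc_of% S.i₂_p₂, h, Iso.inv_hom_id_assoc]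
  i₁_p₂ := by rw [reassoc_of% S.i₁_p₂, zero_comp]
  i₂_p₁ := by rw [Category.assoc, S.i₂_p₁, comp_zero]
  total := by rw [Category.assoc, Iso.hom_inv_id_assoc, S.total]

/-- For `ε = -1`, the cone construction is applied to `f⟦-1⟧'`, whose shift by `1` is `f`. -/
theorem nonempty_imageSum_shift {D : Type u} [Category.{v} D] [Preadditive D] [HasZeroObject D]
    [HasShift D ℤ] [∀ n : ℤ, (shiftFunctor D n).Additive] [Pretriangulated D] {ε : ℤ}
    (hε : ε * ε = 1) {Y : D} {f : Y ⟶ Y} (hf : f ≫ f = f) :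
    Nonempty (ImageSum f (f⟦ε⟧')) := by
  obtain rfl | rfl := (mul_self_eq_one_iff).1 hε
  · exact nonempty_imageSum hf
  · have hf' : f⟦(-1 : ℤ)⟧' ≫ f⟦(-1 : ℤ)⟧' = f⟦(-1 : ℤ)⟧' := by rw [← Functor.map_comp, hf]
    obtain ⟨S⟩ := nonempty_imageSum hf'
    exact ⟨(S.ofIso ((shiftFunctorCompIsoId D (-1 : ℤ) 1 (by simp)).app Y)
      ((shiftFunctorCompIsoId D (-1 : ℤ) 1 (by simp)).hom.naturality f)).swap⟩

end

/-! ### The derived category of an abelian category is idempotent complete. -/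

section
variable {C : Type u} [Category.{v} C] [Abelian C] [HasDerivedCategory.{w} C]

/-- The localization functor commutes with the square of the shift by `ε`. -/
noncomputable def shiftTwiceIso (ε : ℤ) :
    shiftTwice C ε ⋙ DerivedCategory.Q ≅ DerivedCategory.Q ⋙
      (shiftFunctor (DerivedCategory C) ε ⋙ shiftFunctor (DerivedCategory C) ε) :=
  Functor.isoWhiskerLeft (shiftFunctor (CochainComplex C ℤ) ε) (DerivedCategory.Q.commShiftIso ε) ≪≫
    Functor.isoWhiskerRight (DerivedCategory.Q.commShiftIso ε) (shiftFunctor (DerivedCategory C) ε)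

theorem isInvertedBy_comp_Q {T : CochainComplex C ℤ ⥤ CochainComplex C ℤ}
    (hTq : ∀ {K L} (f : K ⟶ L) [QuasiIso f], QuasiIso (T.map f)) :
    (HomologicalComplex.quasiIso C (ComplexShape.up ℤ)).IsInvertedBy
      (T ⋙ (DerivedCategory.Q : _ ⥤ DerivedCategory C)) := fun _ _ f (_ : QuasiIso f) =>
  have := hTq f
  inferInstanceAs (IsIso (DerivedCategory.Q.map (T.map f)))

/-- An idempotent of the derived category splits after a truncation functor `T`, by the swindle
with the coproduct of the even shifts of the values of `T`. -/
theorem splits_lift_map {ε : ℤ} (hε : ε * ε = 1)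
    {T : CochainComplex C ℤ ⥤ CochainComplex C ℤ}
    (hT : ∀ K i, 0 < ε * i → IsZero ((T.obj K).X i))
    (hTq : ∀ {K L} (f : K ⟶ L) [QuasiIso f], QuasiIso (T.map f))
    {X : DerivedCategory C} {e : X ⟶ X} (he : e ≫ e = e) :
    Splits ((Localization.lift (T ⋙ (DerivedCategory.Q : _ ⥤ DerivedCategory C))
      (isInvertedBy_comp_Q hTq) DerivedCategory.Q).map e) := by
  have := hasCoproduct_iterFam hε hT
  let S := shiftTwice C ε
  let F := orbitSum S T
  let Q : CochainComplex C ℤ ⥤ DerivedCategory C := DerivedCategory.Q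
  let W := HomologicalComplex.quasiIso C (ComplexShape.up ℤ)
  have hF : ∀ {K L} (f : K ⟶ L) [QuasiIso f], QuasiIso (F.map f) := fun f _ => by
    have := hTq f
    exact quasiIso_orbitSum_map hε hT f
  let T' := Localization.lift (T ⋙ Q) (isInvertedBy_comp_Q hTq) DerivedCategory.Q
  let F' := Localization.lift (F ⋙ Q) (isInvertedBy_comp_Q hF) DerivedCategory.Q
  let s := shiftFunctor (DerivedCategory C) ε
  let σ : (F ⋙ S) ⋙ Q ≅ (F ⋙ Q) ⋙ (s ⋙ s) := Functor.isoWhiskerLeft F (shiftTwiceIso ε)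
  let u : T ⋙ Q ⟶ F ⋙ Q := Functor.whiskerRight (orbitIn S T) Q
  let v : F ⋙ Q ⟶ T ⋙ Q := Functor.whiskerRight (orbitOut S T) Q
  let a : F ⋙ Q ⟶ (F ⋙ Q) ⋙ (s ⋙ s) := Functor.whiskerRight (orbitTail S T) Q ≫ σ.hom
  let c : (F ⋙ Q) ⋙ (s ⋙ s) ⟶ F ⋙ Q := σ.inv ≫ Functor.whiskerRight (orbitUntail S T) Q
  have huv : u ≫ v = 𝟙 _ := by
    ext K
    exact (Q.map_comp _ _).symm.trans ((congrArg Q.map (orbitIn_out S T K)).trans (Q.map_id _))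
  have htt : Functor.whiskerRight (orbitUntail S T) Q ≫ Functor.whiskerRight (orbitTail S T) Q =
      𝟙 _ := by
    ext K
    exact (Q.map_comp _ _).symm.trans ((congrArg Q.map (orbitUntail_tail S T K)).trans (Q.map_id _))
  have hca : c ≫ a = 𝟙 _ := by
    simp only [c, a, Category.assoc]
    rw [reassoc_of% htt, Iso.inv_hom_id]
  have hac : a ≫ c = Functor.whiskerRight (orbitTail S T) Q ≫
      Functor.whiskerRight (orbitUntail S T) Q := by
    simp only [c, a, Category.assoc, Iso.hom_inv_id_assoc]
  have htot : ∀ K, (v ≫ u).app K + (a ≫ c).app K = 𝟙 _ := fun K => by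
    rw [hac]
    refine (congrArg₂ (· + ·) (Q.map_comp _ _).symm (Q.map_comp _ _).symm).trans ?_
    exact (Q.map_add ..).symm.trans ((congrArg Q.map (orbit_total S T K)).trans (Q.map_id _))
  -- The decomposition of the orbit sum descends to the derived category as natural transformations.
  -- The localization functor is not required to preserve the coproduct.
  let u' := Localization.liftNatTrans Q W _ _ T' F' u
  let v' := Localization.liftNatTrans Q W _ _ F' T' v
  let a' := Localization.liftNatTrans Q W _ _ F' (F' ⋙ (s ⋙ s)) a
  let c' := Localization.liftNatTrans Q W _ _ (F' ⋙ (s ⋙ s)) F' c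
  have huv' : u' ≫ v' = 𝟙 _ := by
    simp only [u', v', Localization.comp_liftNatTrans, huv, Localization.liftNatTrans_id]
  have hca' : c' ≫ a' = 𝟙 _ := by
    simp only [c', a', Localization.comp_liftNatTrans, hca, Localization.liftNatTrans_id]
  have htot' : v' ≫ u' + a' ≫ c' = 𝟙 _ := by
    refine Localization.natTrans_ext Q W fun K => ?_
    simp only [v', u', a', c', Localization.comp_liftNatTrans, NatTrans.app_add,
      Localization.liftNatTrans_app, ← Preadditive.comp_add, ← Preadditive.add_comp, htot]
    erw [Category.id_comp, Iso.hom_inv_id_app]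
    rfl
  have hf : F'.map e ≫ F'.map e = F'.map e := by rw [← F'.map_comp, he]
  have hf₁ : (F'.map e)⟦ε⟧' ≫ (F'.map e)⟦ε⟧' = (F'.map e)⟦ε⟧' := by rw [← Functor.map_comp, hf]
  -- The objects `im f ⊕ im f[ε]` and `im f[ε] ⊕ im f[2ε]` share a summand. This is why the orbit
  -- sum runs over even shifts.
  obtain ⟨I⟩ := nonempty_imageSum_shift hε hf
  obtain ⟨I'⟩ := nonempty_imageSum_shift hε hf₁
  exact splits_of_imageSum splits_compl (by rw [← Functor.map_comp, he]) I I'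
    (congrArg (NatTrans.app · X) huv') (congrArg (NatTrans.app · X) hca')
    (congrArg (NatTrans.app · X) htot') (u'.naturality e).symm (a'.naturality e).symm
    (c'.naturality e).symm

/-- The truncation map is an isomorphism at `X`, so `e` is conjugate to its truncation. -/
theorem splits_of_isLE (X : DerivedCategory C) [X.IsLE 0] {e : X ⟶ X} (he : e ≫ e = e) :
    Splits e := by
  let T := (ComplexShape.embeddingUpIntLE 0).truncLEFunctor C
  have hTq : ∀ {K L} (f : K ⟶ L) [QuasiIso f], QuasiIso (T.map f) := fun f _ =>
    (CochainComplex.quasiIso_truncLEMap_iff f 0).2 fun _ _ => inferInstance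
  have h := splits_lift_map (ε := 1) (T := T) (by simp) (fun K i hi =>
    CochainComplex.isZero_of_isStrictlyLE (K.truncLE 0) 0 i (by simpa using hi)) hTq he
  let Q : CochainComplex C ℤ ⥤ DerivedCategory C := DerivedCategory.Q
  let W := HomologicalComplex.quasiIso C (ComplexShape.up ℤ)
  let T' := Localization.lift (T ⋙ Q) (isInvertedBy_comp_Q hTq) DerivedCategory.Q
  let τ : T ⋙ Q ⟶ Q := Functor.whiskerRight ((ComplexShape.embeddingUpIntLE 0).ιTruncLENatTrans C) Q
  let τ' := Localization.liftNatTrans Q W _ _ T' (𝟭 _) τ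
  obtain ⟨K, hK, ⟨j⟩⟩ := DerivedCategory.exists_iso_Q_obj_of_isLE X 0
  have hτ : IsIso (τ.app K) := inferInstanceAs (IsIso (Q.map (K.ιTruncLE 0)))
  have hτ' : IsIso (τ'.app (Q.obj K)) := by
    rw [Localization.liftNatTrans_app]
    infer_instance
  have : IsIso (τ'.app X) := (NatTrans.isIso_app_iff_of_iso τ' j).2 hτ'
  refine Splits.of_conj he (inv (τ'.app X)) ?_ h
  rw [IsIso.eq_inv_comp, ← Category.assoc, IsIso.comp_inv_eq]
  exact (τ'.naturality e).symm

theorem splits_of_isGE (X : DerivedCategory C) [X.IsGE 0] {e : X ⟶ X} (he : e ≫ e = e) :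
    Splits e := by
  let T := (ComplexShape.embeddingUpIntGE 0).truncGEFunctor C
  have hTq : ∀ {K L} (f : K ⟶ L) [QuasiIso f], QuasiIso (T.map f) := fun f _ =>
    (CochainComplex.quasiIso_truncGEMap_iff f 0).2 fun _ _ => inferInstance
  have h := splits_lift_map (ε := -1) (T := T) (by simp) (fun K i hi =>
    CochainComplex.isZero_of_isStrictlyGE (K.truncGE 0) 0 i (by simpa using hi)) hTq he
  let Q : CochainComplex C ℤ ⥤ DerivedCategory C := DerivedCategory.Q
  let W := HomologicalComplex.quasiIso C (ComplexShape.up ℤ)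
  let T' := Localization.lift (T ⋙ Q) (isInvertedBy_comp_Q hTq) DerivedCategory.Q
  let τ : Q ⟶ T ⋙ Q := Functor.whiskerRight ((ComplexShape.embeddingUpIntGE 0).πTruncGENatTrans C) Q
  let τ' := Localization.liftNatTrans Q W _ _ (𝟭 _) T' τ
  obtain ⟨K, hK, ⟨j⟩⟩ := DerivedCategory.exists_iso_Q_obj_of_isGE X 0
  have hτ : IsIso (τ.app K) := inferInstanceAs (IsIso (Q.map (K.πTruncGE 0)))
  have hτ' : IsIso (τ'.app (Q.obj K)) := by
    rw [Localization.liftNatTrans_app]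
    infer_instance
  have : IsIso (τ'.app X) := (NatTrans.isIso_app_iff_of_iso τ' j).2 hτ'
  exact Splits.of_conj he (τ'.app X) (τ'.naturality e) h

variable (C) in
/-- The derived category of an abelian category is idempotent complete. -/
theorem isIdempotentComplete_derivedCategory : IsIdempotentComplete (DerivedCategory C) where
  idempotents_split X e he := by
    let t : Triangulated.TStructure (DerivedCategory C) := DerivedCategory.TStructure.t
    have h₁ : ((t.truncLT 0).obj X).IsLE 0 := t.isLE_truncLT_obj X 0 0
    have h₂ : ((t.truncGE 0).obj X).IsGE 0 := t.isGE_truncGE_obj X 0 0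
    -- By functoriality of the truncation triangle, `e` extends to an endomorphism of the triangle
    -- whose outer components are idempotents of objects bounded on one side.
    exact splits_of_distTriang (t.triangleLTGE_distinguished 0 X)
      (φ := (t.triangleLTGE 0).map e)
      (splits_of_isLE ((t.truncLT 0).obj X)
        (((t.truncLT 0).map_comp e e).symm.trans (congrArg _ he))) he
      (splits_of_isGE ((t.truncGE 0).obj X)
        (((t.truncGE 0).map_comp e e).symm.trans (congrArg _ he)))

end

/-! ### Additive structure on `Der`. -/

section
variable {C : Type u} [Category.{v} C] [Abelian C]

/-- The additive structure of the derived category. -/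
noncomputable instance preadditiveDer : Preadditive (Der C) :=
  @DerivedCategory.instPreadditive C _ _ (HasDerivedCategory.standard C)

instance hasFiniteProducts_der : HasFiniteProducts (Der C) :=
  let := HasDerivedCategory.standard C
  (inferInstance : HasFiniteProducts (DerivedCategory C))

instance isIdempotentComplete_der : IsIdempotentComplete (Der C) :=
  let := HasDerivedCategory.standard C
  isIdempotentComplete_derivedCategory C

/-- By uniqueness of lifts to the localization, `Der.map F` is isomorphic to the additive functor
`F.mapDerivedCategory`. -/
theorem der_map_additive {C' : Type*} [Category* C'] [Abelian C'] (F : C ⥤ C') [F.Additive]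
    [F.PreservesHomology] : (Der.map F).Additive := by
  let := HasDerivedCategory.standard C
  let := HasDerivedCategory.standard C'
  have := F.preservesFiniteLimits_of_preservesHomology
  have := F.preservesFiniteColimits_of_preservesHomology
  let F' : DerivedCategory C ⥤ DerivedCategory C' := Der.map F
  let W := HomologicalComplex.quasiIso C (ComplexShape.up ℤ)
  have h : Localization.Lifting DerivedCategory.Q W
    (F.mapHomologicalComplex _ ⋙ DerivedCategory.Q) F' := ⟨eqToIso (Der.fac F)⟩
  have e : F.mapDerivedCategory ≅ F' := Localization.liftNatIso DerivedCategory.Q W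
    (F.mapHomologicalComplex _ ⋙ DerivedCategory.Q) (F.mapHomologicalComplex _ ⋙ DerivedCategory.Q)
    _ _ (Iso.refl _)
  have : F.mapDerivedCategory.Additive := inferInstance
  have := Functor.additive_of_iso e
  exact this

end

/-! ### Case (b): the derived category. -/

section
variable {G : Type t} [Group G] {A : Type u} [Category.{v} A] [Abelian A]

theorem isAdditivePresheaf_derRep : IsAdditivePresheaf (DerRep.{w} G A) :=
  ⟨fun X => (inferInstance : Preadditive (Der (RepCat A X))),
    fun X => (inferInstance : HasFiniteProducts (Der (RepCat A X))),
    fun _ _ f => der_map_additive (repRes A f)⟩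

theorem isStrictStack_derRep [Finite G] (p : ℕ) [Fact p.Prime] [Linear (ZLoc p) A] :
    IsStrictStack (DerRep.{w} G A) (sippTopology G p) := fun X U α hα => by
  obtain ⟨c, hc, hs⟩ := exists_weight p (isUnit_natCast_zLoc p) α hα
  have : IsIdempotentComplete ((DerRep.{w} G A).obj (op X)) :=
    isIdempotentComplete_der (C := RepCat A X)
  exact (derKit α c hc hs).isEquivalence_comparison

end

end Sipp

universe w v u t

open CategoryTheory Limits in
theorem mainTheorem2 (p : ℕ) [Fact p.Prime] (G : Type t) [Group G] [Finite G] :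
    (∀ (A : Type u) [Category.{v} A] [Preadditive A] [Linear (Sipp.ZLoc p) A]
        [HasFiniteProducts A] [IsIdempotentComplete A],
      Sipp.IsAdditivePresheaf (Sipp.Rep.{w} G A) ∧
      Sipp.IsStrictStack (Sipp.Rep.{w} G A) (Sipp.sippTopology G p)) ∧
    (∀ (A : Type u) [Category.{v} A] [Abelian A] [Linear (Sipp.ZLoc p) A],
      Sipp.IsAdditivePresheaf (Sipp.DerRep.{w} G A) ∧
      Sipp.IsStrictStack (Sipp.DerRep.{w} G A) (Sipp.sippTopology G p)) ∧
    (∀ (k : Type u) [Field k] [CharP k p],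
      Sipp.IsAdditivePresheaf (Sipp.StRep.{w} G k) ∧
      Sipp.IsStrictStack (Sipp.StRep.{w} G k) (Sipp.sippTopology G p)) := by
  refine ⟨fun A _ _ _ _ _ => ⟨Sipp.isAdditivePresheaf_rep, Sipp.isStrictStack_rep p⟩,
    fun A _ _ _ => ⟨Sipp.isAdditivePresheaf_derRep, Sipp.isStrictStack_derRep p⟩,
    fun k _ _ => ⟨Sipp.isAdditivePresheaf_stRep, Sipp.isStrictStack_stRep p⟩⟩
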